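/- Let $\mathbf k$ be a field and $I$ a set. **Trees.** An $I$-tree is a finite connected oriented graph without loops, in which every vertex has at least one incoming edge and exactly one outgoing edge, together with a bijection between $I$ and the set of its leaves (the edges without source). It is reduced if every vertex has at least two incoming edges. An edge is internal if it has both a source and a target; $E_t$ is the set of internal edges of $t$, and $t/E$ is the tree obtained from $t$ by contracting the edges in $E\subset E_t$. Let $\mathcal T_I$ be the category whose objects are the isomorphism classes of reduced $I$-trees, with exactly one morphism $t\to s$ if $s=t/E$ for some (necessarily unique) $E\subset E_t$, and none otherwise. Let $\mathbf k\mathcal T_I$ be its $\mathbf k$-linear span, a dg category concentrated in degree $0$. **Conventions.** Differentials have degree $-1$. A dg (co)category on the set $\mathrm{Ob}\,\mathcal T_I$ consists of complexes $\mathcal C(a,b)$, with compositions $\mathcal C(b,c)\otimes\mathcal C(a,b)\to\mathcal C(a,c)$ and units (respectively with a map $\Delta:\mathcal C(a,c)\to\bigoplus_b\mathcal C(b,c)\otimes\mathcal C(a,b)$ and counits) satisfying the (co)associativity, (co)unit and (co)Leibniz laws. It is connected if $\mathcal C(a,a)=\mathbf k$ for all $a$ and $\mathcal C(b,a)=0$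 whenever $|E_b|<|E_a|$. Write $\overline{\mathcal C}(a,b)=\mathcal C(a,b)$ if $a\ne b$ and $\overline{\mathcal C}(a,a)=0$. For a graded graph $\Gamma$, the free category and the free cocategory on $\Gamma$ both have underlying graph $(a,b)\mapsto\bigoplus_{b=x_0,\dots,x_m=a}\Gamma(x_1,x_0)\otimes\cdots\otimes\Gamma(x_m,x_{m-1})$ (where $m\ge0$, and the words with $m=0$ give $\mathbf k$ if $a=b$), with concatenation as composition, respectively deconcatenation as cocomposition. The bar construction $B(\mathcal C)$ is the free cocategory on $s\overline{\mathcal C}$, with the coderivation induced by the differential and the composition of $\mathcal C$, the composition entering by $s\alpha\otimes s\beta\mapsto(-1)^{|s\alpha|}s(\alpha\beta)$. The cobar construction $\Omega(\mathcal R)$ is the free category on $s^{-1}\overline{\mathcal R}$, with the derivation induced by the differential and the cocomposition of $\mathcal R$, the cocomposition entering by $s^{-1}\alpha\mapsto\sum(-1)^{|\alpha_{(1)}|+1}s^{-1}\alpha_{(1)}\otimes s^{-1}\alpha_{(2)}$. **The graph $K$.** If $s=t/E$ let $K(t,s)=\Lambda^{|E|}(\mathbf k[E])$, placed in degree $|E|$;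 otherwise let $K(t,s)=0$. The differential is zero. **Theorem.** 1. The formula $$\Delta(e_1\wedge\dots\wedge e_n)=\sum_{p=0}^{n}\ \sum_{\sigma\in\mathrm{Sh}_{p,n-p}}\epsilon(\sigma)\;(e_{\sigma(1)}\wedge\dots\wedge e_{\sigma(p)})\otimes(e_{\sigma(p+1)}\wedge\dots\wedge e_{\sigma(n)}),$$ for $E=\{e_1,\dots,e_n\}$ in any order, where the factors of the term of $\sigma$ lie in $K(b,s)$ and $K(t,b)$ with $b=t/\{e_{\sigma(p+1)},\dots,e_{\sigma(n)}\}$, makes $K$ a connected dg cocategory. 2. $B(\mathbf k\mathcal T_I)$ is a connected dg cocategory, and the map $$\bar\kappa(e_1\wedge\dots\wedge e_n)=\sum_{\sigma\in S_n}\epsilon(\sigma)\,(\{e_{\sigma(1)}\},\dots,\{e_{\sigma(n)}\}),$$ again for any order of $E$, is an injective morphism of dg cocategories $K\to B(\mathbf k\mathcal T_I)$. Here $(\{f_1\},\dots,\{f_n\})$ is the word whose $i$-th letter is the contraction of $f_i$ in $t/\{f_{i+1},\dots,f_n\}$. Thus $K$ is a subcocategory of $B(\mathbf k\mathcal T_I)$.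 3. $\mathbf k\mathcal T_I$ and $\Omega(K)$ are connected dg categories, and $\Omega(K)$ is a minimal resolution of $\mathbf k\mathcal T_I$: the functor $\Omega(K)\to\mathbf k\mathcal T_I$ that is the identity on objects, sends a generator $s^{-1}e$ (for one internal edge $e$ of $t$) to the morphism $t\to t/e$, and sends the generators of positive degree to $0$, is a dg functor inducing isomorphisms in homology on all complexes of morphisms; as a graded category $\Omega(K)$ is free on $s^{-1}\overline K$; and the differential of every generator is a linear combination of composites of at least two generators. -/

import Mathlib

universe u v

namespace TreeKoszul

open scoped TensorProduct DirectSum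

noncomputable section

open scoped Classical

/-! ## Reduced `I`-trees -/

/-- A reduced tree with set of leaves `I` and finite set of vertices `V`.

Every vertex has exactly one outgoing edge, so the edges of the tree are the leaves `Sum.inl i`,
which have no source, and the edges `Sum.inr v`, where `Sum.inr v` is the edge going out of `v`.
`target e` is the vertex at which the edge `e` comes in, if there is one.

`connected` says that there is a root edge `r`, which has no target, and that following the
orientation from any edge one arrives at `r`; this is connectedness together with the absence of
loops. `reduced` says that every vertex has at least two incoming edges. -/
structure TreeOn (I : Type u) (V : Type v) where
  target : I ⊕ V → Option V
  connected : ∃ r, target r = none ∧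
    ∀ e, Relation.ReflTransGen (fun e e' => ∃ v, target e = some v ∧ e' = Sum.inr v) e r
  reduced : ∀ v, {e | target e = some v}.Nontrivial

namespace TreeOn

variable {I : Type u} {V : Type v}

/-- `t.Step e e'`: the target of the edge `e` is the source of the edge `e'`. -/
def Step (t : TreeOn I V) (e e' : I ⊕ V) : Prop := ∃ v, t.target e = some v ∧ e' = Sum.inr v

/-- `t.Leads e e'`: an oriented path starting with `e` ends with `e'`. -/
def Leads (t : TreeOn I V) : I ⊕ V → I ⊕ V → Prop := Relation.ReflTransGen t.Step

/-- The edge going out of `v` is internal when it has a target (when it is not the root edge). -/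
def IsInternal (t : TreeOn I V) (v : V) : Prop := t.target (Sum.inr v) ≠ none

/-- The set of leaves that lie above the edge going out of `v`. -/
def cluster (t : TreeOn I V) (v : V) : Set I := {i | t.Leads (Sum.inl i) (Sum.inr v)}

/-- The edge going out of `v` is internal and belongs to the set `E`. -/
def IsContracted (t : TreeOn I V) (E : Set V) (v : V) : Prop := v ∈ E ∧ t.IsInternal v

theorem step_unique (t : TreeOn I V) : Relator.RightUnique t.Step := by
  rintro a b c ⟨v, hv, rfl⟩ ⟨w, hw, rfl⟩
  rw [hv] at hw
  simpa using hw

theorem acyclic (t : TreeOn I V) (e : I ⊕ V) : ¬ Relation.TransGen t.Step e e := by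
  obtain ⟨r, hr, h⟩ := t.connected
  have h' : t.Leads e r := h e
  induction h' using Relation.ReflTransGen.head_induction_on with
  | refl =>
    intro hc
    obtain ⟨c, ⟨v, hv, _⟩, _⟩ := Relation.TransGen.head'_iff.1 hc
    rw [hr] at hv
    exact absurd hv (by simp)
  | head hab _ ih =>
    intro hc
    obtain ⟨c, h1, h2⟩ := Relation.TransGen.head'_iff.1 hc
    obtain rfl := t.step_unique h1 hab
    exact ih (Relation.TransGen.tail' h2 h1)

theorem leads_antisymm (t : TreeOn I V) {e f : I ⊕ V} (h : t.Leads e f) (h' : t.Leads f e) :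
    e = f := by
  rcases Relation.reflTransGen_iff_eq_or_transGen.1 h with h1 | h1
  · exact h1.symm
  · exact absurd (Relation.TransGen.trans_left h1 h') (t.acyclic e)

theorem leads_total (t : TreeOn I V) {a e f : I ⊕ V} (h : t.Leads a e) (h' : t.Leads a f) :
    t.Leads e f ∨ t.Leads f e :=
  Relation.ReflTransGen.total_of_right_unique t.step_unique h h'

/-- Two different edges coming in at the same vertex have nothing above them in common. -/
theorem eq_of_target_eq (t : TreeOn I V) {a e f : I ⊕ V} {v : V} (he : t.target e = some v)
    (hf : t.target f = some v) (h : t.Leads a e) (h' : t.Leads a f) : e = f := by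
  have key : ∀ x y, t.target x = some v → t.target y = some v → t.Leads x y → x = y := by
    intro x y hx hy hxy
    rcases Relation.ReflTransGen.cases_head hxy with h1 | ⟨c, h1, h2⟩
    · exact h1
    · obtain rfl : c = Sum.inr v := t.step_unique h1 ⟨v, hx, rfl⟩
      exact absurd (Relation.TransGen.tail' h2 ⟨v, hy, rfl⟩) (t.acyclic _)
  rcases t.leads_total h h' with h1 | h1
  · exact key e f he hf h1
  · exact (key f e hf he h1).symm

/-- Above every edge there is a leaf. -/
theorem exists_leaf [Finite V] (t : TreeOn I V) (e : I ⊕ V) : ∃ i, t.Leads (Sum.inl i) e := by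
  cases e with
  | inl i => exact ⟨i, Relation.ReflTransGen.refl⟩
  | inr v =>
    let r : V → V → Prop := fun a b => Relation.TransGen t.Step (Sum.inr a) (Sum.inr b)
    have : IsTrans V r := ⟨fun a b c => Relation.TransGen.trans⟩
    have : Std.Irrefl r := ⟨fun a => t.acyclic _⟩
    have wf : WellFounded r := Finite.wellFounded_of_trans_of_irrefl r
    induction v using wf.induction with
    | _ v ih =>
      obtain ⟨e, he⟩ := (t.reduced v).nonempty
      have hs : t.Step e (Sum.inr v) := ⟨v, he, rfl⟩
      cases e with
      | inl i => exact ⟨i, Relation.ReflTransGen.single hs⟩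
      | inr w =>
        obtain ⟨i, hi⟩ := ih w (Relation.TransGen.single hs)
        exact ⟨i, hi.tail hs⟩

theorem leads_of_cluster_subset [Finite V] (t : TreeOn I V) {v w : V}
    (h : t.cluster v ⊆ t.cluster w) : t.Leads (Sum.inr v) (Sum.inr w) := by
  obtain ⟨i, hi⟩ := t.exists_leaf (Sum.inr v)
  rcases t.leads_total hi (h hi) with h1 | h1
  · exact h1
  · rcases Relation.ReflTransGen.cases_tail h1 with h2 | ⟨e, h2, u, hu, huv⟩
    · rw [h2]; exact Relation.ReflTransGen.refl
    · obtain rfl : v = u := by simpa using huv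
      obtain ⟨f, hf, hfe⟩ := (t.reduced v).exists_ne e
      obtain ⟨j, hj⟩ := t.exists_leaf f
      have hjv : j ∈ t.cluster v := hj.tail ⟨v, hf, rfl⟩
      have hje : t.Leads (Sum.inl j) e := (h hjv).trans h2
      exact absurd (t.eq_of_target_eq hf hu hj hje) hfe

theorem cluster_subset_iff [Finite V] (t : TreeOn I V) {v w : V} :
    t.cluster v ⊆ t.cluster w ↔ t.Leads (Sum.inr v) (Sum.inr w) :=
  ⟨t.leads_of_cluster_subset, fun h _ hi => Relation.ReflTransGen.trans hi h⟩

/-- In a reduced tree, an edge is determined by the set of leaves above it. -/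
theorem cluster_injective [Finite V] (t : TreeOn I V) : Function.Injective t.cluster := by
  intro v w h
  simpa using t.leads_antisymm (t.leads_of_cluster_subset h.subset)
    (t.leads_of_cluster_subset h.symm.subset)

/-! ### Contraction of a set of internal edges -/

/-- The vertex of `t / E` at which an edge comes in: follow the orientation from the target of the
edge, through contracted edges only, up to a vertex whose outgoing edge is not contracted. -/
def Reaches (t : TreeOn I V) (E : Set V) (e : I ⊕ V) (v : V) : Prop :=
  ∃ w, t.target e = some w ∧ ¬ t.IsContracted E v ∧
    Relation.ReflTransGen (fun a b => t.IsContracted E a ∧ t.target (Sum.inr a) = some b) w v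

theorem reaches_unique (t : TreeOn I V) (E : Set V) {e : I ⊕ V} {v v' : V}
    (h : t.Reaches E e v) (h' : t.Reaches E e v') : v = v' := by
  obtain ⟨w, hw, hv, hp⟩ := h
  obtain ⟨w', hw', hv', hp'⟩ := h'
  obtain rfl : w = w' := by rw [hw] at hw'; simpa using hw'
  have U : Relator.RightUnique
      (fun a b => t.IsContracted E a ∧ t.target (Sum.inr a) = some b) := by
    rintro a b c ⟨_, h1⟩ ⟨_, h2⟩
    rw [h1] at h2
    simpa using h2
  rcases Relation.ReflTransGen.total_of_right_unique U hp hp' with h | h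
  · rcases Relation.ReflTransGen.cases_head h with h1 | ⟨c, h1, _⟩
    · exact h1
    · exact absurd h1.1 hv
  · rcases Relation.ReflTransGen.cases_head h with h1 | ⟨c, h1, _⟩
    · exact h1.symm
    · exact absurd h1.1 hv'

/-- The target, in `t / E`, of an edge of `t`. -/
def next (t : TreeOn I V) (E : Set V) (e : I ⊕ V) : Option {v : V // ¬ t.IsContracted E v} :=
  if h : ∃ v, t.Reaches E e v then some ⟨h.choose, h.choose_spec.choose_spec.2.1⟩ else none

theorem next_eq_some_iff (t : TreeOn I V) (E : Set V) (e : I ⊕ V)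
    (v : {v : V // ¬ t.IsContracted E v}) : t.next E e = some v ↔ t.Reaches E e v.1 := by
  unfold next
  split_ifs with h
  · rw [Option.some_inj, Subtype.ext_iff]
    exact ⟨fun h' => h' ▸ h.choose_spec, fun h' => t.reaches_unique E h.choose_spec h'⟩
  · exact ⟨fun h' => absurd h' (by simp), fun h' => absurd ⟨_, h'⟩ h⟩

theorem next_of_target_none (t : TreeOn I V) (E : Set V) {e : I ⊕ V} (h : t.target e = none) :
    t.next E e = none := by
  unfold next
  rw [dif_neg]
  rintro ⟨v, w, hw, _⟩
  rw [h] at hw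
  exact absurd hw (by simp)

theorem next_of_not_contracted (t : TreeOn I V) (E : Set V) {e : I ⊕ V} {w : V}
    (h : t.target e = some w) (hw : ¬ t.IsContracted E w) : t.next E e = some ⟨w, hw⟩ :=
  (t.next_eq_some_iff E e ⟨w, hw⟩).2 ⟨w, h, hw, Relation.ReflTransGen.refl⟩

theorem next_of_contracted (t : TreeOn I V) (E : Set V) {e : I ⊕ V} {w : V}
    (h : t.target e = some w) (hw : t.IsContracted E w) : t.next E e = t.next E (Sum.inr w) := by
  apply Option.ext
  intro v
  rw [t.next_eq_some_iff, t.next_eq_some_iff]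
  constructor
  · rintro ⟨w', hw', hv, hp⟩
    obtain rfl : w = w' := by rw [h] at hw'; simpa using hw'
    rcases Relation.ReflTransGen.cases_head hp with h1 | ⟨c, h1, h2⟩
    · exact absurd (h1 ▸ hw) v.2
    · exact ⟨c, h1.2, hv, h2⟩
  · rintro ⟨c, hc, hv, hp⟩
    exact ⟨w, h, hv, Relation.ReflTransGen.head ⟨hw, hc⟩ hp⟩

/-- An edge of `t / E`, seen as an edge of `t`. -/
def edgeVal (t : TreeOn I V) (E : Set V) : I ⊕ {v : V // ¬ t.IsContracted E v} → I ⊕ V :=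
  Sum.map id Subtype.val

/-- The orientation relation of `t / E`. -/
def CStep (t : TreeOn I V) (E : Set V) (e e' : I ⊕ {v : V // ¬ t.IsContracted E v}) : Prop :=
  ∃ v, t.next E (t.edgeVal E e) = some v ∧ e' = Sum.inr v

theorem leads_of_next (t : TreeOn I V) (E : Set V) {e : I ⊕ V}
    {v : {v : V // ¬ t.IsContracted E v}} (h : t.next E e = some v) :
    t.Leads e (Sum.inr v.1) := by
  obtain ⟨w, hw, _, hp⟩ := (t.next_eq_some_iff E e v).1 h
  have hp' : t.Leads (Sum.inr w) (Sum.inr v.1) := by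
    refine Relation.ReflTransGen.lift Sum.inr ?_ _ _ hp
    rintro a b ⟨_, hab⟩
    exact ⟨b, hab, rfl⟩
  exact Relation.ReflTransGen.head ⟨w, hw, rfl⟩ hp'

theorem leads_of_cstep (t : TreeOn I V) (E : Set V)
    {e f : I ⊕ {v : V // ¬ t.IsContracted E v}}
    (h : Relation.ReflTransGen (t.CStep E) e f) : t.Leads (t.edgeVal E e) (t.edgeVal E f) := by
  induction h with
  | refl => exact Relation.ReflTransGen.refl
  | tail _ hs ih =>
    obtain ⟨v, hv, rfl⟩ := hs
    exact ih.trans (t.leads_of_next E hv)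

theorem next_of_leads (t : TreeOn I V) (E : Set V) {e : I ⊕ V}
    (v : {v : V // ¬ t.IsContracted E v}) (h : t.Leads e (Sum.inr v.1)) :
    e = Sum.inr v.1 ∨ ∃ w, t.next E e = some w ∧
      Relation.ReflTransGen (t.CStep E) (Sum.inr w) (Sum.inr v) := by
  induction h using Relation.ReflTransGen.head_induction_on with
  | refl => exact Or.inl rfl
  | @head e f hef _ ih =>
    right
    obtain ⟨w, hw, rfl⟩ := hef
    by_cases hc : t.IsContracted E w
    · rcases ih with h1 | ⟨w', h1, h2⟩
      · obtain rfl : w = v.1 := by simpa using h1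
        exact absurd hc v.2
      · exact ⟨w', by rw [t.next_of_contracted E hw hc, h1], h2⟩
    · refine ⟨⟨w, hc⟩, t.next_of_not_contracted E hw hc, ?_⟩
      rcases ih with h1 | ⟨w', h1, h2⟩
      · obtain rfl : w = v.1 := by simpa using h1
        exact Relation.ReflTransGen.refl
      · exact Relation.ReflTransGen.head ⟨w', h1, rfl⟩ h2

theorem cstep_of_leads (t : TreeOn I V) (E : Set V)
    {e : I ⊕ {v : V // ¬ t.IsContracted E v}} (v : {v : V // ¬ t.IsContracted E v})
    (h : t.Leads (t.edgeVal E e) (Sum.inr v.1)) :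
    Relation.ReflTransGen (t.CStep E) e (Sum.inr v) := by
  rcases t.next_of_leads E v h with h1 | ⟨w, h1, h2⟩
  · obtain rfl : e = Sum.inr v := by
      cases e with
      | inl i => simp [edgeVal] at h1
      | inr x => simpa [edgeVal, Subtype.ext_iff] using h1
    exact Relation.ReflTransGen.refl
  · exact Relation.ReflTransGen.head ⟨w, h1, rfl⟩ h2

/-- Between a leaf and an edge `e` below it there is an edge that is not contracted and comes in,
in `t / E`, at the same vertex as `e`. -/
theorem exists_edge_above (t : TreeOn I V) (E : Set V) {i : I} {e : I ⊕ V}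
    (h : t.Leads (Sum.inl i) e) :
    ∃ f, t.Leads (t.edgeVal E f) e ∧ (t.edgeVal E f = e ∨
      t.next E (t.edgeVal E f) = t.next E e) := by
  induction h with
  | refl => exact ⟨Sum.inl i, Relation.ReflTransGen.refl, Or.inl rfl⟩
  | @tail e g _ hs ih =>
    obtain ⟨w, hw, rfl⟩ := hs
    by_cases hc : t.IsContracted E w
    · obtain ⟨f, h1, h2⟩ := ih
      refine ⟨f, h1.tail ⟨w, hw, rfl⟩, Or.inr ?_⟩
      rcases h2 with h2 | h2
      · rw [h2, t.next_of_contracted E hw hc]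
      · rw [h2, t.next_of_contracted E hw hc]
    · exact ⟨Sum.inr ⟨w, hc⟩, Relation.ReflTransGen.refl, Or.inl rfl⟩

/-- The tree `t / E` obtained from `t` by contracting the internal edges of `t` that belong to `E`
(an edge is given by its source). The vertices merged with one another by the contraction are
represented by the only one among them whose outgoing edge is not contracted. -/
def contract [Finite V] (t : TreeOn I V) (E : Set V) :
    TreeOn I {v : V // ¬ t.IsContracted E v} where
  target e := t.next E (t.edgeVal E e)
  connected := by
    obtain ⟨r, hr, h⟩ := t.connected
    have hroot : ∃ r', t.edgeVal E r' = r := by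
      cases r with
      | inl i => exact ⟨Sum.inl i, rfl⟩
      | inr v => exact ⟨Sum.inr ⟨v, fun hc => hc.2 hr⟩, rfl⟩
    obtain ⟨r', rfl⟩ := hroot
    refine ⟨r', t.next_of_target_none E hr, fun e => ?_⟩
    cases r' with
    | inr v => exact t.cstep_of_leads E v (h _)
    | inl i =>
      rcases Relation.ReflTransGen.cases_tail (h (t.edgeVal E e)) with h1 | ⟨c, _, v, _, h2⟩
      · cases e with
        | inl j =>
          obtain rfl : i = j := by simpa [edgeVal] using h1
          exact Relation.ReflTransGen.refl
        | inr w => simp [edgeVal] at h1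
      · simp [edgeVal] at h2
  reduced := by
    rintro ⟨v, hv⟩
    obtain ⟨a, ha, b, hb, hab⟩ := t.reduced v
    obtain ⟨i, hi⟩ := t.exists_leaf a
    obtain ⟨j, hj⟩ := t.exists_leaf b
    obtain ⟨f, hf, hf'⟩ := t.exists_edge_above E hi
    obtain ⟨g, hg, hg'⟩ := t.exists_edge_above E hj
    have h1 : t.next E (t.edgeVal E f) = some ⟨v, hv⟩ := by
      rcases hf' with h | h <;> rw [h, t.next_of_not_contracted E ha hv]
    have h2 : t.next E (t.edgeVal E g) = some ⟨v, hv⟩ := by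
      rcases hg' with h | h <;> rw [h, t.next_of_not_contracted E hb hv]
    refine ⟨f, h1, g, h2, ?_⟩
    rintro rfl
    exact hab (t.eq_of_target_eq ha hb hf hg)

theorem cluster_contract [Finite V] (t : TreeOn I V) (E : Set V)
    (v : {v : V // ¬ t.IsContracted E v}) : (t.contract E).cluster v = t.cluster v.1 := by
  ext i
  exact ⟨fun h => t.leads_of_cstep E (e := Sum.inl i) (f := Sum.inr v) h,
    fun h => t.cstep_of_leads E (e := Sum.inl i) v h⟩

theorem isInternal_contract [Finite V] (t : TreeOn I V) (E : Set V)
    (v : {v : V // ¬ t.IsContracted E v}) :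
    (t.contract E).IsInternal v ↔ t.IsInternal v.1 := by
  refine ⟨fun h h' => h (t.next_of_target_none E h'), fun h h' => ?_⟩
  obtain ⟨r, hr, hl⟩ := (t.contract E).connected
  obtain ⟨s, hs, hl'⟩ := t.connected
  cases s with
  | inl i =>
    rcases Relation.ReflTransGen.cases_tail (hl' (Sum.inr v.1)) with h1 | ⟨c, _, w, _, h2⟩
    · simp at h1
    · simp at h2
  | inr w =>
    have hw : ¬ t.IsContracted E w := fun hc => hc.2 hs
    have hp : Relation.ReflTransGen (t.CStep E) (Sum.inr v) (Sum.inr ⟨w, hw⟩) :=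
      t.cstep_of_leads E (e := Sum.inr v) ⟨w, hw⟩ (hl' _)
    rcases Relation.ReflTransGen.cases_head hp with h1 | ⟨c, ⟨x, hx, _⟩, _⟩
    · obtain rfl : v = ⟨w, hw⟩ := by simpa using h1
      exact h hs
    · have h'' : t.next E (t.edgeVal E (Sum.inr v)) = none := h'
      rw [h''] at hx
      exact absurd hx (by simp)

/-! ### Isomorphisms -/

/-- The two trees are isomorphic by an isomorphism that fixes the leaves. -/
def Iso {V W : Type v} (t : TreeOn I V) (t' : TreeOn I W) : Prop :=
  ∃ φ : V ≃ W, ∀ e, t'.target (Sum.map id φ e) = (t.target e).map φ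

theorem Iso.refl (t : TreeOn I V) : t.Iso t := ⟨Equiv.refl V, fun e => by cases e <;> simp⟩

theorem Iso.symm {V W : Type v} {t : TreeOn I V} {t' : TreeOn I W} (h : t.Iso t') : t'.Iso t := by
  obtain ⟨φ, h⟩ := h
  refine ⟨φ.symm, fun e => ?_⟩
  have := h (Sum.map id φ.symm e)
  rw [Sum.map_map] at this
  simp only [Equiv.self_comp_symm, Function.comp_id, Sum.map_id_id, id] at this
  rw [this]
  simp

theorem Iso.trans {V W X : Type v} {t : TreeOn I V} {t' : TreeOn I W} {t'' : TreeOn I X}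
    (h : t.Iso t') (h' : t'.Iso t'') : t.Iso t'' := by
  obtain ⟨φ, h⟩ := h
  obtain ⟨ψ, h'⟩ := h'
  refine ⟨φ.trans ψ, fun e => ?_⟩
  have h1 := h' (Sum.map id φ e)
  rw [Sum.map_map, h e] at h1
  simpa [Option.map_map] using h1

/-- Relabelling of the vertices. -/
def relabel {V W : Type*} (t : TreeOn I V) (φ : V ≃ W) : TreeOn I W where
  target e := (t.target (Sum.map id φ.symm e)).map φ
  connected := by
    obtain ⟨r, hr, h⟩ := t.connected
    refine ⟨Sum.map id φ r, ?_, fun e => ?_⟩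
    · simp [Sum.map_map, hr]
    · have := Relation.ReflTransGen.lift (r := t.Step)
        (p := fun e e' => ∃ v, (t.target (Sum.map id φ.symm e)).map φ = some v ∧ e' = Sum.inr v)
        (Sum.map id φ) (by
          rintro a b ⟨v, hv, rfl⟩
          exact ⟨φ v, by simp [Sum.map_map, hv], rfl⟩) _ _ (h (Sum.map id φ.symm e))
      rw [Function.onFun, Sum.map_map] at this
      simpa using this
  reduced := by
    intro v
    obtain ⟨a, ha, b, hb, hab⟩ := t.reduced (φ.symm v)
    refine ⟨Sum.map id φ a, ?_, Sum.map id φ b, ?_, ?_⟩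
    · simp only [Set.mem_ofPred_eq] at ha ⊢
      simp [Sum.map_map, ha]
    · simp only [Set.mem_ofPred_eq] at hb ⊢
      simp [Sum.map_map, hb]
    · intro h
      exact hab (Sum.map_injective.2 ⟨Function.injective_id, φ.injective⟩ h)

theorem relabel_iso {V W : Type v} (t : TreeOn I V) (φ : V ≃ W) : t.Iso (t.relabel φ) :=
  ⟨φ, fun e => by simp [relabel, Sum.map_map]⟩

/-- The internal edges of `t`, each of them given by the set of leaves above it. -/
def edges (t : TreeOn I V) : Set (Set I) := t.cluster '' {v | t.IsInternal v}

theorem edges_contract [Finite V] (t : TreeOn I V) (E : Set (Set I)) :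
    (t.contract (t.cluster ⁻¹' E)).edges = t.edges \ E := by
  ext c
  constructor
  · rintro ⟨v, hv, rfl⟩
    have hv' : t.IsInternal v.1 := (t.isInternal_contract _ v).1 hv
    rw [t.cluster_contract]
    exact ⟨⟨v.1, hv', rfl⟩, fun hE => v.2 ⟨hE, hv'⟩⟩
  · rintro ⟨⟨v, hv, rfl⟩, hE⟩
    refine ⟨⟨v, fun hc => hE hc.1⟩, (t.isInternal_contract _ _).2 hv, ?_⟩
    rw [t.cluster_contract]

theorem cluster_eq_univ (t : TreeOn I V) {v : V} (h : ¬ t.IsInternal v) :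
    t.cluster v = Set.univ := by
  have hv : t.target (Sum.inr v) = none := not_not.1 h
  obtain ⟨r, hr, hl⟩ := t.connected
  have : r = Sum.inr v := by
    rcases Relation.ReflTransGen.cases_head (hl (Sum.inr v)) with h1 | ⟨c, ⟨x, hx, _⟩, _⟩
    · exact h1.symm
    · rw [hv] at hx
      exact absurd hx (by simp)
  subst this
  exact Set.eq_univ_of_forall fun i => hl (Sum.inl i)

theorem nontrivial_iff [Finite V] (t : TreeOn I V) : Nontrivial I ↔ Nonempty V := by
  constructor
  · intro h
    by_contra hV
    rw [not_nonempty_iff] at hV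
    obtain ⟨r, hr, hl⟩ := t.connected
    obtain ⟨i, j, hij⟩ := h
    have key : ∀ e, e = r := by
      intro e
      rcases Relation.ReflTransGen.cases_head (hl e) with h1 | ⟨c, ⟨x, _, _⟩, _⟩
      · exact h1
      · exact (hV.false x).elim
    exact hij (by simpa using (key (Sum.inl i)).trans (key (Sum.inl j)).symm)
  · rintro ⟨v⟩
    obtain ⟨a, ha, b, hb, hab⟩ := t.reduced v
    obtain ⟨i, hi⟩ := t.exists_leaf a
    obtain ⟨j, hj⟩ := t.exists_leaf b
    refine ⟨i, j, ?_⟩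
    rintro rfl
    exact hab (t.eq_of_target_eq ha hb hi hj)

theorem exists_root_vertex (t : TreeOn I V) (v : V) : ∃ w, ¬ t.IsInternal w := by
  obtain ⟨r, hr, hl⟩ := t.connected
  rcases Relation.ReflTransGen.cases_tail (hl (Sum.inr v)) with h1 | ⟨c, _, w, _, h2⟩
  · exact ⟨v, fun h => h (h1 ▸ hr)⟩
  · exact ⟨w, fun h => h (h2 ▸ hr)⟩

theorem range_cluster [Finite V] (t : TreeOn I V) :
    Set.range t.cluster = t.edges ∪ {c | Nontrivial I ∧ c = Set.univ} := by
  ext c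
  constructor
  · rintro ⟨v, rfl⟩
    by_cases hv : t.IsInternal v
    · exact Or.inl ⟨v, hv, rfl⟩
    · exact Or.inr ⟨t.nontrivial_iff.2 ⟨v⟩, t.cluster_eq_univ hv⟩
  · rintro (⟨v, _, rfl⟩ | ⟨hI, rfl⟩)
    · exact ⟨v, rfl⟩
    · obtain ⟨v⟩ := t.nontrivial_iff.1 hI
      obtain ⟨w, hw⟩ := t.exists_root_vertex v
      exact ⟨w, t.cluster_eq_univ hw⟩

/-- The set of leaves above an edge. -/
def above (t : TreeOn I V) (e : I ⊕ V) : Set I := {i | t.Leads (Sum.inl i) e}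

theorem leads_iff_above [Finite V] (t : TreeOn I V) (e : I ⊕ V) (v : V) :
    t.Leads e (Sum.inr v) ↔ t.above e ⊆ t.cluster v := by
  cases e with
  | inl i =>
    constructor
    · exact fun h j hj => Relation.ReflTransGen.trans hj h
    · exact fun h => h Relation.ReflTransGen.refl
  | inr w => exact t.cluster_subset_iff.symm

theorem target_eq_some_iff (t : TreeOn I V) (e : I ⊕ V) (v : V) :
    t.target e = some v ↔ (t.Leads e (Sum.inr v) ∧ e ≠ Sum.inr v) ∧
      ∀ w, t.Leads e (Sum.inr w) ∧ e ≠ Sum.inr w → t.Leads (Sum.inr v) (Sum.inr w) := by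
  constructor
  · intro h
    have hs : t.Step e (Sum.inr v) := ⟨v, h, rfl⟩
    refine ⟨⟨Relation.ReflTransGen.single hs, ?_⟩, ?_⟩
    · rintro rfl
      exact t.acyclic _ (Relation.TransGen.single hs)
    · rintro w ⟨h1, h2⟩
      rcases Relation.ReflTransGen.cases_head h1 with h3 | ⟨c, h3, h4⟩
      · exact absurd h3 h2
      · exact t.step_unique h3 hs ▸ h4
  · rintro ⟨⟨h1, h2⟩, h3⟩
    rcases Relation.ReflTransGen.cases_head h1 with h4 | ⟨c, ⟨w, hw, rfl⟩, h5⟩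
    · exact absurd h4 h2
    · have hs : t.Step e (Sum.inr w) := ⟨w, hw, rfl⟩
      have hne : e ≠ Sum.inr w := by
        rintro rfl
        exact t.acyclic _ (Relation.TransGen.single hs)
      have := t.leads_antisymm (h3 w ⟨Relation.ReflTransGen.single hs, hne⟩) h5
      obtain rfl : v = w := by simpa using this
      exact hw

/-- A reduced tree is determined, up to isomorphism, by its internal edges. -/
theorem iso_of_edges_eq {V W : Type v} [Finite V] [Finite W] {t : TreeOn I V} {t' : TreeOn I W}
    (h : t.edges = t'.edges) : t.Iso t' := by
  have hr : Set.range t.cluster = Set.range t'.cluster := by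
    rw [t.range_cluster, t'.range_cluster, h]
  let φ : V ≃ W := (Equiv.ofInjective _ t.cluster_injective).trans
    ((Equiv.setCongr hr).trans (Equiv.ofInjective _ t'.cluster_injective).symm)
  have hφ : ∀ v, t'.cluster (φ v) = t.cluster v := by
    intro v
    exact congrArg Subtype.val (Equiv.apply_symm_apply (Equiv.ofInjective _ t'.cluster_injective)
      (Equiv.setCongr hr (Equiv.ofInjective _ t.cluster_injective v)))
  have habove : ∀ e, t'.above (Sum.map id φ e) = t.above e := by
    rintro (i | v)
    · ext j
      have aux : ∀ {X : Type v} (s : TreeOn I X), j ∈ s.above (Sum.inl i) ↔ j = i := by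
        intro X s
        constructor
        · intro hj
          rcases Relation.ReflTransGen.cases_tail hj with h1 | ⟨c, _, x, _, h2⟩
          · simpa using h1.symm
          · simp at h2
        · rintro rfl
          exact Relation.ReflTransGen.refl
      exact (aux t').trans (aux t).symm
    · exact hφ v
  have hlead : ∀ e v, t'.Leads (Sum.map id φ e) (Sum.inr (φ v)) ↔ t.Leads e (Sum.inr v) := by
    intro e v
    rw [t'.leads_iff_above, t.leads_iff_above, habove, hφ]
  have hinj : Function.Injective (Sum.map (id : I → I) φ) :=
    Sum.map_injective.2 ⟨Function.injective_id, φ.injective⟩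
  have hne : ∀ (e : I ⊕ V) (v : V), Sum.map id φ e ≠ Sum.inr (φ v) ↔ e ≠ Sum.inr v :=
    fun e v => hinj.ne_iff (x := e) (y := Sum.inr v)
  refine ⟨φ, fun e => Option.ext fun w => ?_⟩
  obtain ⟨v, rfl⟩ := φ.surjective w
  have h1 : (t.target e).map φ = some (φ v) ↔ t.target e = some v := by
    simp
  rw [h1, t'.target_eq_some_iff, t.target_eq_some_iff, hlead, hne]
  refine and_congr Iff.rfl ⟨fun H x hx => ?_, fun H x hx => ?_⟩
  · exact (hlead (Sum.inr v) x).1 (H (φ x) (by rw [hlead, hne]; exact hx))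
  · obtain ⟨x, rfl⟩ := φ.surjective x
    rw [hlead, hne] at hx
    exact (hlead (Sum.inr v) x).2 (H x hx)

theorem Iso.edges_eq {V W : Type v} {t : TreeOn I V} {t' : TreeOn I W} (h : t.Iso t') :
    t.edges = t'.edges := by
  have key : ∀ {V W : Type v} {t : TreeOn I V} {t' : TreeOn I W}, t.Iso t' →
      t.edges ⊆ t'.edges := by
    rintro V W t t' ⟨φ, h⟩ _ ⟨v, hv, rfl⟩
    have hstep : ∀ e f, t'.Step (Sum.map id φ e) (Sum.map id φ f) ↔ t.Step e f := by
      intro e f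
      constructor
      · rintro ⟨w, hw, hf⟩
        obtain ⟨x, rfl⟩ := φ.surjective w
        rw [h] at hw
        refine ⟨x, by simpa using hw, ?_⟩
        exact Sum.map_injective.2 ⟨Function.injective_id, φ.injective⟩ hf
      · rintro ⟨w, hw, rfl⟩
        exact ⟨φ w, by rw [h, hw]; rfl, rfl⟩
    have hlead : ∀ e f, t.Leads e f → t'.Leads (Sum.map id φ e) (Sum.map id φ f) := by
      intro e f hef
      induction hef with
      | refl => exact Relation.ReflTransGen.refl
      | tail _ hs ih => exact ih.tail ((hstep _ _).2 hs)
    have hlead' : ∀ e f, t'.Leads e f →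
        t.Leads (Sum.map id φ.symm e) (Sum.map id φ.symm f) := by
      intro e f hef
      induction hef with
      | refl => exact Relation.ReflTransGen.refl
      | tail _ hs ih =>
        refine ih.tail ((hstep _ _).1 ?_)
        simpa [Sum.map_map] using hs
    refine ⟨φ v, ?_, ?_⟩
    · intro hn
      have := h (Sum.inr v)
      rw [Sum.map_inr, hn] at this
      exact hv (by simpa using this.symm)
    · ext i
      constructor
      · intro hi
        have h1 := hlead' _ _ hi
        rw [Sum.map_inr, Equiv.symm_apply_apply] at h1
        exact h1
      · exact fun hi => hlead _ _ hi
  exact Set.Subset.antisymm (key h) (key h.symm)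

end TreeOn

/-! ## The category of trees -/

/-- Reduced `I`-trees (with vertices numbered from `0`) up to isomorphism. -/
def treeSetoid (I : Type u) : Setoid (Σ n : ℕ, TreeOn I (Fin n)) where
  r t t' := t.2.Iso t'.2
  iseqv := ⟨fun t => TreeOn.Iso.refl t.2, TreeOn.Iso.symm, TreeOn.Iso.trans⟩

/-- The objects of the category of trees: isomorphism classes of reduced `I`-trees. -/
def ITree (I : Type u) : Type u := Quotient (treeSetoid I)

namespace ITree

variable {I : Type u}

/-- The isomorphism class of a tree. -/
def mk {V : Type} [Finite V] (t : TreeOn I V) : ITree I :=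
  Quotient.mk (treeSetoid I) ⟨_, t.relabel (Finite.equivFin V)⟩

/-- The set `E_t` of internal edges of `t`. The leaves being labelled, an internal edge of a reduced
tree is determined by the set of leaves above it, see `TreeOn.cluster_injective`, and is given by
this set. -/
def edges (t : ITree I) : Finset (Set I) :=
  Quotient.lift (s := treeSetoid I)
    (fun t : Σ n : ℕ, TreeOn I (Fin n) =>
      (Set.Finite.image t.2.cluster (Set.toFinite {v | t.2.IsInternal v})).toFinset)
    (fun _ _ h => by
      ext c
      rw [Set.Finite.mem_toFinset, Set.Finite.mem_toFinset]
      exact Set.ext_iff.1 (TreeOn.Iso.edges_eq h) c) t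

/-- The tree `t / E` obtained by contracting the internal edges of `t` that belong to `E`. -/
def contract (t : ITree I) (E : Finset (Set I)) : ITree I :=
  Quotient.lift (s := treeSetoid I)
    (fun t : Σ n : ℕ, TreeOn I (Fin n) => mk (t.2.contract (t.2.cluster ⁻¹' (E : Set (Set I)))))
    (fun t t' h => Quotient.sound (s := treeSetoid I) (by
      refine TreeOn.Iso.trans (TreeOn.relabel_iso _ _).symm
        (TreeOn.Iso.trans ?_ (TreeOn.relabel_iso _ _))
      apply TreeOn.iso_of_edges_eq
      rw [TreeOn.edges_contract, TreeOn.edges_contract, TreeOn.Iso.edges_eq h])) t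

theorem coe_edges_mk {V : Type} [Finite V] (t : TreeOn I V) :
    ((mk t).edges : Set (Set I)) = t.edges := by
  change ((Set.Finite.toFinset _ : Finset (Set I)) : Set (Set I)) = _
  rw [Set.Finite.coe_toFinset]
  exact (t.relabel_iso (Finite.equivFin V)).symm.edges_eq

theorem edges_injective : Function.Injective (edges (I := I)) := by
  intro t t' h
  induction t using Quotient.ind with | _ t
  induction t' using Quotient.ind with | _ t'
  refine Quotient.sound (s := treeSetoid I) (TreeOn.iso_of_edges_eq ?_)
  have h1 := congrArg (fun s : Finset (Set I) => (s : Set (Set I))) h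
  change ((Set.Finite.toFinset _ : Finset (Set I)) : Set (Set I)) =
    ((Set.Finite.toFinset _ : Finset (Set I)) : Set (Set I)) at h1
  rwa [Set.Finite.coe_toFinset, Set.Finite.coe_toFinset] at h1

theorem edges_contract (t : ITree I) (E : Finset (Set I)) :
    (t.contract E).edges = t.edges \ E := by
  induction t using Quotient.ind with | _ t
  apply Finset.coe_injective
  rw [Finset.coe_sdiff]
  refine (coe_edges_mk _).trans ?_
  rw [TreeOn.edges_contract]
  congr 1
  exact (Set.Finite.coe_toFinset _).symm

theorem contract_contract (t : ITree I) (E F : Finset (Set I)) :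
    (t.contract E).contract F = t.contract (E ∪ F) := by
  apply edges_injective
  rw [edges_contract, edges_contract, edges_contract, sdiff_sdiff_left]
  rfl

theorem contract_empty (t : ITree I) : t.contract ∅ = t := by
  apply edges_injective
  rw [edges_contract, Finset.sdiff_empty]

/-- There is one morphism from `t` to `s` if `s = t / E` for some set `E` of internal edges of `t`,
and there is none otherwise. -/
instance : CategoryTheory.SmallCategory (ITree I) where
  Hom t s := ULift (PLift (∃ E ⊆ t.edges, s = t.contract E))
  id t := ⟨⟨∅, Finset.empty_subset _, t.contract_empty.symm⟩⟩
  comp {t s r} f g := ⟨⟨by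
    obtain ⟨E, hE, rfl⟩ := f.down.down
    obtain ⟨F, hF, rfl⟩ := g.down.down
    refine ⟨E ∪ F, Finset.union_subset hE (hF.trans ?_), t.contract_contract E F⟩
    rw [edges_contract]
    exact Finset.sdiff_subset⟩⟩

/-- If there is a morphism from `t` to `s`, this is the set `E` with `s = t / E`, see
`contract_contracted` and `contracted_contract`. -/
def contracted (t s : ITree I) : Finset (Set I) := t.edges \ s.edges

theorem contracted_contract (t : ITree I) {E : Finset (Set I)} (hE : E ⊆ t.edges) :
    contracted t (t.contract E) = E := by
  rw [contracted, edges_contract, sdiff_sdiff_right_self]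
  exact inf_eq_right.2 hE

theorem contract_contracted {t s : ITree I} (f : t ⟶ s) : t.contract (contracted t s) = s := by
  obtain ⟨E, hE, rfl⟩ := f.down.down
  rw [contracted_contract t hE]

end ITree

/-! ## Differential graded graphs, categories and cocategories -/

open CategoryTheory

/-- A graded graph with set of objects `Ob`: the graded module `Γ a b` is the one of the arrows
from `a` to `b`. -/
abbrev GrGraph (k : Type u) [Field k] (Ob : Type v) : Type (max u v + 1) :=
  Ob → Ob → ℤ → ModuleCat.{max u v} k

section Graphs

variable {k : Type u} [Field k] {Ob : Type v}

namespace GrGraph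

/-- Families of linear maps of degree `0`. -/
def Hom (Γ Γ' : GrGraph k Ob) : Type (max u v) := ∀ (a b : Ob) (n : ℤ), Γ a b n →ₗ[k] Γ' a b n

/-- The identification of `Γ a b n` with `Γ a' b' n'` when the indices are equal. -/
def cast (Γ : GrGraph k Ob) {a a' b b' : Ob} {n n' : ℤ} (ha : a = a') (hb : b = b')
    (hn : n = n') : Γ a b n →ₗ[k] Γ a' b' n' := by
  subst ha hb hn
  exact LinearMap.id

/-- The unit graph: the ground field in degree `0` from an object to itself, and zero elsewhere. -/
def unit : GrGraph k Ob :=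
  fun a b n => ModuleCat.of k ({_x : PUnit.{v + 1} // a = b ∧ n = 0} →₀ k)

/-- The generator of the unit graph at the object `a`. -/
def unitOne (a : Ob) : (unit : GrGraph k Ob) a a 0 := Finsupp.single ⟨PUnit.unit, rfl, rfl⟩ 1

/-- Maps out of the unit graph. -/
def unitLift {a b : Ob} {n : ℤ} {N : Type*} [AddCommGroup N] [Module k N]
    (y : a = b → n = 0 → N) : (unit : GrGraph k Ob) a b n →ₗ[k] N :=
  Finsupp.lsum k fun x => LinearMap.toSpanSingleton k N (y x.2.1 x.2.2)

/-- An intermediate object and a decomposition of the degree `n`. -/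
@[ext]
structure Split (Ob : Type v) (n : ℤ) where
  mid : Ob
  p : ℤ
  q : ℤ
  add_eq : p + q = n

/-- The graph of pairs of composable arrows: from `a` to `c` and in degree `n` it is the direct sum
of the modules `Γ(b, c)_p ⊗ Γ'(a, b)_q`, with `p + q = n`. -/
def tens (Γ Γ' : GrGraph k Ob) : GrGraph k Ob := fun a c n =>
  ModuleCat.of k (⨁ s : Split Ob n, (Γ s.mid c s.p ⊗[k] Γ' a s.mid s.q))

/-- The element `x ⊗ y`. -/
def tmul (Γ Γ' : GrGraph k Ob) {a b c : Ob} {p q n : ℤ} (h : p + q = n) :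
    Γ b c p →ₗ[k] Γ' a b q →ₗ[k] tens Γ Γ' a c n :=
  TensorProduct.curry
    (DirectSum.lof k (Split Ob n) (fun s => Γ s.mid c s.p ⊗[k] Γ' a s.mid s.q) ⟨b, p, q, h⟩)

/-- Maps out of the graph of pairs of composable arrows. -/
def tensLift (Γ Γ' : GrGraph k Ob) {a c : Ob} {n : ℤ} {N : Type*} [AddCommGroup N] [Module k N]
    (f : ∀ (b : Ob) (p q : ℤ), p + q = n → Γ b c p →ₗ[k] Γ' a b q →ₗ[k] N) :
    tens Γ Γ' a c n →ₗ[k] N :=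
  DirectSum.toModule k (Split Ob n) N fun s => TensorProduct.lift (f s.mid s.p s.q s.add_eq)

theorem tensLift_tmul (Γ Γ' : GrGraph k Ob) {a c : Ob} {n : ℤ} {N : Type*} [AddCommGroup N]
    [Module k N] (f : ∀ (b : Ob) (p q : ℤ), p + q = n → Γ b c p →ₗ[k] Γ' a b q →ₗ[k] N)
    {b : Ob} {p q : ℤ} (h : p + q = n) (x : Γ b c p) (y : Γ' a b q) :
    tensLift Γ Γ' f (tmul Γ Γ' h x y) = f b p q h x y := by
  change DirectSum.toModule k (Split Ob n) N _ (DirectSum.lof k _ _ _ _) = _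
  rw [DirectSum.toModule_lof]
  rfl

/-- The tensor product of two families of maps of degree `0`. -/
def tensMap {Γ Γ' Λ Λ' : GrGraph k Ob} (f : Hom Γ Λ) (g : Hom Γ' Λ') :
    Hom (tens Γ Γ') (tens Λ Λ') := fun a c _ =>
  tensLift Γ Γ' fun b p q h => (tmul Λ Λ' h).compl₁₂ (f b c p) (g a b q)

/-- `(x ⊗ y) ⊗ z ↦ x ⊗ (y ⊗ z)`. -/
def assoc (Γ Γ' Γ'' : GrGraph k Ob) :
    Hom (tens (tens Γ Γ') Γ'') (tens Γ (tens Γ' Γ'')) := fun a d n =>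
  tensLift (tens Γ Γ') Γ'' fun b pq r h =>
    tensLift Γ Γ' fun c p q h' =>
      LinearMap.mk₂ k
        (fun x y => (tmul Γ (tens Γ' Γ'') (q := q + r) (by omega) x).comp (tmul Γ' Γ'' rfl y))
        (by intros; ext; simp) (by intros; ext; simp) (by intros; ext; simp) (by intros; ext; simp)

/-- The graph of words `γ₁ ⊗ ⋯ ⊗ γₘ` of length `m`: it is the direct sum, over the sequences of
objects `b = x₀, …, xₘ = a`, of the modules `Γ(x₁, x₀) ⊗ ⋯ ⊗ Γ(xₘ, xₘ₋₁)`. -/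
def word (Γ : GrGraph k Ob) : ℕ → GrGraph k Ob
  | 0 => unit
  | m + 1 => tens Γ (word Γ m)

/-- The empty word at the object `a`. -/
def wordNil (Γ : GrGraph k Ob) (a : Ob) : word Γ 0 a a 0 := unitOne a

/-- The word `γ ⊗ w`. -/
def wordCons (Γ : GrGraph k Ob) (m : ℕ) {a b c : Ob} {p q n : ℤ} (h : p + q = n) :
    Γ b c p →ₗ[k] word Γ m a b q →ₗ[k] word Γ (m + 1) a c n := tmul Γ (word Γ m) h

/-- Maps out of the empty words. -/
def wordZeroLift (Γ : GrGraph k Ob) {a b : Ob} {n : ℤ} {N : Type*} [AddCommGroup N] [Module k N]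
    (y : a = b → n = 0 → N) : word Γ 0 a b n →ₗ[k] N := unitLift y

/-- Maps out of the words of length `m + 1`. -/
def wordSuccLift (Γ : GrGraph k Ob) (m : ℕ) {a c : Ob} {n : ℤ} {N : Type*} [AddCommGroup N]
    [Module k N]
    (f : ∀ (b : Ob) (p q : ℤ), p + q = n → Γ b c p →ₗ[k] word Γ m a b q →ₗ[k] N) :
    word Γ (m + 1) a c n →ₗ[k] N := tensLift Γ (word Γ m) f

/-- The graph of all words, underlying both the free category and the free cocategory on `Γ`. -/
def free (Γ : GrGraph k Ob) : GrGraph k Ob := fun a b n =>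
  ModuleCat.of k (⨁ m : ℕ, word Γ m a b n)

/-- The words of length `m` among all words. -/
def incl (Γ : GrGraph k Ob) (m : ℕ) (a b : Ob) (n : ℤ) : word Γ m a b n →ₗ[k] free Γ a b n :=
  DirectSum.lof k ℕ (fun m => word Γ m a b n) m

/-- Maps out of the graph of words. -/
def freeLift (Γ : GrGraph k Ob) {a b : Ob} {n : ℤ} {N : Type*} [AddCommGroup N] [Module k N]
    (f : ∀ m, word Γ m a b n →ₗ[k] N) : free Γ a b n →ₗ[k] N :=
  DirectSum.toModule k ℕ N f

/-- The empty word at `a`. -/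
def one (Γ : GrGraph k Ob) (a : Ob) : free Γ a a 0 := incl Γ 0 a a 0 (wordNil Γ a)

/-- Adding a letter in front of a word: `γ`, `w ↦ γ ⊗ w`. -/
def cons (Γ : GrGraph k Ob) {a b c : Ob} {p q n : ℤ} (h : p + q = n) :
    Γ b c p →ₗ[k] free Γ a b q →ₗ[k] free Γ a c n :=
  (freeLift Γ fun m => ((wordCons Γ m h).compr₂ (incl Γ (m + 1) a c n)).flip).flip

/-- The word with the only letter `γ`. -/
def letter (Γ : GrGraph k Ob) {a b : Ob} {n : ℤ} : Γ a b n →ₗ[k] free Γ a b n :=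
  (cons Γ (add_zero n)).flip (one Γ a)

/-- Concatenation of a word of length `m` and of a word. -/
def concatWord (Γ : GrGraph k Ob) : ∀ (m : ℕ) {a b c : Ob} {p q n : ℤ}, p + q = n →
    (word Γ m b c p →ₗ[k] free Γ a b q →ₗ[k] free Γ a c n)
  | 0, _, _, _, _, _, _, h =>
    wordZeroLift _ fun hb hp => (free Γ).cast rfl hb (by omega)
  | m + 1, _, _, _, _, _, _, h =>
    wordSuccLift Γ m fun b' p₁ p₂ h' =>
      LinearMap.mk₂ k
        (fun γ w => (cons Γ (q := p₂ + _) (by omega) γ).comp (concatWord Γ m rfl w))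
        (by intros; ext; simp) (by intros; ext; simp) (by intros; ext; simp) (by intros; ext; simp)

/-- Concatenation of words. -/
def concat (Γ : GrGraph k Ob) {a b c : Ob} {p q n : ℤ} (h : p + q = n) :
    free Γ b c p →ₗ[k] free Γ a b q →ₗ[k] free Γ a c n :=
  freeLift Γ fun m => concatWord Γ m h

/-- The derivation of the free category that is given by `δ` on the letters (`δ` has degree `-1`):
`γ₁ ⊗ ⋯ ⊗ γₘ ↦ ∑ᵢ (-1) ^ (|γ₁| + ⋯ + |γᵢ₋₁|) γ₁ ⊗ ⋯ ⊗ δ γᵢ ⊗ ⋯ ⊗ γₘ`. -/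
def derivWord (Γ : GrGraph k Ob)
    (δ : ∀ (a b : Ob) (i j : ℤ), j + 1 = i → Γ a b i →ₗ[k] free Γ a b j) :
    ∀ (m : ℕ) {a b : Ob} {i j : ℤ}, j + 1 = i → (word Γ m a b i →ₗ[k] free Γ a b j)
  | 0, _, _, _, _, _ => 0
  | m + 1, a, c, _, _, h =>
    wordSuccLift Γ m fun b p q h' =>
      (concat Γ (p := p - 1) (q := q) (by omega)).compl₁₂ (δ b c p (p - 1) (by omega))
          (incl Γ m a b q)
        + p.negOnePow • (cons Γ (p := p) (q := q - 1) (by omega)).compl₁₂ LinearMap.id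
          (derivWord Γ δ m (by omega))

/-- Composition of the first letter of a word with a letter in front of it, by means of an
operation `μ` of degree `-1`: `γ`, `γ₁ ⊗ ⋯ ⊗ γₘ ↦ μ(γ, γ₁) ⊗ γ₂ ⊗ ⋯ ⊗ γₘ`. -/
def mergeWord (Γ : GrGraph k Ob)
    (μ : ∀ (a b c : Ob) (p q n : ℤ), n + 1 = p + q → Γ b c p →ₗ[k] Γ a b q →ₗ[k] Γ a c n) :
    ∀ (m : ℕ) {a b c : Ob} {p q n : ℤ}, n + 1 = p + q →
      (Γ b c p →ₗ[k] word Γ m a b q →ₗ[k] free Γ a c n)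
  | 0, _, _, _, _, _, _, _ => 0
  | m + 1, a, b, c, p, _, _, h =>
    (wordSuccLift Γ m fun b' q₁ q₂ h' =>
      LinearMap.mk₂ k
        (fun γ₁ w => ((cons Γ (p := p + q₁ - 1) (q := q₂) (by omega)).flip (incl Γ m a b' q₂ w)).comp
          ((μ b' b c p q₁ (p + q₁ - 1) (by omega)).flip γ₁))
        (by intros; ext; simp) (by intros; ext; simp) (by intros; ext; simp)
        (by intros; ext; simp)).flip

/-- The coderivation of the free cocategory with components `δ` and `μ` of degree `-1`:
`γ₁ ⊗ ⋯ ⊗ γₘ ↦ ∑ᵢ (-1) ^ (|γ₁| + ⋯ + |γᵢ₋₁|) (γ₁ ⊗ ⋯ ⊗ δ γᵢ ⊗ ⋯ ⊗ γₘ + γ₁ ⊗ ⋯ ⊗ μ(γᵢ, γᵢ₊₁) ⊗ ⋯ ⊗ γₘ)`. -/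
def coderivWord (Γ : GrGraph k Ob)
    (δ : ∀ (a b : Ob) (i j : ℤ), j + 1 = i → Γ a b i →ₗ[k] Γ a b j)
    (μ : ∀ (a b c : Ob) (p q n : ℤ), n + 1 = p + q → Γ b c p →ₗ[k] Γ a b q →ₗ[k] Γ a c n) :
    ∀ (m : ℕ) {a b : Ob} {i j : ℤ}, j + 1 = i → (word Γ m a b i →ₗ[k] free Γ a b j)
  | 0, _, _, _, _, _ => 0
  | m + 1, a, c, _, _, h =>
    wordSuccLift Γ m fun b p q h' =>
      (cons Γ (p := p - 1) (q := q) (by omega)).compl₁₂ (δ b c p (p - 1) (by omega))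
          (incl Γ m a b q)
        + mergeWord Γ μ m (by omega)
        + p.negOnePow • (cons Γ (p := p) (q := q - 1) (by omega)).compl₁₂ LinearMap.id
          (coderivWord Γ δ μ m (by omega))

/-- Deconcatenation: `γ₁ ⊗ ⋯ ⊗ γₘ ↦ ∑ᵢ (γ₁ ⊗ ⋯ ⊗ γᵢ) ⊗ (γᵢ₊₁ ⊗ ⋯ ⊗ γₘ)`, with `0 ≤ i ≤ m`. -/
def deconcatWord (Γ : GrGraph k Ob) :
    ∀ (m : ℕ) {a c : Ob} {n : ℤ}, word Γ m a c n →ₗ[k] tens (free Γ) (free Γ) a c n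
  | 0, a, _, _ =>
    wordZeroLift _ fun hc hn => (tens (free Γ) (free Γ)).cast rfl hc hn.symm
      (tmul (free Γ) (free Γ) (add_zero 0) (one Γ a) (one Γ a))
  | m + 1, a, c, n =>
    ((tmul (free Γ) (free Γ) (zero_add n)) (one Γ c)).comp (incl Γ (m + 1) a c n)
      + (wordSuccLift Γ m fun b p q h =>
        ((tensLift (free Γ) (free Γ) fun x q₁ q₂ h' =>
          LinearMap.mk₂ k
            (fun w₁ w₂ => ((tmul (free Γ) (free Γ) (p := p + q₁) (q := q₂) (n := n)
              (by omega)).flip w₂).comp ((cons Γ rfl).flip w₁))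
            (by intros; ext; simp) (by intros; ext; simp) (by intros; ext; simp)
            (by intros; ext; simp)).comp (deconcatWord Γ m)).flip)

/-- The reduced shifted graph: `x ∈ Γ(a, b)` of degree `m` has degree `m + r` in the shifted graph,
and the module of arrows from an object to itself is replaced by zero. An element of the shifted
graph is given as a function on the proofs of `a ≠ b`. -/
def shift (r : ℤ) (Γ : GrGraph k Ob) : GrGraph k Ob := fun a b n =>
  ModuleCat.of k (PLift (a ≠ b) → Γ a b (n - r))

/-- The shift `x ↦ sʳ x`, which is zero if `x` is an arrow from an object to itself. -/
def toShift (r : ℤ) (Γ : GrGraph k Ob) {a b : Ob} {m n : ℤ} (h : m + r = n) :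
    Γ a b m →ₗ[k] shift r Γ a b n :=
  LinearMap.pi fun _ => Γ.cast rfl rfl (by omega)

/-- The inverse of the shift, `sʳ x ↦ x`. -/
def ofShift (r : ℤ) (Γ : GrGraph k Ob) {a b : Ob} {m n : ℤ} (h : m + r = n) :
    shift r Γ a b n →ₗ[k] Γ a b m :=
  if hab : a ≠ b then
    (Γ.cast rfl rfl (by omega)).comp (LinearMap.proj (φ := fun _ => Γ a b (n - r)) (PLift.up hab))
  else 0

end GrGraph

end Graphs

open GrGraph

/-- The data of a differential graded category with set of objects `Ob`, with differential of
degree `-1`. The laws are stated in `CatData.IsDGCategory`. -/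
structure CatData (k : Type u) [Field k] (Ob : Type v) where
  X : GrGraph k Ob
  d : ∀ (a b : Ob) {m n : ℤ}, n + 1 = m → (X a b m →ₗ[k] X a b n)
  one : ∀ a : Ob, X a a 0
  comp : ∀ {a b c : Ob} {p q n : ℤ}, p + q = n → (X b c p →ₗ[k] X a b q →ₗ[k] X a c n)

/-- The data of a differential graded cocategory with set of objects `Ob`, with differential of
degree `-1`. The laws are stated in `CocatData.IsDGCocategory`. -/
structure CocatData (k : Type u) [Field k] (Ob : Type v) where
  X : GrGraph k Ob
  d : ∀ (a b : Ob) {m n : ℤ}, n + 1 = m → (X a b m →ₗ[k] X a b n)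
  counit : ∀ a : Ob, X a a 0 →ₗ[k] k
  Δ : GrGraph.Hom X (tens X X)

section DG

variable {k : Type u} [Field k] {Ob : Type v}

/-- The laws of a differential graded category. -/
structure CatData.IsDGCategory (C : CatData k Ob) : Prop where
  d_d : ∀ (a b : Ob) (l m n : ℤ) (h : m + 1 = l) (h' : n + 1 = m) (x : C.X a b l),
    C.d a b h' (C.d a b h x) = 0
  assoc : ∀ (a b c e : Ob) (p q r pq qr n : ℤ) (hpq : p + q = pq) (hqr : q + r = qr)
    (h : pq + r = n) (h' : p + qr = n) (x : C.X c e p) (y : C.X b c q) (z : C.X a b r),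
    C.comp h (C.comp hpq x y) z = C.comp h' x (C.comp hqr y z)
  one_comp : ∀ (a b : Ob) (n : ℤ) (x : C.X a b n), C.comp (zero_add n) (C.one b) x = x
  comp_one : ∀ (a b : Ob) (n : ℤ) (x : C.X a b n), C.comp (add_zero n) x (C.one a) = x
  leibniz : ∀ (a b c : Ob) (p q n p' q' n' : ℤ) (h : p + q = n) (hp : p' + 1 = p)
    (hq : q' + 1 = q) (hn : n' + 1 = n) (h₁ : p' + q = n') (h₂ : p + q' = n')
    (x : C.X b c p) (y : C.X a b q),
    C.d a c hn (C.comp h x y)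
      = C.comp h₁ (C.d b c hp x) y + p.negOnePow • C.comp h₂ x (C.d a b hq y)

/-- Connected differential graded categories, the objects being graded by `deg`. -/
structure CatData.IsConnected (C : CatData k Ob) (deg : Ob → ℕ) : Prop where
  subsingleton_self : ∀ (a : Ob) (n : ℤ), n ≠ 0 → Subsingleton (C.X a a n)
  bijective_one : ∀ a : Ob, Function.Bijective fun r : k => r • C.one a
  subsingleton : ∀ (a b : Ob) (n : ℤ), deg b < deg a → Subsingleton (C.X b a n)

/-- The differential `d ⊗ 1 + 1 ⊗ d`, with the Koszul sign rule, of pairs of composable arrows. -/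
def CocatData.tensD (R : CocatData k Ob) (a c : Ob) {m n : ℤ} (h : n + 1 = m) :
    tens R.X R.X a c m →ₗ[k] tens R.X R.X a c n :=
  tensLift R.X R.X fun b p q h' =>
    (tmul R.X R.X (p := p - 1) (q := q) (by omega)).compl₁₂ (R.d b c (by omega)) LinearMap.id
      + p.negOnePow • (tmul R.X R.X (p := p) (q := q - 1) (by omega)).compl₁₂
        LinearMap.id (R.d a b (by omega))

/-- `x ⊗ y ↦ ε(x) y`. -/
def CocatData.counitLeft (R : CocatData k Ob) (a c : Ob) (n : ℤ) :
    tens R.X R.X a c n →ₗ[k] R.X a c n :=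
  tensLift R.X R.X fun b p q h =>
    if hb : b = c ∧ p = 0 then
      (LinearMap.lsmul k (R.X a c n)).compl₁₂
        ((R.counit c).comp (R.X.cast hb.1 rfl hb.2)) (R.X.cast rfl hb.1 (by omega))
    else 0

/-- `x ⊗ y ↦ ε(y) x`. -/
def CocatData.counitRight (R : CocatData k Ob) (a c : Ob) (n : ℤ) :
    tens R.X R.X a c n →ₗ[k] R.X a c n :=
  tensLift R.X R.X fun b p q h =>
    if hb : b = a ∧ q = 0 then
      ((LinearMap.lsmul k (R.X a c n)).compl₁₂
        ((R.counit a).comp (R.X.cast rfl hb.1 hb.2)) (R.X.cast hb.1 rfl (by omega))).flip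
    else 0

/-- The laws of a differential graded cocategory. -/
structure CocatData.IsDGCocategory (R : CocatData k Ob) : Prop where
  d_d : ∀ (a b : Ob) (l m n : ℤ) (h : m + 1 = l) (h' : n + 1 = m) (x : R.X a b l),
    R.d a b h' (R.d a b h x) = 0
  coassoc : ∀ (a b : Ob) (n : ℤ) (x : R.X a b n),
    GrGraph.assoc R.X R.X R.X a b n (tensMap R.Δ (fun _ _ _ => LinearMap.id) a b n (R.Δ a b n x))
      = tensMap (fun _ _ _ => LinearMap.id) R.Δ a b n (R.Δ a b n x)
  counit_left : ∀ (a b : Ob) (n : ℤ) (x : R.X a b n), R.counitLeft a b n (R.Δ a b n x) = x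
  counit_right : ∀ (a b : Ob) (n : ℤ) (x : R.X a b n), R.counitRight a b n (R.Δ a b n x) = x
  coleibniz : ∀ (a b : Ob) (m n : ℤ) (h : n + 1 = m) (x : R.X a b m),
    R.Δ a b n (R.d a b h x) = R.tensD a b h (R.Δ a b m x)
  counit_d : ∀ (a : Ob) (x : R.X a a 1), R.counit a (R.d a a (zero_add 1) x) = 0

/-- Connected differential graded cocategories, the objects being graded by `deg`. -/
structure CocatData.IsConnected (R : CocatData k Ob) (deg : Ob → ℕ) : Prop where
  subsingleton_self : ∀ (a : Ob) (n : ℤ), n ≠ 0 → Subsingleton (R.X a a n)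
  bijective_counit : ∀ a : Ob, Function.Bijective (R.counit a)
  subsingleton : ∀ (a b : Ob) (n : ℤ), deg b < deg a → Subsingleton (R.X b a n)

/-- Differential graded functors that are the identity on objects. -/
structure IsDGFunctor (C D : CatData k Ob) (f : GrGraph.Hom C.X D.X) : Prop where
  map_d : ∀ (a b : Ob) (m n : ℤ) (h : n + 1 = m) (x : C.X a b m),
    f a b n (C.d a b h x) = D.d a b h (f a b m x)
  map_one : ∀ a : Ob, f a a 0 (C.one a) = D.one a
  map_comp : ∀ (a b c : Ob) (p q n : ℤ) (h : p + q = n) (x : C.X b c p) (y : C.X a b q),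
    f a c n (C.comp h x y) = D.comp h (f b c p x) (f a b q y)

/-- `f` exhibits the differential graded cocategory `R` as a subcocategory of `S`. -/
structure IsSubcocategory (R S : CocatData k Ob) (f : GrGraph.Hom R.X S.X) : Prop where
  map_d : ∀ (a b : Ob) (m n : ℤ) (h : n + 1 = m) (x : R.X a b m),
    f a b n (R.d a b h x) = S.d a b h (f a b m x)
  map_Δ : ∀ (a b : Ob) (n : ℤ) (x : R.X a b n),
    S.Δ a b n (f a b n x) = tensMap f f a b n (R.Δ a b n x)
  map_counit : ∀ (a : Ob) (x : R.X a a 0), S.counit a (f a a 0 x) = R.counit a x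
  injective : ∀ (a b : Ob) (n : ℤ), Function.Injective (f a b n)

/-- The map `f` induces bijections in homology, for all pairs of objects and in all degrees. -/
structure IsQuasiIso (C D : CatData k Ob) (f : GrGraph.Hom C.X D.X) : Prop where
  injective : ∀ (a b : Ob) (l m n : ℤ) (h : m + 1 = l) (h' : n + 1 = m) (x : C.X a b m),
    C.d a b h' x = 0 → (∃ y : D.X a b l, D.d a b h y = f a b m x) → ∃ z : C.X a b l, C.d a b h z = x
  surjective : ∀ (a b : Ob) (l m n : ℤ) (h : m + 1 = l) (h' : n + 1 = m) (y : D.X a b m),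
    D.d a b h' y = 0 → ∃ x : C.X a b m, C.d a b h' x = 0 ∧
      ∃ z : D.X a b l, y = f a b m x + D.d a b h z

/-- The extension to words of length `m` of a map from a graph to a category. -/
def CatData.liftWord (C : CatData k Ob) {Γ : GrGraph k Ob} (φ : GrGraph.Hom Γ C.X) :
    ∀ m : ℕ, GrGraph.Hom (word Γ m) C.X
  | 0 => fun a _ _ => wordZeroLift _ fun hb hn => C.X.cast rfl hb hn.symm (C.one a)
  | m + 1 => fun a c _ => wordSuccLift Γ m fun b p q h =>
    (C.comp h).compl₁₂ (φ b c p) (C.liftWord φ m a b q)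

/-- The extension to the free category of a map from a graph to a category:
`γ₁ ⊗ ⋯ ⊗ γₘ ↦ φ(γ₁) ⋯ φ(γₘ)`. -/
def CatData.lift (C : CatData k Ob) {Γ : GrGraph k Ob} (φ : GrGraph.Hom Γ C.X) :
    GrGraph.Hom (free Γ) C.X := fun a b n => freeLift Γ fun m => C.liftWord φ m a b n

/-- The functor `ε : P ⟶ C` is a minimal resolution of the category `C`: it is a quasi-isomorphism
of differential graded categories, and `P` is minimal, that is, `P` is free as a graded category on
a reduced graph of generators `i : Γ ⟶ P`, and the differential of a generator is decomposable,
which means a linear combination of composites of at least two generators. -/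
structure IsMinimalResolution (P C : CatData k Ob) (Γ : GrGraph k Ob) (i : GrGraph.Hom Γ P.X)
    (ε : GrGraph.Hom P.X C.X) : Prop where
  isDGCategory : P.IsDGCategory
  isDGCategory_target : C.IsDGCategory
  isDGFunctor : IsDGFunctor P C ε
  isQuasiIso : IsQuasiIso P C ε
  reduced : ∀ (a : Ob) (n : ℤ), Subsingleton (Γ a a n)
  free : ∀ (a b : Ob) (n : ℤ), Function.Bijective (P.lift i a b n)
  decomposable : ∀ (a b : Ob) (m n : ℤ) (h : n + 1 = m) (γ : Γ a b m),
    ∃ w : ⨁ j : ℕ, word Γ j a b n, w 0 = 0 ∧ w 1 = 0 ∧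
      P.d a b h (i a b m γ) = P.lift i a b n w

/-- The bar construction: the free cocategory on the reduced suspension of `C`, with the
coderivation that lifts the composition and the differential of `C`; the composition enters it by
`s α ⊗ s β ↦ (-1) ^ |s α| s (α β)`, and the differential by `s α ↦ - s (d α)`. -/
def bar (C : CatData k Ob) : CocatData k Ob where
  X := free (shift 1 C.X)
  d a b _ _ h := freeLift (shift 1 C.X) fun m =>
    coderivWord (shift 1 C.X)
      (fun a b i j h => -((toShift 1 C.X (m := j - 1) (by omega)).comp
        ((C.d a b (by omega)).comp (ofShift 1 C.X (m := i - 1) (by omega)))))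
      (fun a b c p q n h => p.negOnePow •
        ((C.comp (p := p - 1) (q := q - 1) (n := n - 1) (by omega)).compl₁₂
          (ofShift 1 C.X (by omega)) (ofShift 1 C.X (by omega))).compr₂
          (toShift 1 C.X (by omega)))
      m h
  counit a := freeLift (shift 1 C.X) fun m =>
    match m with
    | 0 => wordZeroLift _ fun _ _ => (1 : k)
    | _ + 1 => 0
  Δ _ _ _ := freeLift (shift 1 C.X) fun m => deconcatWord (shift 1 C.X) m

/-- The differential of the generators of the cobar construction:
`s⁻¹ α ↦ - s⁻¹ (d α) + ∑ (-1) ^ (|α₁| + 1) s⁻¹ α₁ ⊗ s⁻¹ α₂`, where `Δ α = ∑ α₁ ⊗ α₂`. -/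
def cobarGen (R : CocatData k Ob) (a c : Ob) (i j : ℤ) (h : j + 1 = i) :
    shift (-1) R.X a c i →ₗ[k] free (shift (-1) R.X) a c j :=
  (-((letter (shift (-1) R.X)).comp
      ((toShift (-1) R.X (m := j + 1) (by omega)).comp (R.d a c (m := i + 1) (by omega))))
    + (tensLift R.X R.X fun b p q h' =>
        (p + 1).negOnePow • (cons (shift (-1) R.X) (p := p - 1) (q := q - 1) (by omega)).compl₁₂
          (toShift (-1) R.X (by omega))
          ((letter (shift (-1) R.X)).comp (toShift (-1) R.X (by omega)))).comp
      (R.Δ a c (i + 1))).comp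
    (ofShift (-1) R.X (by omega))

/-- The cobar construction: the free category on the reduced desuspension of `R`, with the
derivation that lifts the cocomposition and the differential of `R`. -/
def cobar (R : CocatData k Ob) : CatData k Ob where
  X := free (shift (-1) R.X)
  d _ _ _ _ h := freeLift (shift (-1) R.X) fun m => derivWord (shift (-1) R.X) (cobarGen R) m h
  one := GrGraph.one (shift (-1) R.X)
  comp h := concat (shift (-1) R.X) h

/-- The generators of the cobar construction. -/
def cobarι (R : CocatData k Ob) : GrGraph.Hom (shift (-1) R.X) (cobar R).X :=
  fun _ _ _ => letter (shift (-1) R.X)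

end DG

/-- The `k`-linear category spanned by a category, concentrated in degree `0`. -/
def linearization (k : Type u) [Field k] (Ob : Type v) [SmallCategory Ob] : CatData k Ob where
  X a b n := ModuleCat.of k ({_f : a ⟶ b // n = 0} →₀ k)
  d _ _ _ _ _ := 0
  one a := Finsupp.single ⟨𝟙 a, rfl⟩ 1
  comp h := Finsupp.lsum k fun g => LinearMap.toSpanSingleton k _
    (Finsupp.lmapDomain k k fun f => ⟨f.1 ≫ g.1, by rw [← h, g.2, f.2, add_zero]⟩)

/-! ## The Koszul dual of the category of trees -/

section Koszul

variable (k : Type u) [Field k] {I : Type v}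

/-- The category `k T_I`. -/
abbrev treeCat (I : Type v) : CatData k (ITree I) := linearization k (ITree I)

/-- The number of internal edges. -/
def ITree.degree (t : ITree I) : ℕ := t.edges.card

/-- The graph `K`: if `s = t / E`, then `K(t, s)` is the exterior power `Λ^|E| k[E]` in degree
`|E|`, and it is zero otherwise. -/
def koszulGraph : GrGraph k (ITree I) := fun t s n =>
  ModuleCat.of k ({_f : t ⟶ s // ((t.contracted s).card : ℤ) = n} →
    ⋀[k]^((t.contracted s).card) (t.contracted s →₀ k))

/-- The element `e` of the basis `E` of `k[E]`, or zero if `e` is not an element of `E`. -/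
def basisElem {X : Type v} (E : Finset X) (e : X) : E →₀ k :=
  if h : e ∈ E then Finsupp.single ⟨e, h⟩ 1 else 0

/-- The element `e₁ ∧ ⋯ ∧ eₘ` of `K(t, s)`. -/
def wedge (t s : ITree I) {m : ℕ} (e : Fin m → Set I) : koszulGraph k t s m := fun f =>
  exteriorPower.ιMulti k _ fun i =>
    basisElem k (t.contracted s) (e (Fin.cast (Nat.cast_injective f.2) i))

/-- The linear form on `Λ^|E| k[E]` that takes the value `1` at `e₁ ∧ ⋯ ∧ eₘ`. -/
def topForm {X : Type v} (E : Finset X) (e : Fin E.card ≃ E) :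
    ⋀[k]^(E.card) (E →₀ k) →ₗ[k] k :=
  exteriorPower.alternatingMapLinearEquiv
    (Module.Basis.det ((Finsupp.basisSingleOne (R := k) (ι := E)).reindex e.symm))

/-- The identification of `K(t, s)` with the exterior power `Λ^|E| k[E]`, when `s = t / E`. -/
def koszulEval (t s : ITree I) (n : ℤ) (f : {_f : t ⟶ s // ((t.contracted s).card : ℤ) = n}) :
    koszulGraph k t s n →ₗ[k] ⋀[k]^((t.contracted s).card) (t.contracted s →₀ k) :=
  LinearMap.proj f

/-- The linear map out of `K(t, s)`, with `s = t / E`, that sends `e₁ ∧ ⋯ ∧ eₘ` to `y(e₁, …, eₘ)`,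
for a fixed ordering `e₁, …, eₘ` of `E`. -/
def koszulLift (t s : ITree I) (n : ℤ) {N : Type*} [AddCommGroup N] [Module k N]
    (y : ∀ m : ℕ, (m : ℤ) = n → (Fin m → Set I) → N) : koszulGraph k t s n →ₗ[k] N :=
  if h : Nonempty {_f : t ⟶ s // ((t.contracted s).card : ℤ) = n} then
    ((topForm k (t.contracted s) (t.contracted s).equivFin.symm).smulRight
      (y (t.contracted s).card h.some.2 fun i => ((t.contracted s).equivFin.symm i : Set I))).comp
      (koszulEval k t s n h.some)
  else 0

/-- `σ` is a `(p, m - p)`-shuffle: it is increasing on the first `p` elements and on the others. -/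
def IsShuffle {m : ℕ} (p : ℕ) (σ : Equiv.Perm (Fin m)) : Prop :=
  ∀ i j : Fin m, i < j → ((j : ℕ) < p ∨ p ≤ (i : ℕ)) → σ i < σ j

/-- The shuffle cocomposition of `e₁ ∧ ⋯ ∧ eₘ ∈ K(t, s)`:
`∑ₚ ∑_σ ε(σ) (e_σ(1) ∧ ⋯ ∧ e_σ(p)) ⊗ (e_σ(p+1) ∧ ⋯ ∧ e_σ(m))`, where `0 ≤ p ≤ m` and `σ` runs over
the `(p, m - p)`-shuffles. The factors of the term of index `σ` lie in `K(b, s)` and in `K(t, b)`,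
where `b = t / {e_σ(p+1), …, e_σ(m)}`. -/
def shuffleSum (t s : ITree I) {n : ℤ} (m : ℕ) (h : (m : ℤ) = n) (e : Fin m → Set I) :
    tens (koszulGraph k) (koszulGraph k) t s n :=
  ∑ p : Fin (m + 1), ∑ σ : Equiv.Perm (Fin m) with IsShuffle (p : ℕ) σ,
    let u : Fin (p : ℕ) → Set I := fun i => e (σ ⟨i, by omega⟩)
    let v : Fin (m - p) → Set I := fun i => e (σ ⟨p + i, by omega⟩)
    Equiv.Perm.sign σ •
      tmul (koszulGraph k) (koszulGraph k) (b := t.contract (Finset.univ.image v))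
        (p := ((p : ℕ) : ℤ)) (q := ((m - p : ℕ) : ℤ)) (by omega) (wedge k _ s u) (wedge k t _ v)

/-- The Koszul dual cocategory `K`, with zero differential. -/
def koszul (I : Type v) : CocatData k (ITree I) where
  X := koszulGraph k
  d _ _ _ _ _ := 0
  counit t := koszulLift k t t 0 fun _ _ _ => (1 : k)
  Δ t s n := koszulLift k t s n fun m h e => shuffleSum k t s m h e

/-- The basis element of `k T_I(t, s)` in degree `0` (zero if there is no morphism). -/
def arrow (t s : ITree I) (n : ℤ) : (treeCat k I).X t s n :=
  if h : Nonempty {_f : t ⟶ s // n = 0} then Finsupp.single h.some 1 else 0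

/-- The element `({e₁}, …, {eₘ})` of the bar construction of `k T_I`: the word whose `i`-th letter is
the contraction of `eᵢ` in `t / {eᵢ₊₁, …, eₘ}`. -/
def barWord (t : ITree I) : ∀ (l : List (Set I)) (s : ITree I) {n : ℤ}, (l.length : ℤ) = n →
    (bar (treeCat k I)).X t s n
  | [], s, _, h =>
    if hs : t = s then (bar (treeCat k I)).X.cast rfl hs h (GrGraph.one _ t) else 0
  | _ :: l, s, n, h =>
    cons (shift 1 (treeCat k I).X) (p := 1) (q := n - 1) (by omega)
      (toShift 1 (treeCat k I).X (m := 0) (by omega) (arrow k (t.contract l.toFinset) s 0))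
      (barWord t l (t.contract l.toFinset) (by simp at h; omega))

/-- The element `∑_σ ε(σ) ({e_σ(1)}, …, {e_σ(m)})` of the bar construction of `k T_I`. -/
def antisymmetrization (t s : ITree I) {n : ℤ} (m : ℕ) (h : (m : ℤ) = n) (e : Fin m → Set I) :
    (bar (treeCat k I)).X t s n :=
  ∑ σ : Equiv.Perm (Fin m), Equiv.Perm.sign σ •
    barWord k t (List.ofFn fun i => e (σ i)) s (by simpa using h)

/-- The map from `K` to the bar construction of `k T_I`. -/
def kappaBar (I : Type v) : GrGraph.Hom (koszul k I).X (bar (treeCat k I)).X := fun t s n =>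
  koszulLift k t s n fun m h e => antisymmetrization k t s m h e

/-- On the generators of the cobar construction of `K`: the generator `s⁻¹ e`, for a single internal
edge `e` of `t`, is sent to the morphism from `t` to `t / e`, and the generators of positive degree
are sent to zero. -/
def resolutionGen (I : Type v) : GrGraph.Hom (shift (-1) (koszul k I).X) (treeCat k I).X :=
  fun t s n => (koszulLift k t s (n + 1) fun _ _ _ => arrow k t s n).comp
    (ofShift (-1) (koszul k I).X (by omega))

/-- The functor from the cobar construction of `K` to `k T_I`. -/
def resolutionMap (I : Type v) : GrGraph.Hom (cobar (koszul k I)).X (treeCat k I).X :=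
  (treeCat k I).lift (resolutionGen k I)

end Koszul

end

end TreeKoszul

open TreeKoszul TreeKoszul.GrGraph CategoryTheory

/-!
Everything is reduced to one basis element. If `s = t / A`, then `K(t, s)` is a line, spanned by the
exterior product `gen t s` of the elements of `A` in increasing order, for a fixed linear order on the
sets of leaves; `eps B C` is the sign of the rearrangement that sorts `B` followed by `C`. Summing over
shuffles is summing over subsets, so the cocomposition is
`Δ (gen t s) = ∑_{C ⊆ A} eps (A \ C) C • gen (t / C) s ⊗ gen t (t / C)` (`shuffleSum_eq`), and
coassociativity says that both sides are sums over the ways of contracting `A` in three steps.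

The image `kap t s` of `gen t s` in the bar construction is expanded with respect to the edge that is
contracted last (`kap_eq_sum`). By induction on this expansion, it is a cycle, because the two orders
of the last two contractions have the same composite and opposite signs (`treeBarD_kap`); it is cut by
deconcatenation as `gen t s` is by `Δ` (`deconcat_kap`); and it is nonzero, because the first letters
of the terms start from different trees (`kap_ne_zero`).

For the resolution, fix an edge `e`. Contracting `e` everywhere defines a differential graded functor
`contractMap` from `Ω(K)` to itself, acting on objects by `t ↦ t / e`: it sends the generator of `A` to
the one of `A` if `e ∉ A`, the generator of `{e}` to the identity, and the other generators to zero.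
Adjoining `e` to `A` defines a homotopy from `Ω(K)(t, s)` to `Ω(K)(t, s / e)`, and
`homotopy_relation` states that `d h + h d` sends `x` to `u_s x - contractMap(x) u_t`, where `u_t` is
the generator of `e` in `(t, t / e)`, or the identity if `e` is not an edge of `t`. If `e` is
contracted from `t` to `s`, then `u_s` is the identity, and a cycle `x` is homologous to
`contractMap(x) u_t`, where `contractMap(x)` lies over a morphism that contracts one edge less. By
induction on the number of contracted edges, a cycle with zero image in `k T_I` is a boundary
(`exists_cobarD_eq_of_resMap_eq_zero`). Minimality holds because `K` has zero differential.
-/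

namespace TreeKoszul

open scoped TensorProduct DirectSum Classical
open CategoryTheory GrGraph

noncomputable section

/-! ### Pairs of composable arrows, and words -/

section GraphLemmas

variable {k : Type u} [Field k] {Ob : Type v}

namespace GrGraph

@[simp] theorem cast_refl (Γ : GrGraph k Ob) {a b : Ob} {n : ℤ} (ha : a = a) (hb : b = b)
    (hn : n = n) (x : Γ a b n) : Γ.cast ha hb hn x = x := rfl

/-- The identity of a graph. -/
def Hom.id (Γ : GrGraph k Ob) : Hom Γ Γ := fun _ _ _ => LinearMap.id

@[simp] theorem Hom.id_apply (Γ : GrGraph k Ob) {a b : Ob} {n : ℤ} (x : Γ a b n) :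
    Hom.id Γ a b n x = x := rfl

theorem tens_induction {Γ Γ' : GrGraph k Ob} {a c : Ob} {n : ℤ}
    {P : tens Γ Γ' a c n → Prop} (zero : P 0) (add : ∀ x y, P x → P y → P (x + y))
    (tmul : ∀ (b : Ob) (p q : ℤ) (h : p + q = n) (x : Γ b c p) (y : Γ' a b q),
      P (tmul Γ Γ' h x y)) (x : tens Γ Γ' a c n) : P x := by
  induction x using DirectSum.induction_on with
  | zero => exact zero
  | add x y hx hy => exact add x y hx hy
  | of s x =>
    induction x using TensorProduct.induction_on with
    | zero => rw [map_zero]; exact zero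
    | add x y hx hy => rw [map_add]; exact add _ _ hx hy
    | tmul x y => exact tmul s.mid s.p s.q s.add_eq x y

/-- Linear maps out of the graph of pairs of composable arrows agree when they agree on the
elements `x ⊗ y`. -/
theorem tens_hom_ext {Γ Γ' : GrGraph k Ob} {a c : Ob} {n : ℤ} {N : Type*} [AddCommGroup N]
    [Module k N] {f g : tens Γ Γ' a c n →ₗ[k] N}
    (h : ∀ (b : Ob) (p q : ℤ) (h : p + q = n) (x : Γ b c p) (y : Γ' a b q),
      f (tmul Γ Γ' h x y) = g (tmul Γ Γ' h x y)) (x : tens Γ Γ' a c n) : f x = g x := by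
  induction x using tens_induction with
  | zero => rw [map_zero, map_zero]
  | add x y hx hy => rw [map_add, map_add, hx, hy]
  | tmul b p q h' x y => exact h b p q h' x y

@[simp] theorem tensMap_tmul {Γ Γ' Λ Λ' : GrGraph k Ob} (f : Hom Γ Λ) (g : Hom Γ' Λ')
    {a b c : Ob} {p q n : ℤ} (h : p + q = n) (x : Γ b c p) (y : Γ' a b q) :
    tensMap f g a c n (tmul Γ Γ' h x y) = tmul Λ Λ' h (f b c p x) (g a b q y) :=
  tensLift_tmul _ _ _ _ _ _

theorem assoc_tmul (Γ Γ' Γ'' : GrGraph k Ob) {a b c d : Ob} {p q r pq qr n : ℤ} (h : pq + r = n)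
    (h' : p + q = pq) (h₁ : q + r = qr) (h₂ : p + qr = n) (x : Γ c d p) (y : Γ' b c q)
    (z : Γ'' a b r) :
    assoc Γ Γ' Γ'' a d n (tmul (tens Γ Γ') Γ'' h (tmul Γ Γ' h' x y) z)
      = tmul Γ (tens Γ' Γ'') h₂ x (tmul Γ' Γ'' h₁ y z) := by
  subst h₁
  unfold assoc
  rw [tensLift_tmul, tensLift_tmul]
  rfl

@[simp] theorem freeLift_incl (Γ : GrGraph k Ob) {a b : Ob} {n : ℤ} {N : Type*} [AddCommGroup N]
    [Module k N] (f : ∀ m, word Γ m a b n →ₗ[k] N) (m : ℕ) (w : word Γ m a b n) :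
    freeLift Γ f (incl Γ m a b n w) = f m w :=
  DirectSum.toModule_lof _ _ _

@[simp] theorem cons_incl (Γ : GrGraph k Ob) {a b c : Ob} {p q n : ℤ} (h : p + q = n) (γ : Γ b c p)
    (m : ℕ) (w : word Γ m a b q) :
    cons Γ h γ (incl Γ m a b q w) = incl Γ (m + 1) a c n (wordCons Γ m h γ w) := by
  unfold cons
  rw [LinearMap.flip_apply, freeLift_incl]
  rfl

theorem free_induction_incl {Γ : GrGraph k Ob} {a c : Ob} {n : ℤ}
    {P : free Γ a c n → Prop} (zero : P 0) (add : ∀ x y, P x → P y → P (x + y))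
    (incl : ∀ m w, P (incl Γ m a c n w)) (x : free Γ a c n) : P x := by
  induction x using DirectSum.induction_on with
  | zero => exact zero
  | add x y hx hy => exact add x y hx hy
  | of m x => exact incl m x

theorem word_zero_induction {Γ : GrGraph k Ob} {a c : Ob} {n : ℤ} {P : word Γ 0 a c n → Prop}
    (zero : P 0) (add : ∀ x y, P x → P y → P (x + y))
    (nil : ∀ (r : k) (hc : a = c) (hn : n = 0),
      P (r • (word Γ 0).cast rfl hc hn.symm (wordNil Γ a))) (w : word Γ 0 a c n) : P w := by
  induction w using Finsupp.induction_linear with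
  | zero => exact zero
  | add x y hx hy => exact add x y hx hy
  | single s r =>
    obtain ⟨s, rfl, rfl⟩ := s
    have : (Finsupp.single ⟨s, rfl, rfl⟩ r : word Γ 0 a a 0) = r • wordNil Γ a :=
      (Finsupp.smul_single_one _ _).symm
    rw [this]
    exact nil r rfl rfl

theorem word_succ_induction {Γ : GrGraph k Ob} {m : ℕ} {a c : Ob} {n : ℤ}
    {P : word Γ (m + 1) a c n → Prop}
    (zero : P 0) (add : ∀ x y, P x → P y → P (x + y))
    (cons : ∀ (b : Ob) (p q : ℤ) (h : p + q = n) (γ : Γ b c p) (w : word Γ m a b q),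
      P (wordCons Γ m h γ w)) (w : word Γ (m + 1) a c n) : P w :=
  tens_induction (P := P) zero add cons w

/-- A property of combinations of words that is compatible with linear combinations holds if it
holds for the empty words and is inherited when a letter is added in front of a word. -/
theorem free_induction {Γ : GrGraph k Ob} {P : ∀ (a c : Ob) (n : ℤ), free Γ a c n → Prop}
    (zero : ∀ a c n, P a c n 0) (add : ∀ a c n x y, P a c n x → P a c n y → P a c n (x + y))
    (smul_one : ∀ a (r : k), P a a 0 (r • one Γ a))
    (cons : ∀ (a b c : Ob) (p q n : ℤ) (h : p + q = n) (γ : Γ b c p) (w : free Γ a b q),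
      P a b q w → P a c n (cons Γ h γ w)) (a c : Ob) (n : ℤ) (x : free Γ a c n) : P a c n x := by
  have key : ∀ (m : ℕ) (a c : Ob) (n : ℤ) (w : word Γ m a c n), P a c n (incl Γ m a c n w) := by
    intro m
    induction m with
    | zero =>
      intro a c n w
      induction w using word_zero_induction with
      | zero => rw [map_zero]; exact zero a c n
      | add x y hx hy => rw [map_add]; exact add a c n _ _ hx hy
      | nil r hc hn =>
        clear x
        have key : ∀ (c : Ob) (n : ℤ) (hc : a = c) (hn : 0 = n),
            P a c n (incl Γ 0 a c n (r • (word Γ 0).cast rfl hc hn (wordNil Γ a))) := by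
          rintro c n rfl rfl
          rw [map_smul]
          exact smul_one a r
        exact key c n hc hn.symm
    | succ m ih =>
      intro a c n w
      induction w using word_succ_induction with
      | zero => rw [map_zero]; exact zero a c n
      | add x y hx hy => rw [map_add]; exact add a c n _ _ hx hy
      | cons b p q h x y =>
        have := cons a b c p q n h x (incl Γ m a b q y) (ih a b q y)
        rwa [cons_incl] at this
  induction x using free_induction_incl with
  | zero => exact zero a c n
  | add x y hx hy => exact add a c n x y hx hy
  | incl m w => exact key m a c n w

/-- Two families of linear maps out of the graph of words agree when they agree on the empty words
and their agreement is inherited by the words with one more letter. -/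
theorem free_hom_ext {Γ : GrGraph k Ob} {N : Ob → Ob → ℤ → Type*}
    [∀ a c n, AddCommGroup (N a c n)] [∀ a c n, Module k (N a c n)]
    {f g : ∀ (a c : Ob) (n : ℤ), free Γ a c n →ₗ[k] N a c n}
    (one : ∀ a, f a a 0 (one Γ a) = g a a 0 (one Γ a))
    (cons : ∀ (a b c : Ob) (p q n : ℤ) (h : p + q = n) (γ : Γ b c p) (w : free Γ a b q),
      f a b q w = g a b q w → f a c n (cons Γ h γ w) = g a c n (cons Γ h γ w))
    (a c : Ob) (n : ℤ) (x : free Γ a c n) : f a c n x = g a c n x := by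
  induction a, c, n, x using free_induction with
  | zero a c n => rw [map_zero, map_zero]
  | add a c n x y hx hy => rw [map_add, map_add, hx, hy]
  | smul_one a r => rw [map_smul, map_smul, one]
  | cons a b c p q n h γ w hw => exact cons a b c p q n h γ w hw

theorem wordZeroLift_nil (Γ : GrGraph k Ob) {a : Ob} {N : Type*} [AddCommGroup N]
    [Module k N] (y : a = a → (0 : ℤ) = 0 → N) : wordZeroLift Γ y (wordNil Γ a) = y rfl rfl := by
  unfold wordZeroLift unitLift wordNil unitOne
  erw [Finsupp.lsum_single]
  rw [LinearMap.toSpanSingleton_apply, one_smul]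

@[simp] theorem wordSuccLift_cons (Γ : GrGraph k Ob) (m : ℕ) {a b c : Ob} {p q n : ℤ} {N : Type*}
    [AddCommGroup N] [Module k N]
    (f : ∀ (b : Ob) (p q : ℤ), p + q = n → Γ b c p →ₗ[k] word Γ m a b q →ₗ[k] N)
    (h : p + q = n) (γ : Γ b c p) (w : word Γ m a b q) :
    wordSuccLift Γ m f (wordCons Γ m h γ w) = f b p q h γ w :=
  tensLift_tmul _ _ _ _ _ _

/-! ### Concatenation -/

theorem one_concat (Γ : GrGraph k Ob) {a b : Ob} {q : ℤ} {n : ℤ} (h : 0 + q = n)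
    (v : free Γ a b q) : concat Γ h (one Γ b) v = (free Γ).cast rfl rfl (by omega) v := by
  unfold concat one
  rw [freeLift_incl]
  unfold concatWord
  rw [wordZeroLift_nil]

theorem cons_concat (Γ : GrGraph k Ob) {a b c d : Ob} {p q r m l n : ℤ} (h : p + q = m)
    (h' : m + r = n) (h₁ : q + r = l) (h₂ : p + l = n) (γ : Γ c d p) (w : free Γ b c q)
    (v : free Γ a b r) :
    concat Γ h' (cons Γ h γ w) v = cons Γ h₂ γ (concat Γ h₁ w v) := by
  subst h₁
  induction w using free_induction_incl with
  | zero => simp only [map_zero, LinearMap.zero_apply]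
  | add x y hx hy => simp only [map_add, LinearMap.add_apply, hx, hy]
  | incl j w =>
    rw [cons_incl]
    unfold concat
    rw [freeLift_incl, freeLift_incl]
    conv_lhs => unfold concatWord
    rw [wordSuccLift_cons]
    rfl

theorem concat_one (Γ : GrGraph k Ob) {a c : Ob} {n : ℤ} (x : free Γ a c n) :
    concat Γ (add_zero n) x (one Γ a) = x := by
  refine free_hom_ext (N := fun a c n => free Γ a c n)
    (f := fun a c n => (concat Γ (add_zero n)).flip (one Γ a))
    (g := fun a c n => LinearMap.id) ?_ ?_ a c n x
  · intro a
    simp only [LinearMap.flip_apply, one_concat]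
    rfl
  · intro a b c p q n h γ w hw
    simp only [LinearMap.flip_apply, LinearMap.id_apply] at hw ⊢
    rw [cons_concat Γ h _ (add_zero q) h, hw]

theorem concat_assoc (Γ : GrGraph k Ob) {a b c e : Ob} {p q r pq qr n : ℤ} (hpq : p + q = pq)
    (hqr : q + r = qr) (h : pq + r = n) (h' : p + qr = n) (x : free Γ c e p) (y : free Γ b c q)
    (z : free Γ a b r) : concat Γ h (concat Γ hpq x y) z = concat Γ h' x (concat Γ hqr y z) := by
  induction c, e, p, x using free_induction generalizing pq n with
  | zero => simp only [map_zero, LinearMap.zero_apply]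
  | add a c n x y hx hy =>
    simp only [map_add, LinearMap.add_apply]
    rw [hx, hy]
  | smul_one a s =>
    subst hpq hqr h
    simp only [map_smul, LinearMap.smul_apply, one_concat]
    congr 1
    have key : ∀ (t : ℤ) (ht : q = t) (h : t + r = 0 + q + r) (hh : q + r = 0 + q + r),
      concat Γ h ((free Γ).cast rfl rfl ht y) z
        = (free Γ).cast rfl rfl hh (concat Γ rfl y z) := by
      rintro t rfl h hh
      generalize 0 + q + r = l at *
      subst h
      rfl
    exact key _ _ _ _
  | cons a b c p₁ q₁ n₁ h₁ γ w hw =>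
    rw [cons_concat Γ h₁ hpq rfl (by omega),
      cons_concat Γ (l := q₁ + qr) _ h (by omega) (by omega),
      cons_concat Γ h₁ h' rfl (by omega), hw rfl (by omega) rfl]

@[simp] theorem letter_concat (Γ : GrGraph k Ob) {a b c : Ob} {p q n : ℤ} (h : p + q = n)
    (γ : Γ b c p) (w : free Γ a b q) : concat Γ h (letter Γ γ) w = cons Γ h γ w := by
  unfold letter
  rw [LinearMap.flip_apply, cons_concat Γ (add_zero p) h (zero_add q) h, one_concat]
  rfl

theorem map_unit_smul {M N : Type*} [AddCommGroup M] [AddCommGroup N] [Module k M] [Module k N]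
    (f : M →ₗ[k] N) (u : ℤˣ) (x : M) : f (u • x) = u • f x := by
  rw [Units.smul_def, Units.smul_def, map_zsmul]

theorem map_unit_smul₂ {M M' N : Type*} [AddCommGroup M] [AddCommGroup M'] [AddCommGroup N]
    [Module k M] [Module k M'] [Module k N]
    (f : M →ₗ[k] M' →ₗ[k] N) (u : ℤˣ) (x : M) (y : M') : f (u • x) y = u • f x y := by
  rw [Units.smul_def, Units.smul_def, map_zsmul, LinearMap.smul_apply]

/-! ### Derivations of the free category -/

/-- The derivation of the free category that is given by `δ` on the letters. -/
def deriv (Γ : GrGraph k Ob)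
    (δ : ∀ (a b : Ob) (i j : ℤ), j + 1 = i → Γ a b i →ₗ[k] free Γ a b j) {a b : Ob} {i j : ℤ}
    (h : j + 1 = i) : free Γ a b i →ₗ[k] free Γ a b j :=
  freeLift Γ fun m => derivWord Γ δ m h

section deriv

variable {Γ : GrGraph k Ob} (δ : ∀ (a b : Ob) (i j : ℤ), j + 1 = i → Γ a b i →ₗ[k] free Γ a b j)

theorem deriv_one {a : Ob} {j : ℤ} (h : j + 1 = 0) : deriv Γ δ h (one Γ a) = 0 := by
  unfold deriv one
  rw [freeLift_incl]
  rfl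

theorem deriv_cons {a b c : Ob} {p q p' q' i j : ℤ} (h : p + q = i) (h' : j + 1 = i)
    (hp : p' + 1 = p) (hq : q' + 1 = q) (h₁ : p' + q = j) (h₂ : p + q' = j) (γ : Γ b c p)
    (w : free Γ a b q) :
    deriv Γ δ h' (cons Γ h γ w)
      = concat Γ h₁ (δ b c p p' hp γ) w + p.negOnePow • cons Γ h₂ γ (deriv Γ δ hq w) := by
  obtain rfl : p' = p - 1 := by omega
  obtain rfl : q' = q - 1 := by omega
  induction w using free_induction_incl with
  | zero => simp only [map_zero, smul_zero, add_zero]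
  | add x y hx hy =>
    simp only [map_add, hx, hy, smul_add]
    abel
  | incl m w =>
    rw [cons_incl]
    unfold deriv
    rw [freeLift_incl, freeLift_incl]
    conv_lhs => unfold derivWord
    rw [wordSuccLift_cons]
    rfl

theorem deriv_letter {a b : Ob} {i j : ℤ} (h : j + 1 = i) (γ : Γ a b i) :
    deriv Γ δ h (letter Γ γ) = δ a b i j h γ := by
  unfold letter
  rw [LinearMap.flip_apply, deriv_cons δ (add_zero i) h h (sub_add_cancel 0 1) (add_zero j)
    (by omega), deriv_one, map_zero, smul_zero, add_zero, concat_one]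

theorem deriv_concat {a b c : Ob} {p q p' q' i j : ℤ} (h : p + q = i) (h' : j + 1 = i)
    (hp : p' + 1 = p) (hq : q' + 1 = q) (h₁ : p' + q = j) (h₂ : p + q' = j) (x : free Γ b c p)
    (y : free Γ a b q) :
    deriv Γ δ h' (concat Γ h x y)
      = concat Γ h₁ (deriv Γ δ hp x) y + p.negOnePow • concat Γ h₂ x (deriv Γ δ hq y) := by
  induction b, c, p, x using free_induction generalizing p' i j with
  | zero => simp only [map_zero, LinearMap.zero_apply, smul_zero, add_zero]
  | add a c n x y hx hy =>
    simp only [map_add, LinearMap.add_apply, smul_add]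
    rw [hx h h' hp h₁ h₂, hy h h' hp h₁ h₂]
    abel
  | smul_one a s =>
    obtain rfl : q = i := by omega
    obtain rfl : q' = j := by omega
    simp only [map_smul, LinearMap.smul_apply, one_concat, deriv_one, Int.negOnePow_zero, one_smul,
      smul_zero, LinearMap.map_zero, LinearMap.zero_apply, zero_add]
    rfl
  | cons a b c p₁ q₁ n₁ h₀ γ w hw =>
    rw [cons_concat Γ h₀ h rfl (by omega),
      deriv_cons δ (p' := p₁ - 1) (q' := q₁ + q - 1) (by omega) h' (by omega) (by omega) (by omega)
        (by omega),
      hw (p' := q₁ - 1) rfl (by omega) (by omega) (by omega) (by omega),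
      deriv_cons δ (p' := p₁ - 1) (q' := q₁ - 1) h₀ hp (by omega) (by omega) (by omega)
        (by omega), map_add (concat Γ h₁), LinearMap.add_apply, map_unit_smul₂,
      cons_concat Γ (l := q₁ + q - 1) _ h₁ (by omega) (by omega),
      cons_concat Γ (l := q₁ + q - 1) _ h₂ (by omega) (by omega), map_add, map_unit_smul, smul_add,
      smul_smul, ← Int.negOnePow_add, h₀,
      concat_assoc Γ (qr := q₁ + q) _ rfl _ (by omega)]
    abel

/-- A derivation of odd degree squares to a derivation, so its square vanishes when it vanishes on
the letters. -/
theorem deriv_deriv (hδ : ∀ (a b : Ob) (l m n : ℤ) (h : m + 1 = l) (h' : n + 1 = m)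
    (γ : Γ a b l), deriv Γ δ h' (δ a b l m h γ) = 0) {a b : Ob} {l m n : ℤ} (h : m + 1 = l)
    (h' : n + 1 = m) (x : free Γ a b l) : deriv Γ δ h' (deriv Γ δ h x) = 0 := by
  induction a, b, l, x using free_induction generalizing m n with
  | zero => simp only [map_zero]
  | add a c n x y hx hy => simp only [map_add, hx, hy, add_zero]
  | smul_one a s => simp only [map_smul, deriv_one, map_zero, smul_zero]
  | cons a b c p q n' h₀ γ w hw =>
    rw [deriv_cons δ (p' := p - 1) (q' := q - 1) h₀ h (by omega) (by omega) (by omega) (by omega),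
      map_add, map_unit_smul,
      deriv_concat δ (p' := p - 2) (q' := q - 1) _ h' (by omega) (by omega) (by omega) (by omega),
      deriv_cons δ (p' := p - 1) (q' := q - 2) _ h' (by omega) (by omega) (by omega) (by omega),
      hδ, hw, map_zero, map_zero, LinearMap.zero_apply, smul_zero, zero_add, add_zero,
      Int.negOnePow_sub, Int.negOnePow_one, mul_neg, mul_one, Units.neg_smul, neg_add_cancel]

end deriv

/-! ### Deconcatenation -/

/-- Adding a letter in front of the first component: `γ`, `w ⊗ y ↦ (γ ⊗ w) ⊗ y`. -/
def consTens (Γ Λ : GrGraph k Ob) {a b c : Ob} {p q n : ℤ} (h : p + q = n) (γ : Γ b c p) :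
    tens (free Γ) Λ a b q →ₗ[k] tens (free Γ) Λ a c n :=
  tensLift (free Γ) Λ fun _ q₁ _ _ =>
    (tmul (free Γ) Λ (p := p + q₁) (by omega)).comp (cons Γ rfl γ)

theorem consTens_tmul (Γ Λ : GrGraph k Ob) {a b c x : Ob} {p q n q₁ q₂ m : ℤ} (h : p + q = n)
    (h' : q₁ + q₂ = q) (h₁ : p + q₁ = m) (h₂ : m + q₂ = n) (γ : Γ b c p) (w : free Γ x b q₁)
    (y : Λ a x q₂) :
    consTens Γ Λ h γ (tmul (free Γ) Λ h' w y) = tmul (free Γ) Λ h₂ (cons Γ h₁ γ w) y := by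
  subst h₁
  unfold consTens
  rw [tensLift_tmul]
  rfl

/-- The cocomposition of the free cocategory. -/
def deconcat (Γ : GrGraph k Ob) : Hom (free Γ) (tens (free Γ) (free Γ)) :=
  fun _ _ _ => freeLift Γ fun m => deconcatWord Γ m

theorem deconcat_one (Γ : GrGraph k Ob) (a : Ob) :
    deconcat Γ a a 0 (one Γ a) = tmul (free Γ) (free Γ) (add_zero 0) (one Γ a) (one Γ a) := by
  conv_lhs => unfold deconcat one
  rw [freeLift_incl]
  unfold deconcatWord
  rw [wordZeroLift_nil]
  rfl

theorem deconcat_cons (Γ : GrGraph k Ob) {a b c : Ob} {p q n : ℤ} (h : p + q = n) (γ : Γ b c p)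
    (w : free Γ a b q) :
    deconcat Γ a c n (cons Γ h γ w)
      = tmul (free Γ) (free Γ) (zero_add n) (one Γ c) (cons Γ h γ w)
        + consTens Γ (free Γ) h γ (deconcat Γ a b q w) := by
  induction w using free_induction_incl with
  | zero => simp only [map_zero, add_zero]
  | add x y hx hy =>
    simp only [map_add, hx, hy]
    abel
  | incl m w =>
    rw [cons_incl]
    conv_lhs => unfold deconcat
    rw [freeLift_incl]
    conv_lhs => unfold deconcatWord
    rw [LinearMap.add_apply]
    congr 1
    rw [wordSuccLift_cons, LinearMap.flip_apply, LinearMap.comp_apply]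
    conv_rhs => unfold deconcat
    rw [freeLift_incl]
    generalize deconcatWord Γ m w = z
    induction z using tens_induction with
    | zero => simp only [map_zero, LinearMap.zero_apply]
    | add x y hx hy => simp only [map_add, LinearMap.add_apply, hx, hy]
    | tmul b p q h x y =>
      rw [consTens_tmul Γ _ _ _ rfl (by omega), tensLift_tmul]
      rfl

theorem deconcat_coassoc (Γ : GrGraph k Ob) {a c : Ob} {n : ℤ} (x : free Γ a c n) :
    assoc (free Γ) (free Γ) (free Γ) a c n
        (tensMap (deconcat Γ) (Hom.id (free Γ)) a c n (deconcat Γ a c n x))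
      = tensMap (Hom.id (free Γ)) (deconcat Γ) a c n (deconcat Γ a c n x) := by
  induction a, c, n, x using free_induction with
  | zero => simp only [map_zero]
  | add a c n x y hx hy => simp only [map_add, hx, hy]
  | smul_one a r =>
    simp only [map_smul]
    rw [deconcat_one, tensMap_tmul, tensMap_tmul, deconcat_one,
      assoc_tmul _ _ _ _ _ (add_zero 0) (add_zero 0)]
    rfl
  | cons a b c p q n h γ w hw =>
    have hA : ∀ (b' : Ob) (q₁ q₂ m : ℤ) (h₁ : q₁ + q₂ = q) (h₂ : p + q₁ = m) (h₃ : m + q₂ = n)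
        (T : tens (free Γ) (free Γ) b' b q₁) (y : free Γ a b' q₂),
        assoc (free Γ) (free Γ) (free Γ) a c n (tmul _ _ h₃ (consTens Γ (free Γ) h₂ γ T) y)
          = consTens Γ _ h γ (assoc (free Γ) (free Γ) (free Γ) a b q (tmul _ _ h₁ T y)) := by
      intro b' q₁ q₂ m h₁ h₂ h₃ T y
      induction T using tens_induction with
      | zero => simp only [map_zero, LinearMap.zero_apply]
      | add T T' hT hT' => simp only [map_add, LinearMap.add_apply, hT, hT']
      | tmul b'' r₁ r₂ h₄ x z =>
        rw [consTens_tmul Γ _ _ _ rfl (by omega), assoc_tmul _ _ _ _ _ rfl (by omega),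
          assoc_tmul _ _ _ _ _ rfl (by omega), consTens_tmul Γ _ _ _ rfl (by omega)]
    have hB : ∀ T : tens (free Γ) (free Γ) a b q,
        assoc (free Γ) (free Γ) (free Γ) a c n
          (tensMap (deconcat Γ) (Hom.id (free Γ)) a c n (consTens Γ (free Γ) h γ T))
        = tmul _ _ (zero_add n) (one Γ c) (consTens Γ (free Γ) h γ T)
          + consTens Γ _ h γ (assoc (free Γ) (free Γ) (free Γ) a b q
            (tensMap (deconcat Γ) (Hom.id (free Γ)) a b q T)) := by
      intro T
      induction T using tens_induction with
      | zero => simp only [map_zero, add_zero]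
      | add T T' hT hT' =>
        simp only [map_add, hT, hT']
        abel
      | tmul b' r₁ r₂ h₄ x z =>
        rw [consTens_tmul Γ _ _ _ rfl (by omega), tensMap_tmul, tensMap_tmul, deconcat_cons,
          map_add, LinearMap.add_apply, map_add, assoc_tmul _ _ _ _ _ (by omega) (zero_add n),
          hA b' r₁ r₂ (p + r₁) h₄ rfl]
        rfl
    have hC : ∀ T : tens (free Γ) (free Γ) a b q,
        tensMap (Hom.id (free Γ)) (deconcat Γ) a c n (consTens Γ (free Γ) h γ T)
          = consTens Γ _ h γ (tensMap (Hom.id (free Γ)) (deconcat Γ) a b q T) := by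
      intro T
      induction T using tens_induction with
      | zero => simp only [map_zero]
      | add T T' hT hT' => simp only [map_add, hT, hT']
      | tmul b' r₁ r₂ h₄ x z =>
        rw [consTens_tmul Γ _ _ _ rfl (by omega), tensMap_tmul, tensMap_tmul,
          consTens_tmul Γ _ _ _ rfl (by omega)]
        rfl
    rw [deconcat_cons, map_add, map_add, map_add, tensMap_tmul, tensMap_tmul, hB, hC, hw,
      deconcat_one, deconcat_cons, map_add, assoc_tmul _ _ _ _ _ (zero_add n) (zero_add n),
      Hom.id_apply, Hom.id_apply]
    abel

end GrGraph
end GraphLemmas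

section FreeCocategory

variable {k : Type u} [Field k] {Ob : Type v}

namespace GrGraph

/-! ### Coderivations of the free cocategory -/

/-- Composition of the first letter of a word with a letter in front of it, by means of `μ`. -/
def merge (Γ : GrGraph k Ob)
    (μ : ∀ (a b c : Ob) (p q n : ℤ), n + 1 = p + q → Γ b c p →ₗ[k] Γ a b q →ₗ[k] Γ a c n)
    {a b c : Ob} {p q n : ℤ} (h : n + 1 = p + q) :
    Γ b c p →ₗ[k] free Γ a b q →ₗ[k] free Γ a c n :=
  (freeLift Γ fun m => (mergeWord Γ μ m h).flip).flip

/-- The coderivation of the free cocategory with components `δ` and `μ`. -/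
def coderiv (Γ : GrGraph k Ob)
    (δ : ∀ (a b : Ob) (i j : ℤ), j + 1 = i → Γ a b i →ₗ[k] Γ a b j)
    (μ : ∀ (a b c : Ob) (p q n : ℤ), n + 1 = p + q → Γ b c p →ₗ[k] Γ a b q →ₗ[k] Γ a c n)
    {a b : Ob} {i j : ℤ} (h : j + 1 = i) : free Γ a b i →ₗ[k] free Γ a b j :=
  freeLift Γ fun m => coderivWord Γ δ μ m h

section

variable {Γ : GrGraph k Ob} (δ : ∀ (a b : Ob) (i j : ℤ), j + 1 = i → Γ a b i →ₗ[k] Γ a b j)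
  (μ : ∀ (a b c : Ob) (p q n : ℤ), n + 1 = p + q → Γ b c p →ₗ[k] Γ a b q →ₗ[k] Γ a c n)

theorem merge_one {a b : Ob} {p n : ℤ} (h : n + 1 = p + 0) (γ : Γ a b p) :
    merge Γ μ h γ (one Γ a) = 0 := by
  unfold merge one
  rw [LinearMap.flip_apply, freeLift_incl]
  rfl

theorem merge_cons {a b c e : Ob} {p q q₁ q₂ m n : ℤ} (h : n + 1 = p + q) (h₀ : q₁ + q₂ = q)
    (h₁ : m + 1 = p + q₁) (h₂ : m + q₂ = n) (γ : Γ c e p) (γ₁ : Γ b c q₁) (w : free Γ a b q₂) :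
    merge Γ μ h γ (cons Γ h₀ γ₁ w) = cons Γ h₂ (μ b c e p q₁ m h₁ γ γ₁) w := by
  obtain rfl : m = p + q₁ - 1 := by omega
  induction w using free_induction_incl with
  | zero => simp only [map_zero]
  | add x y hx hy => simp only [map_add, hx, hy]
  | incl j w =>
    rw [cons_incl]
    unfold merge
    rw [LinearMap.flip_apply, freeLift_incl, LinearMap.flip_apply]
    conv_lhs => unfold mergeWord
    rw [LinearMap.flip_apply, wordSuccLift_cons]
    rfl

theorem coderiv_one {a : Ob} {j : ℤ} (h : j + 1 = 0) : coderiv Γ δ μ h (one Γ a) = 0 := by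
  unfold coderiv one
  rw [freeLift_incl]
  rfl

theorem coderiv_cons {a b c : Ob} {p q p' q' i j : ℤ} (h : p + q = i) (h' : j + 1 = i)
    (hp : p' + 1 = p) (hq : q' + 1 = q) (h₁ : p' + q = j) (h₂ : p + q' = j) (h₃ : j + 1 = p + q)
    (γ : Γ b c p) (w : free Γ a b q) :
    coderiv Γ δ μ h' (cons Γ h γ w)
      = cons Γ h₁ (δ b c p p' hp γ) w + merge Γ μ h₃ γ w
        + p.negOnePow • cons Γ h₂ γ (coderiv Γ δ μ hq w) := by
  obtain rfl : p' = p - 1 := by omega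
  obtain rfl : q' = q - 1 := by omega
  induction w using free_induction_incl with
  | zero => simp only [map_zero, smul_zero, add_zero]
  | add x y hx hy =>
    simp only [map_add, hx, hy, smul_add]
    abel
  | incl m w =>
    rw [cons_incl]
    unfold coderiv merge
    rw [freeLift_incl, freeLift_incl, LinearMap.flip_apply, freeLift_incl]
    conv_lhs => unfold coderivWord
    rw [wordSuccLift_cons]
    rfl

theorem coderiv_cons_of_eq_zero
    (hδ : ∀ (a b : Ob) (i j : ℤ) (h : j + 1 = i) (γ : Γ a b i), δ a b i j h γ = 0)
    {a b c : Ob} {p q q' i j : ℤ} (h : p + q = i) (h' : j + 1 = i)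
    (hq : q' + 1 = q) (h₂ : p + q' = j) (h₃ : j + 1 = p + q) (γ : Γ b c p) (w : free Γ a b q) :
    coderiv Γ δ μ h' (cons Γ h γ w)
      = merge Γ μ h₃ γ w + p.negOnePow • cons Γ h₂ γ (coderiv Γ δ μ hq w) := by
  rw [coderiv_cons δ μ (p' := p - 1) h h' (by omega) hq (by omega) h₂ h₃, hδ, map_zero,
    LinearMap.zero_apply, zero_add]

/-- Associativity of `μ`, up to the sign produced by the shift of the degrees, extended from letters
to words. -/
theorem merge_merge
    (hμ : ∀ (a b c e : Ob) (p q r pq qr n : ℤ) (h₁ : pq + 1 = p + q) (h₂ : n + 1 = pq + r)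
      (h₃ : qr + 1 = q + r) (h₄ : n + 1 = p + qr) (x : Γ c e p) (y : Γ b c q) (z : Γ a b r),
      μ a b e pq r n h₂ (μ b c e p q pq h₁ x y) z
        = -(p.negOnePow • μ a c e p qr n h₄ x (μ a b c q r qr h₃ y z)))
    {a b c e : Ob} {p q r pq qr n : ℤ} (h₁ : pq + 1 = p + q) (h₂ : n + 1 = pq + r)
    (h₃ : qr + 1 = q + r) (h₄ : n + 1 = p + qr) (x : Γ c e p) (y : Γ b c q) (w : free Γ a b r) :
    merge Γ μ h₂ (μ b c e p q pq h₁ x y) w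
      = -(p.negOnePow • merge Γ μ h₄ x (merge Γ μ h₃ y w)) := by
  induction a, b, r, w using free_induction generalizing qr n with
  | zero => simp only [map_zero, smul_zero, neg_zero]
  | add a c n w w' hw hw' =>
    simp only [map_add, smul_add, neg_add]
    rw [hw h₂ h₃ h₄, hw' h₂ h₃ h₄]
  | smul_one a r => simp only [map_smul, merge_one, map_zero, smul_zero, neg_zero]
  | cons a b' b q₁ q₂ r h γ w _ =>
    rw [merge_cons (m := pq + q₁ - 1) μ h₂ h (by omega) (by omega),
      merge_cons (m := q + q₁ - 1) μ h₃ h (by omega) (by omega),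
      merge_cons (m := pq + q₁ - 1) μ h₄ _ (by omega) (by omega),
      hμ b' b c e p q q₁ pq (q + q₁ - 1) (pq + q₁ - 1) h₁ (by omega) (by omega) (by omega),
      map_neg, LinearMap.neg_apply, map_unit_smul₂]

/-- The coderivation anticommutes with the composition of a letter with the first letter of a word,
because `μ` is associative up to sign. -/
theorem coderiv_merge
    (hδ : ∀ (a b : Ob) (i j : ℤ) (h : j + 1 = i) (γ : Γ a b i), δ a b i j h γ = 0)
    (hμ : ∀ (a b c e : Ob) (p q r pq qr n : ℤ) (h₁ : pq + 1 = p + q) (h₂ : n + 1 = pq + r)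
      (h₃ : qr + 1 = q + r) (h₄ : n + 1 = p + qr) (x : Γ c e p) (y : Γ b c q) (z : Γ a b r),
      μ a b e pq r n h₂ (μ b c e p q pq h₁ x y) z
        = -(p.negOnePow • μ a c e p qr n h₄ x (μ a b c q r qr h₃ y z)))
    {a b c : Ob} {p q n q' n' : ℤ} (h : n + 1 = p + q) (h' : n' + 1 = n) (hq : q' + 1 = q)
    (h₁ : n' + 1 = p + q') (γ : Γ b c p) (w : free Γ a b q) :
    coderiv Γ δ μ h' (merge Γ μ h γ w)
      = -(p.negOnePow • merge Γ μ h₁ γ (coderiv Γ δ μ hq w)) := by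
  induction a, b, q, w using free_induction generalizing n q' n' with
  | zero => simp only [map_zero, smul_zero, neg_zero]
  | add a c n x y hx hy =>
    simp only [map_add, smul_add, neg_add]
    rw [hx h h' hq h₁, hy h h' hq h₁]
  | smul_one a r =>
    simp only [map_smul, merge_one, coderiv_one, map_zero, smul_zero, neg_zero]
  | cons a b' b q₁ q₂ q h₀ γ₁ w _ =>
    rw [merge_cons (m := p + q₁ - 1) μ h h₀ (by omega) (by omega),
      coderiv_cons_of_eq_zero δ μ hδ (q' := q₂ - 1) _ h' (by omega) (by omega) (by omega),
      coderiv_cons_of_eq_zero δ μ hδ (q' := q₂ - 1) _ hq (by omega) (by omega) (by omega),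
      merge_merge μ hμ (qr := q') _ _ (by omega) h₁, map_add, map_unit_smul,
      merge_cons (m := p + q₁ - 1) μ h₁ _ (by omega) (by omega), smul_add, neg_add,
      smul_smul, ← Int.negOnePow_add, Int.negOnePow_sub, Int.negOnePow_one, mul_neg, mul_one,
      Units.neg_smul]

theorem coderiv_coderiv
    (hδ : ∀ (a b : Ob) (i j : ℤ) (h : j + 1 = i) (γ : Γ a b i), δ a b i j h γ = 0)
    (hμ : ∀ (a b c e : Ob) (p q r pq qr n : ℤ) (h₁ : pq + 1 = p + q) (h₂ : n + 1 = pq + r)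
      (h₃ : qr + 1 = q + r) (h₄ : n + 1 = p + qr) (x : Γ c e p) (y : Γ b c q) (z : Γ a b r),
      μ a b e pq r n h₂ (μ b c e p q pq h₁ x y) z
        = -(p.negOnePow • μ a c e p qr n h₄ x (μ a b c q r qr h₃ y z)))
    {a b : Ob} {l m n : ℤ} (h : m + 1 = l) (h' : n + 1 = m) (w : free Γ a b l) :
    coderiv Γ δ μ h' (coderiv Γ δ μ h w) = 0 := by
  induction a, b, l, w using free_induction generalizing m n with
  | zero => simp only [map_zero]
  | add a c n x y hx hy => simp only [map_add, hx, hy, add_zero]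
  | smul_one a r => simp only [map_smul, coderiv_one, map_zero, smul_zero]
  | cons a b c p q l h₀ γ w hw =>
    rw [coderiv_cons_of_eq_zero δ μ hδ (q' := q - 1) h₀ h (by omega) (by omega) (by omega),
      map_add, map_unit_smul,
      coderiv_merge δ μ hδ hμ (q' := q - 1) _ h' (by omega) (by omega),
      coderiv_cons_of_eq_zero δ μ hδ (q' := q - 2) _ h' (by omega) (by omega) (by omega),
      hw, map_zero, smul_zero, add_zero, neg_add_cancel]

/-- Composition of a letter with the first letter of the first component of a pair of words. -/
def mergeTens (Λ : GrGraph k Ob) {a b c : Ob} {p q n : ℤ} (h : n + 1 = p + q) (γ : Γ b c p) :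
    tens (free Γ) Λ a b q →ₗ[k] tens (free Γ) Λ a c n :=
  tensLift (free Γ) Λ fun _ q₁ _ _ =>
    (tmul (free Γ) Λ (p := p + q₁ - 1) (by omega)).comp (merge Γ μ (by omega) γ)

theorem mergeTens_tmul (Λ : GrGraph k Ob) {a b c x : Ob} {p q n q₁ q₂ m : ℤ} (h : n + 1 = p + q)
    (h' : q₁ + q₂ = q) (h₁ : m + 1 = p + q₁) (h₂ : m + q₂ = n) (γ : Γ b c p) (w : free Γ x b q₁)
    (y : Λ a x q₂) :
    mergeTens μ Λ h γ (tmul (free Γ) Λ h' w y) = tmul (free Γ) Λ h₂ (merge Γ μ h₁ γ w) y := by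
  obtain rfl : m = p + q₁ - 1 := by omega
  unfold mergeTens
  rw [tensLift_tmul]
  rfl

theorem mergeTens_consTens (Λ : GrGraph k Ob) {a b c e : Ob} {p q q₁ q₂ m n : ℤ}
    (h : n + 1 = p + q) (h₀ : q₁ + q₂ = q) (h₁ : m + 1 = p + q₁) (h₂ : m + q₂ = n) (γ : Γ c e p)
    (γ₁ : Γ b c q₁) (T : tens (free Γ) Λ a b q₂) :
    mergeTens μ Λ h γ (consTens Γ Λ h₀ γ₁ T) = consTens Γ Λ h₂ (μ b c e p q₁ m h₁ γ γ₁) T := by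
  induction T using tens_induction with
  | zero => simp only [map_zero]
  | add T T' hT hT' => simp only [map_add, hT, hT']
  | tmul b' r₁ r₂ h₄ x z =>
    rw [consTens_tmul Γ _ _ _ rfl (by omega), consTens_tmul Γ _ _ _ rfl (by omega),
      mergeTens_tmul μ Λ (m := m + r₁) _ _ (by omega) (by omega),
      merge_cons μ (m := m) _ _ (by omega) (by omega)]

/-- The composition of the first two letters of a word is compatible with cutting the word. The
first summand is the cut in front of the word, which the second one omits. -/
theorem deconcat_merge {a b c : Ob} {p q n : ℤ} (h : n + 1 = p + q) (γ : Γ b c p)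
    (w : free Γ a b q) :
    deconcat Γ a c n (merge Γ μ h γ w)
      = tmul (free Γ) (free Γ) (zero_add n) (one Γ c) (merge Γ μ h γ w)
        + mergeTens μ (free Γ) h γ (deconcat Γ a b q w) := by
  induction a, b, q, w using free_induction generalizing n with
  | zero => simp only [map_zero, add_zero]
  | add a c n x y hx hy =>
    simp only [map_add]
    rw [hx h, hy h]
    abel
  | smul_one a r =>
    simp only [map_smul, merge_one, map_zero, smul_zero, zero_add, deconcat_one]
    rw [mergeTens_tmul μ (m := n) _ _ _ (by omega) (by omega), merge_one, map_zero,
      LinearMap.zero_apply, smul_zero]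
  | cons a b' b q₁ q₂ q h₀ γ₁ w _ =>
    rw [merge_cons (m := p + q₁ - 1) μ h h₀ (by omega) (by omega), deconcat_cons, deconcat_cons,
      map_add, mergeTens_consTens μ (m := p + q₁ - 1) _ _ _ (by omega) (by omega),
      mergeTens_tmul μ (m := p - 1) _ _ _ (by omega) (by omega), merge_one, map_zero,
      LinearMap.zero_apply, zero_add]

end

end GrGraph

/-- The free cocategory on `Γ` with the coderivation with components `δ` and `μ`. -/
abbrev freeCocat (Γ : GrGraph k Ob)
    (δ : ∀ (a b : Ob) (i j : ℤ), j + 1 = i → Γ a b i →ₗ[k] Γ a b j)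
    (μ : ∀ (a b c : Ob) (p q n : ℤ), n + 1 = p + q → Γ b c p →ₗ[k] Γ a b q →ₗ[k] Γ a c n) :
    CocatData k Ob where
  X := free Γ
  d _ _ _ _ h := coderiv Γ δ μ h
  counit _ := freeLift Γ fun m =>
    match m with
    | 0 => wordZeroLift _ fun _ _ => (1 : k)
    | _ + 1 => 0
  Δ := deconcat Γ

section

variable (Γ : GrGraph k Ob)
  (δ : ∀ (a b : Ob) (i j : ℤ), j + 1 = i → Γ a b i →ₗ[k] Γ a b j)
  (μ : ∀ (a b c : Ob) (p q n : ℤ), n + 1 = p + q → Γ b c p →ₗ[k] Γ a b q →ₗ[k] Γ a c n)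

theorem freeCocat_counit_one (a : Ob) : (freeCocat Γ δ μ).counit a (GrGraph.one Γ a) = 1 := by
  unfold freeCocat GrGraph.one
  dsimp only
  rw [freeLift_incl]
  exact wordZeroLift_nil Γ _

theorem freeCocat_counit_cons {a b : Ob} {p q : ℤ} (h : p + q = 0) (γ : Γ b a p)
    (w : free Γ a b q) : (freeCocat Γ δ μ).counit a (cons Γ h γ w) = 0 := by
  induction w using free_induction_incl with
  | zero => rw [map_zero, map_zero]
  | add x y hx hy => rw [map_add, map_add, hx, hy, add_zero]
  | incl m w =>
    rw [cons_incl]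
    unfold freeCocat
    dsimp only
    rw [freeLift_incl]
    rfl

theorem _root_.TreeKoszul.CocatData.counitLeft_tmul (R : CocatData k Ob) {a c : Ob} {n : ℤ}
    (x : R.X c c 0) (y : R.X a c n) :
    R.counitLeft a c n (tmul R.X R.X (zero_add n) x y) = R.counit c x • y := by
  unfold CocatData.counitLeft
  rw [tensLift_tmul, dif_pos ⟨rfl, rfl⟩]
  rfl

theorem _root_.TreeKoszul.CocatData.counitLeft_tmul_of_ne (R : CocatData k Ob) {a b c : Ob}
    {p q n : ℤ} (h : p + q = n) (hb : ¬ (b = c ∧ p = 0)) (x : R.X b c p) (y : R.X a b q) :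
    R.counitLeft a c n (tmul R.X R.X h x y) = 0 := by
  unfold CocatData.counitLeft
  rw [tensLift_tmul, dif_neg hb]
  rfl

theorem _root_.TreeKoszul.CocatData.counitRight_tmul (R : CocatData k Ob) {a c : Ob} {n : ℤ}
    (x : R.X a c n) (y : R.X a a 0) :
    R.counitRight a c n (tmul R.X R.X (add_zero n) x y) = R.counit a y • x := by
  unfold CocatData.counitRight
  rw [tensLift_tmul, dif_pos ⟨rfl, rfl⟩]
  rfl

theorem _root_.TreeKoszul.CocatData.counitRight_tmul_of_ne (R : CocatData k Ob) {a b c : Ob}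
    {p q n : ℤ} (h : p + q = n) (hb : ¬ (b = a ∧ q = 0)) (x : R.X b c p) (y : R.X a b q) :
    R.counitRight a c n (tmul R.X R.X h x y) = 0 := by
  unfold CocatData.counitRight
  rw [tensLift_tmul, dif_neg hb]
  rfl

theorem _root_.TreeKoszul.CocatData.tensD_tmul (R : CocatData k Ob) {a b c : Ob}
    {p q m n p' q' : ℤ} (h : n + 1 = m) (h' : p + q = m) (hp : p' + 1 = p) (hq : q' + 1 = q)
    (h₁ : p' + q = n) (h₂ : p + q' = n) (x : R.X b c p) (y : R.X a b q) :
    R.tensD a c h (tmul R.X R.X h' x y)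
      = tmul R.X R.X h₁ (R.d b c hp x) y + p.negOnePow • tmul R.X R.X h₂ x (R.d a b hq y) := by
  obtain rfl : p' = p - 1 := by omega
  obtain rfl : q' = q - 1 := by omega
  unfold CocatData.tensD
  rw [tensLift_tmul]
  rfl

theorem freeCocat_counitLeft_consTens {a b c : Ob} {p q n : ℤ} (h : p + q = n) (γ : Γ b c p)
    (T : tens (free Γ) (free Γ) a b q) :
    (freeCocat Γ δ μ).counitLeft a c n (consTens Γ (free Γ) h γ T) = 0 := by
  induction T using tens_induction with
  | zero => rw [map_zero, map_zero]
  | add x y hx hy => rw [map_add, map_add, hx, hy, add_zero]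
  | tmul b' r₁ r₂ h₄ x z =>
    rw [consTens_tmul Γ _ _ _ rfl (by omega)]
    by_cases hb : b' = c ∧ p + r₁ = 0
    · obtain ⟨rfl, hp⟩ := hb
      have key : ∀ (l : ℤ) (hl : l = 0) (h₁ : p + r₁ = l) (h₂ : l + r₂ = n),
          (freeCocat Γ δ μ).counitLeft a b' n
            (tmul (free Γ) (free Γ) h₂ (cons Γ h₁ γ x) z) = 0 := by
        rintro l rfl h₁ h₂
        obtain rfl : r₂ = n := by omega
        refine (CocatData.counitLeft_tmul (freeCocat Γ δ μ) _ z).trans ?_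
        rw [freeCocat_counit_cons, zero_smul]
      exact key _ hp _ _
    · exact CocatData.counitLeft_tmul_of_ne (freeCocat Γ δ μ) _ hb _ _

theorem freeCocat_counitRight_consTens {a b c : Ob} {p q n : ℤ} (h : p + q = n) (γ : Γ b c p)
    (T : tens (free Γ) (free Γ) a b q) :
    (freeCocat Γ δ μ).counitRight a c n (consTens Γ (free Γ) h γ T)
      = cons Γ h γ ((freeCocat Γ δ μ).counitRight a b q T) := by
  induction T using tens_induction with
  | zero => simp only [map_zero]
  | add x y hx hy => rw [map_add, map_add, hx, hy, map_add, map_add]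
  | tmul b' r₁ r₂ h₄ x z =>
    rw [consTens_tmul Γ _ _ _ rfl (by omega)]
    by_cases hb : b' = a ∧ r₂ = 0
    · obtain ⟨rfl, rfl⟩ := hb
      obtain rfl : r₁ = q := by omega
      obtain rfl : p + r₁ = n := by omega
      refine (CocatData.counitRight_tmul (freeCocat Γ δ μ) _ z).trans ?_
      refine Eq.trans ?_ (congrArg _ (CocatData.counitRight_tmul (freeCocat Γ δ μ) x z).symm)
      exact (map_smul (cons Γ h γ) _ _).symm
    · refine (CocatData.counitRight_tmul_of_ne (freeCocat Γ δ μ) _ hb _ _).trans ?_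
      refine Eq.trans ?_
        (congrArg _ (CocatData.counitRight_tmul_of_ne (freeCocat Γ δ μ) _ hb x z).symm)
      rw [map_zero]

theorem freeCocat_tensD_consTens
    (hδ : ∀ (a b : Ob) (i j : ℤ) (h : j + 1 = i) (γ : Γ a b i), δ a b i j h γ = 0)
    {a b c : Ob} {p q n q' n' : ℤ} (h : p + q = n) (hn : n' + 1 = n) (hq : q' + 1 = q)
    (h₁ : n' + 1 = p + q) (h₂ : p + q' = n') (γ : Γ b c p) (T : tens (free Γ) (free Γ) a b q) :
    (freeCocat Γ δ μ).tensD a c hn (consTens Γ (free Γ) h γ T)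
      = mergeTens μ (free Γ) h₁ γ T
        + p.negOnePow • consTens Γ (free Γ) h₂ γ ((freeCocat Γ δ μ).tensD a b hq T) := by
  induction T using tens_induction with
  | zero => simp only [map_zero, smul_zero, add_zero]
  | add x y hx hy =>
    rw [map_add, map_add, hx, hy, map_add, map_add, map_add, smul_add]
    abel
  | tmul b' r₁ r₂ h₄ x z =>
    rw [consTens_tmul Γ _ _ _ rfl (by omega)]
    refine (CocatData.tensD_tmul (freeCocat Γ δ μ) (p' := p + r₁ - 1) (q' := r₂ - 1) hn _ (by omega)
      (by omega) (by omega) (by omega) _ z).trans ?_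
    refine Eq.trans ?_ (congrArg (fun t => _ + p.negOnePow • consTens Γ (free Γ) h₂ γ t)
      (CocatData.tensD_tmul (freeCocat Γ δ μ) (p' := r₁ - 1) (q' := r₂ - 1) hq h₄ (by omega)
      (by omega) (by omega) (by omega) x z).symm)
    rw [mergeTens_tmul μ (m := p + r₁ - 1) _ _ _ (by omega) (by omega), map_add, map_unit_smul]
    change tmul (free Γ) (free Γ) _ (coderiv Γ δ μ _ _) _ + _ • tmul (free Γ) (free Γ) _ _
      (coderiv Γ δ μ _ _) = _ + p.negOnePow • (consTens Γ (free Γ) _ _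
        (tmul (free Γ) (free Γ) _ (coderiv Γ δ μ _ _) _) + _ • consTens Γ (free Γ) _ _
          (tmul (free Γ) (free Γ) _ _ (coderiv Γ δ μ _ _)))
    rw [coderiv_cons_of_eq_zero δ μ hδ (q' := r₁ - 1) _ _ (by omega) (by omega) (by omega),
      consTens_tmul Γ _ _ _ (m := p + r₁ - 1) (by omega) (by omega),
      consTens_tmul Γ _ _ _ rfl (by omega), map_add, LinearMap.add_apply, map_unit_smul₂, smul_add,
      smul_smul, ← Int.negOnePow_add, add_assoc]

/-- When `δ = 0`, the coderivation squares to zero because `μ` is associative up to sign. -/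
theorem freeCocat_isDGCocategory
    (hδ : ∀ (a b : Ob) (i j : ℤ) (h : j + 1 = i) (γ : Γ a b i), δ a b i j h γ = 0)
    (hμ : ∀ (a b c e : Ob) (p q r pq qr n : ℤ) (h₁ : pq + 1 = p + q) (h₂ : n + 1 = pq + r)
      (h₃ : qr + 1 = q + r) (h₄ : n + 1 = p + qr) (x : Γ c e p) (y : Γ b c q) (z : Γ a b r),
      μ a b e pq r n h₂ (μ b c e p q pq h₁ x y) z
        = -(p.negOnePow • μ a c e p qr n h₄ x (μ a b c q r qr h₃ y z)))
    (hd : ∀ (a : Ob) (x : free Γ a a 1),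
      (freeCocat Γ δ μ).counit a (coderiv Γ δ μ (zero_add 1) x) = 0) :
    (freeCocat Γ δ μ).IsDGCocategory where
  d_d a b l m n h h' x := coderiv_coderiv δ μ hδ hμ h h' x
  coassoc a b n x := deconcat_coassoc Γ x
  counit_left a c n x := by
    change (freeCocat Γ δ μ).counitLeft a c n (deconcat Γ a c n x) = x
    induction a, c, n, x using free_induction with
    | zero => simp only [map_zero]
    | add a c n x y hx hy => rw [map_add, map_add, hx, hy]
    | smul_one a r =>
      rw [map_smul, deconcat_one, map_smul]
      refine congrArg _ ((CocatData.counitLeft_tmul (freeCocat Γ δ μ) _ (one Γ a)).trans ?_)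
      rw [freeCocat_counit_one, one_smul]
    | cons a b c p q n h γ w _ =>
      rw [deconcat_cons, map_add, freeCocat_counitLeft_consTens, add_zero]
      refine (CocatData.counitLeft_tmul (freeCocat Γ δ μ) _ (cons Γ h γ w)).trans ?_
      rw [freeCocat_counit_one, one_smul]
  counit_right a c n x := by
    change (freeCocat Γ δ μ).counitRight a c n (deconcat Γ a c n x) = x
    induction a, c, n, x using free_induction with
    | zero => simp only [map_zero]
    | add a c n x y hx hy => rw [map_add, map_add, hx, hy]
    | smul_one a r =>
      rw [map_smul, deconcat_one, map_smul]
      refine congrArg _ ((CocatData.counitRight_tmul (freeCocat Γ δ μ) (one Γ a) _).trans ?_)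
      rw [freeCocat_counit_one, one_smul]
    | cons a b c p q n h γ w hw =>
      rw [deconcat_cons, map_add, freeCocat_counitRight_consTens, hw]
      refine add_eq_right.2 ?_
      by_cases hb : c = a ∧ n = 0
      · obtain ⟨rfl, rfl⟩ := hb
        refine (CocatData.counitRight_tmul (freeCocat Γ δ μ) (one Γ c) _).trans ?_
        rw [freeCocat_counit_cons, zero_smul]
      · exact CocatData.counitRight_tmul_of_ne (freeCocat Γ δ μ) _ hb _ _
  coleibniz a c m n h x := by
    change deconcat Γ a c n (coderiv Γ δ μ h x)
      = (freeCocat Γ δ μ).tensD a c h (deconcat Γ a c m x)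
    induction a, c, m, x using free_induction generalizing n with
    | zero => simp only [map_zero]
    | add a c n x y hx hy => rw [map_add, map_add, map_add, hx, hy, map_add]
    | smul_one a r =>
      rw [map_smul, coderiv_one, smul_zero, map_zero, map_smul, deconcat_one, map_smul]
      refine (smul_eq_zero_of_right r ?_).symm
      refine (CocatData.tensD_tmul (freeCocat Γ δ μ) (p' := n) (q' := n) h _ h h (by omega)
        (by omega) (one Γ a) (one Γ a)).trans ?_
      change tmul (free Γ) (free Γ) _ (coderiv Γ δ μ _ _) _ + _ • tmul (free Γ) (free Γ) _ _
        (coderiv Γ δ μ _ _) = 0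
      rw [coderiv_one, map_zero, map_zero, smul_zero, LinearMap.zero_apply, add_zero]
    | cons a b c p q m h₀ γ w hw =>
      have h1 : (freeCocat Γ δ μ).tensD a c h (tmul (free Γ) (free Γ) (zero_add m) (one Γ c)
          (cons Γ h₀ γ w)) = tmul (free Γ) (free Γ) (zero_add n) (one Γ c)
            (coderiv Γ δ μ h (cons Γ h₀ γ w)) := by
        refine (CocatData.tensD_tmul (freeCocat Γ δ μ) (p := 0) (p' := -1) (q' := n) h _
          (by norm_num) h (by omega) (by omega) (one Γ c) (cons Γ h₀ γ w)).trans ?_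
        change tmul (free Γ) (free Γ) _ (coderiv Γ δ μ _ _) _ + _ • tmul (free Γ) (free Γ) _ _
          (coderiv Γ δ μ _ _) = _
        rw [coderiv_one, map_zero, LinearMap.zero_apply, zero_add, Int.negOnePow_zero, one_smul]
      rw [deconcat_cons, map_add, h1,
        freeCocat_tensD_consTens Γ δ μ hδ (q' := q - 1) _ _ (by omega) (by omega) (by omega),
        ← hw,
        coderiv_cons_of_eq_zero δ μ hδ (q' := q - 1) _ _ (by omega) (by omega) (by omega),
        map_add, map_unit_smul, deconcat_merge, deconcat_cons, map_add, map_unit_smul, smul_add]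
      abel
  counit_d a x := hd a x

end

end FreeCocategory

section FreeCategory

variable {k : Type u} [Field k] {Ob : Type v}

/-! ### The free differential graded category -/

/-- The free category on `Γ` with the derivation that is given by `δ` on the letters. -/
abbrev freeCat (Γ : GrGraph k Ob)
    (δ : ∀ (a b : Ob) (i j : ℤ), j + 1 = i → Γ a b i →ₗ[k] free Γ a b j) : CatData k Ob where
  X := free Γ
  d _ _ _ _ h := deriv Γ δ h
  one := GrGraph.one Γ
  comp h := concat Γ h

theorem freeCat_isDGCategory (Γ : GrGraph k Ob)
    (δ : ∀ (a b : Ob) (i j : ℤ), j + 1 = i → Γ a b i →ₗ[k] free Γ a b j)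
    (hδ : ∀ (a b : Ob) (l m n : ℤ) (h : m + 1 = l) (h' : n + 1 = m)
    (γ : Γ a b l), deriv Γ δ h' (δ a b l m h γ) = 0) : (freeCat Γ δ).IsDGCategory where
  d_d _ _ _ _ _ h h' x := deriv_deriv δ hδ h h' x
  assoc _ _ _ _ _ _ _ _ _ _ hpq hqr h h' x y z := concat_assoc Γ hpq hqr h h' x y z
  one_comp _ _ n x := one_concat Γ (zero_add n) x
  comp_one _ _ _ x := concat_one Γ x
  leibniz _ _ _ _ _ _ _ _ _ h hp hq hn h₁ h₂ x y := deriv_concat δ h hn hp hq h₁ h₂ x y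

theorem lift_one (C : CatData k Ob) {Γ : GrGraph k Ob} (φ : GrGraph.Hom Γ C.X) (a : Ob) :
    C.lift φ a a 0 (GrGraph.one Γ a) = C.one a := by
  unfold CatData.lift GrGraph.one
  rw [freeLift_incl]
  unfold CatData.liftWord
  rw [wordZeroLift_nil]
  rfl

theorem lift_cons (C : CatData k Ob) {Γ : GrGraph k Ob} (φ : GrGraph.Hom Γ C.X) {a b c : Ob}
    {p q n : ℤ} (h : p + q = n) (γ : Γ b c p) (w : free Γ a b q) :
    C.lift φ a c n (cons Γ h γ w) = C.comp h (φ b c p γ) (C.lift φ a b q w) := by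
  induction w using free_induction_incl with
  | zero => simp only [map_zero]
  | add x y hx hy => simp only [map_add, hx, hy]
  | incl m w =>
    rw [cons_incl]
    unfold CatData.lift
    rw [freeLift_incl, freeLift_incl]
    conv_lhs => unfold CatData.liftWord
    rw [wordSuccLift_cons]
    rfl

theorem lift_letter (C : CatData k Ob) (hC : C.IsDGCategory) {Γ : GrGraph k Ob}
    (φ : GrGraph.Hom Γ C.X) {a b : Ob} {n : ℤ} (γ : Γ a b n) :
    C.lift φ a b n (letter Γ γ) = φ a b n γ := by
  unfold letter
  rw [LinearMap.flip_apply, lift_cons, lift_one, hC.comp_one]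

theorem lift_concat (C : CatData k Ob) (hC : C.IsDGCategory) {Γ : GrGraph k Ob}
    (φ : GrGraph.Hom Γ C.X) {a b c : Ob} {p q n : ℤ} (h : p + q = n) (x : free Γ b c p)
    (y : free Γ a b q) :
    C.lift φ a c n (concat Γ h x y) = C.comp h (C.lift φ b c p x) (C.lift φ a b q y) := by
  induction b, c, p, x using free_induction generalizing n with
  | zero => simp only [map_zero, LinearMap.zero_apply]
  | add a c n x x' hx hx' => simp only [map_add, LinearMap.add_apply, hx, hx']
  | smul_one a s =>
    obtain rfl : q = n := by omega
    simp only [map_smul, LinearMap.smul_apply, one_concat, lift_one, cast_refl]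
    rw [hC.one_comp]
  | cons a b c p₁ q₁ n₁ h₀ γ w hw =>
    rw [cons_concat Γ h₀ h rfl (by omega), lift_cons, hw, lift_cons]
    exact (hC.assoc _ _ _ _ _ _ _ _ _ _ _ _ _ _ _ _ _).symm

/-- The words in a graph whose arrows strictly decrease `deg`: the only ones that do not decrease
`deg` are the multiples of the empty words. -/
theorem free_eq_zero_or_smul_one {Γ : GrGraph k Ob} {deg : Ob → ℕ}
    (hΓ : ∀ a b n, ¬ deg b < deg a → Subsingleton (Γ a b n)) {a c : Ob} {n : ℤ}
    (x : free Γ a c n) (hac : ¬ deg c < deg a) :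
    x = 0 ∨ ∃ (h : a = c) (hn : 0 = n) (r : k),
      x = (free Γ).cast rfl h hn (r • GrGraph.one Γ a) := by
  induction a, c, n, x using free_induction with
  | zero a c n => exact Or.inl rfl
  | add a c n x y hx hy =>
    rcases hx hac with rfl | ⟨rfl, rfl, r, rfl⟩
    · rw [zero_add]
      exact hy hac
    · rcases hy hac with rfl | ⟨_, _, r', rfl⟩
      · rw [add_zero]
        exact Or.inr ⟨rfl, rfl, r, rfl⟩
      · exact Or.inr ⟨rfl, rfl, r + r', by rw [add_smul]; rfl⟩
  | smul_one a r => exact Or.inr ⟨rfl, rfl, r, rfl⟩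
  | cons a b c p q n h γ w hw =>
    left
    by_cases hbc : deg c < deg b
    · rcases hw (by omega) with rfl | ⟨rfl, _⟩
      · rw [map_zero]
      · exact absurd hbc hac
    · have := hΓ b c p hbc
      rw [Subsingleton.elim γ 0, map_zero, LinearMap.zero_apply]

theorem free_self_eq {Γ : GrGraph k Ob} {deg : Ob → ℕ}
    (hΓ : ∀ a b n, ¬ deg b < deg a → Subsingleton (Γ a b n)) {a : Ob} (x : free Γ a a 0) :
    ∃ r : k, x = r • GrGraph.one Γ a := by
  rcases free_eq_zero_or_smul_one hΓ x (lt_irrefl _) with rfl | ⟨_, _, r, rfl⟩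
  · exact ⟨0, (zero_smul _ _).symm⟩
  · exact ⟨r, rfl⟩

theorem free_subsingleton {Γ : GrGraph k Ob} {deg : Ob → ℕ}
    (hΓ : ∀ a b n, ¬ deg b < deg a → Subsingleton (Γ a b n)) {a c : Ob} {n : ℤ}
    (hac : ¬ deg c < deg a) (h : ¬ (a = c ∧ n = 0)) : Subsingleton (free Γ a c n) := by
  have key : ∀ x : free Γ a c n, x = 0 := by
    intro x
    rcases free_eq_zero_or_smul_one hΓ x hac with rfl | ⟨h1, h2, _⟩
    · rfl
    · exact absurd ⟨h1, h2.symm⟩ h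
  exact ⟨fun x y => (key x).trans (key y).symm⟩

theorem freeCat_isConnected {Γ : GrGraph k Ob} {deg : Ob → ℕ}
    (hΓ : ∀ a b n, ¬ deg b < deg a → Subsingleton (Γ a b n))
    (δ : ∀ (a b : Ob) (i j : ℤ), j + 1 = i → Γ a b i →ₗ[k] free Γ a b j) :
    (freeCat Γ δ).IsConnected deg where
  subsingleton_self a n hn := free_subsingleton hΓ (lt_irrefl _) fun h => hn h.2
  bijective_one a := by
    refine ⟨fun r s h => ?_, fun x => ?_⟩
    · have h1 := congrArg ((freeCocat Γ (fun _ _ _ _ _ => 0) fun _ _ _ _ _ _ _ => 0).counit a) h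
      simp only [map_smul] at h1
      rw [freeCocat_counit_one] at h1
      simpa using h1
    · obtain ⟨r, rfl⟩ := free_self_eq hΓ x
      exact ⟨r, rfl⟩
  subsingleton a b n h := free_subsingleton hΓ (by omega) (by rintro ⟨rfl, _⟩; omega)

theorem freeCocat_isConnected {Γ : GrGraph k Ob} {deg : Ob → ℕ}
    (hΓ : ∀ a b n, ¬ deg b < deg a → Subsingleton (Γ a b n))
    (δ : ∀ (a b : Ob) (i j : ℤ), j + 1 = i → Γ a b i →ₗ[k] Γ a b j)
    (μ : ∀ (a b c : Ob) (p q n : ℤ), n + 1 = p + q → Γ b c p →ₗ[k] Γ a b q →ₗ[k] Γ a c n) :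
    (freeCocat Γ δ μ).IsConnected deg where
  subsingleton_self a n hn := free_subsingleton hΓ (lt_irrefl _) fun h => hn h.2
  bijective_counit a := by
    refine ⟨fun x y h => ?_, fun r => ⟨r • GrGraph.one Γ a, ?_⟩⟩
    · obtain ⟨r, rfl⟩ := free_self_eq hΓ x
      obtain ⟨s, rfl⟩ := free_self_eq hΓ y
      simp only [map_smul] at h
      rw [freeCocat_counit_one] at h
      rw [show r = s by simpa using h]
    · rw [map_smul, freeCocat_counit_one, smul_eq_mul, mul_one]
  subsingleton a b n h := free_subsingleton hΓ (by omega) (by rintro ⟨rfl, _⟩; omega)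

/-! ### Shifts -/

namespace GrGraph

instance shift_subsingleton (r : ℤ) (Γ : GrGraph k Ob) (a : Ob) (n : ℤ) :
    Subsingleton (shift r Γ a a n) :=
  ⟨fun _ _ => funext fun h => absurd rfl h.down⟩

theorem shift_subsingleton_of (r : ℤ) (Γ : GrGraph k Ob) {a b : Ob} {n : ℤ}
    (h : a ≠ b → Subsingleton (Γ a b (n - r))) : Subsingleton (shift r Γ a b n) :=
  ⟨fun _ _ => funext fun hab => (h hab.down).elim _ _⟩

theorem ofShift_toShift (r : ℤ) (Γ : GrGraph k Ob) {a b : Ob} {m n : ℤ} (hab : a ≠ b)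
    (h h' : m + r = n) (x : Γ a b m) : ofShift r Γ h (toShift r Γ h' x) = x := by
  subst h
  unfold ofShift
  rw [dif_pos hab]
  have key : ∀ (l : ℤ) (h₁ : m = l) (h₂ : l = m), Γ.cast rfl rfl h₂ (Γ.cast rfl rfl h₁ x) = x := by
    rintro l rfl _
    rfl
  exact key _ _ _

theorem toShift_ofShift (r : ℤ) (Γ : GrGraph k Ob) {a b : Ob} {m n : ℤ}
    (h h' : m + r = n) (y : shift r Γ a b n) : toShift r Γ h (ofShift r Γ h' y) = y := by
  by_cases hab : a = b
  · subst hab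
    exact Subsingleton.elim _ _
  · subst h
    unfold ofShift
    rw [dif_pos hab]
    funext hab'
    have key : ∀ (l : ℤ) (h₁ : m = l) (h₂ : l = m) (x : Γ a b l),
        Γ.cast rfl rfl h₁ (Γ.cast rfl rfl h₂ x) = x := by
      rintro l rfl _ _
      rfl
    exact key _ _ _ _

theorem ofShift_self (r : ℤ) (Γ : GrGraph k Ob) {a : Ob} {m n : ℤ} (h : m + r = n)
    (y : shift r Γ a a n) : ofShift r Γ h y = 0 := by
  rw [Subsingleton.elim y 0, map_zero]

end GrGraph

/-! ### Bar constructions of categories with zero differential -/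

/-- The component of the coderivation of the bar construction that comes from the composition. -/
def barμ (C : CatData k Ob) (a b c : Ob) (p q n : ℤ) (h : n + 1 = p + q) :
    shift 1 C.X b c p →ₗ[k] shift 1 C.X a b q →ₗ[k] shift 1 C.X a c n :=
  p.negOnePow •
    ((C.comp (p := p - 1) (q := q - 1) (n := n - 1) (by omega)).compl₁₂
      (ofShift 1 C.X (by omega)) (ofShift 1 C.X (by omega))).compr₂
      (toShift 1 C.X (by omega))

theorem barμ_apply (C : CatData k Ob) {a b c : Ob} {p q n p' q' n' : ℤ} (h : n + 1 = p + q)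
    (hp : p' + 1 = p) (hq : q' + 1 = q) (hn : n' + 1 = n) (h' : p' + q' = n')
    (x : shift 1 C.X b c p) (y : shift 1 C.X a b q) :
    barμ C a b c p q n h x y
      = p.negOnePow • toShift 1 C.X hn (C.comp h' (ofShift 1 C.X hp x) (ofShift 1 C.X hq y)) := by
  obtain rfl : p' = p - 1 := by omega
  obtain rfl : q' = q - 1 := by omega
  obtain rfl : n' = n - 1 := by omega
  rfl

/-- The composition is associative up to sign after the shift. The objects occurring in nonzero
composites of nonidentity arrows form no cycle (`hcyc`); hence dropping the arrows from an object to
itself from the graph of letters loses no intermediate composite. -/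
theorem barμ_barμ (C : CatData k Ob) (hC : C.IsDGCategory)
    (hcyc : ∀ (a b : Ob) (p q : ℤ), a ≠ b → Subsingleton (C.X a b p) ∨ Subsingleton (C.X b a q))
    (a b c e : Ob) (p q r pq qr n : ℤ) (h₁ : pq + 1 = p + q) (h₂ : n + 1 = pq + r)
    (h₃ : qr + 1 = q + r) (h₄ : n + 1 = p + qr) (x : shift 1 C.X c e p) (y : shift 1 C.X b c q)
    (z : shift 1 C.X a b r) :
    barμ C a b e pq r n h₂ (barμ C b c e p q pq h₁ x y) z
      = -(p.negOnePow • barμ C a c e p qr n h₄ x (barμ C a b c q r qr h₃ y z)) := by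
  have key : ∀ (a b c : Ob) (p q n p' q' n' : ℤ) (hp : p' + 1 = p) (hq : q' + 1 = q)
      (hn hn' : n' + 1 = n) (h' : p' + q' = n') (x : shift 1 C.X b c p) (y : shift 1 C.X a b q),
      ofShift 1 C.X hn (toShift 1 C.X hn' (C.comp h' (ofShift 1 C.X hp x) (ofShift 1 C.X hq y)))
        = C.comp h' (ofShift 1 C.X hp x) (ofShift 1 C.X hq y) := by
    intro a b c p q n p' q' n' hp hq hn hn' h' x y
    by_cases hac : a = c
    · subst hac
      have h0 : C.comp h' (ofShift 1 C.X hp x) (ofShift 1 C.X hq y) = 0 := by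
        by_cases hab : a = b
        · subst hab
          rw [ofShift_self, map_zero, LinearMap.zero_apply]
        · rcases hcyc a b q' p' hab with h | h
          · rw [Subsingleton.elim (ofShift 1 C.X hq y) 0, map_zero]
          · rw [Subsingleton.elim (ofShift 1 C.X hp x) 0, map_zero, LinearMap.zero_apply]
      rw [h0, map_zero, map_zero]
    · exact ofShift_toShift 1 C.X hac _ _ _
  rw [barμ_apply C (p' := pq - 1) (q' := r - 1) (n' := n - 1) _ (by omega) (by omega) (by omega)
      (by omega),
    barμ_apply C (p' := p - 1) (q' := q - 1) (n' := pq - 1) _ (by omega) (by omega) (by omega)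
      (by omega),
    barμ_apply C (p' := p - 1) (q' := qr - 1) (n' := n - 1) _ (by omega) (by omega) (by omega)
      (by omega),
    barμ_apply C (p' := q - 1) (q' := r - 1) (n' := qr - 1) _ (by omega) (by omega) (by omega)
      (by omega),
    map_unit_smul (ofShift 1 C.X _), map_unit_smul₂, map_unit_smul (toShift 1 C.X _),
    map_unit_smul (ofShift 1 C.X _), map_unit_smul (C.comp _ _), map_unit_smul (toShift 1 C.X _),
    key, key,
    hC.assoc _ _ _ _ _ _ _ _ (qr - 1) _ _ (by omega) _ (by omega), smul_smul, smul_smul,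
    smul_smul, ← Units.neg_smul]
  congr 1
  obtain rfl : pq = p + q - 1 := by omega
  rw [Int.negOnePow_sub, Int.negOnePow_add, Int.negOnePow_one]
  rcases Int.units_eq_one_or p.negOnePow with h | h <;>
    rcases Int.units_eq_one_or q.negOnePow with h' | h' <;> rw [h, h'] <;> rfl

theorem bar_eq_freeCocat (C : CatData k Ob) :
    bar C = freeCocat (shift 1 C.X)
      (fun a b i j h => -((toShift 1 C.X (m := j - 1) (by omega)).comp
        ((C.d a b (by omega)).comp (ofShift 1 C.X (m := i - 1) (by omega))))) (barμ C) := rfl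

/-- As nonzero arrows between distinct objects decrease `deg`, no composite of letters is an arrow
from an object to itself. -/
theorem bar_isDGCocategory (C : CatData k Ob) (hC : C.IsDGCategory) {deg : Ob → ℕ}
    (hd : ∀ (a b : Ob) (m n : ℤ) (h : n + 1 = m) (x : C.X a b m), C.d a b h x = 0)
    (hdeg : ∀ (a b : Ob) (n : ℤ), a ≠ b → ¬ deg b < deg a → Subsingleton (C.X a b n)) :
    (bar C).IsDGCocategory := by
  rw [bar_eq_freeCocat]
  refine freeCocat_isDGCocategory _ _ _ ?_ (barμ_barμ C hC ?_) ?_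
  · intro a b i j h γ
    rw [LinearMap.neg_apply, LinearMap.comp_apply, LinearMap.comp_apply, hd, map_zero, neg_zero]
  · intro a b p q hab
    by_cases h : deg b < deg a
    · exact Or.inr (hdeg b a q hab.symm (by omega))
    · exact Or.inl (hdeg a b p hab h)
  · intro a x
    have := free_subsingleton (Γ := shift 1 C.X) (deg := deg)
      (fun a b n h => shift_subsingleton_of 1 C.X fun hab => hdeg a b _ hab h) (a := a) (c := a)
      (n := 1) (lt_irrefl _) (by simp)
    rw [Subsingleton.elim x 0, map_zero, map_zero]

theorem bar_isConnected (C : CatData k Ob) {deg : Ob → ℕ}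
    (hdeg : ∀ (a b : Ob) (n : ℤ), a ≠ b → ¬ deg b < deg a → Subsingleton (C.X a b n)) :
    (bar C).IsConnected deg := by
  rw [bar_eq_freeCocat]
  exact freeCocat_isConnected
    (fun a b n h => shift_subsingleton_of 1 C.X fun hab => hdeg a b _ hab h) _ _

end FreeCategory

section Signs

/-! ### Signs -/

variable {I : Type v}

/-- The sign of a pair of edges: `1` if they are in increasing order for some fixed linear order on
the set of all possible edges, and `-1` otherwise. -/
def pairSign (a b : Set I) : ℤˣ := if WellOrderingRel a b then 1 else -1

theorem pairSign_swap {a b : Set I} (h : a ≠ b) : pairSign a b = -pairSign b a := by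
  unfold pairSign
  rcases trichotomous_of (WellOrderingRel (α := Set I)) a b with h' | h' | h'
  · rw [if_pos h', if_neg (asymm_of _ h'), neg_neg]
  · exact absurd h' h
  · rw [if_pos h', if_neg (asymm_of _ h')]

/-- The sign of the rearrangement that sorts a sequence. -/
def sgn {m : ℕ} (e : Fin m → Set I) : ℤˣ := ∏ i, ∏ j ∈ Finset.Ioi i, pairSign (e i) (e j)

/-- The sign of the rearrangement that sorts the elements of `B`, followed by those of `C`. -/
def eps (B C : Finset (Set I)) : ℤˣ := ∏ b ∈ B, ∏ c ∈ C, pairSign b c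

theorem sgn_comp_perm {m : ℕ} {e : Fin m → Set I} (he : Function.Injective e)
    (σ : Equiv.Perm (Fin m)) : sgn (fun i => e (σ i)) = Equiv.Perm.sign σ * sgn e := by
  let f : Fin m → Fin m → ℤ := fun i j => if i = j then 0 else pairSign (e i) (e j)
  have h := Equiv.Perm.prod_Ioi_comp_eq_sign_mul_prod (R := ℤ) σ
    (f := f) (by
      intro i j
      by_cases hij : i = j
      · simp [f, hij]
      · simp only [f]
        rw [if_neg hij, if_neg (Ne.symm hij), pairSign_swap fun h => hij (he h), Units.val_neg])
  have key : ∀ τ : Equiv.Perm (Fin m), (∏ i, ∏ j ∈ Finset.Ioi i, f (τ i) (τ j))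
        = (sgn (fun i => e (τ i)) : ℤˣ) := by
    intro τ
    unfold sgn
    rw [Units.coe_prod]
    refine Finset.prod_congr rfl fun i _ => ?_
    rw [Units.coe_prod]
    refine Finset.prod_congr rfl fun j hj => ?_
    exact if_neg fun h => (Finset.mem_Ioi.1 hj).ne (τ.injective h)
  have h1 : (∏ i, ∏ j ∈ Finset.Ioi i, f i j) = (sgn e : ℤˣ) := key 1
  rw [key, h1] at h
  ext
  simpa using h

theorem sgn_mul_self {m : ℕ} (e : Fin m → Set I) : sgn e * sgn e = 1 := Int.units_mul_self _

theorem eps_mul_self (B C : Finset (Set I)) : eps B C * eps B C = 1 := Int.units_mul_self _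

@[simp] theorem eps_empty_left (C : Finset (Set I)) : eps ∅ C = 1 := Finset.prod_empty

@[simp] theorem eps_empty_right (B : Finset (Set I)) : eps B ∅ = 1 :=
  Finset.prod_eq_one fun _ _ => Finset.prod_empty

theorem eps_union_left {B B' : Finset (Set I)} (h : Disjoint B B') (C : Finset (Set I)) :
    eps (B ∪ B') C = eps B C * eps B' C := Finset.prod_union h

theorem eps_union_right (B : Finset (Set I)) {C C' : Finset (Set I)} (h : Disjoint C C') :
    eps B (C ∪ C') = eps B C * eps B C' := by
  unfold eps
  rw [← Finset.prod_mul_distrib]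
  exact Finset.prod_congr rfl fun b _ => Finset.prod_union h

theorem eps_insert_left {b : Set I} {B : Finset (Set I)} (h : b ∉ B) (C : Finset (Set I)) :
    eps (insert b B) C = eps {b} C * eps B C := by
  rw [Finset.insert_eq, eps_union_left (Finset.disjoint_singleton_left.2 h)]

theorem eps_insert_right (B : Finset (Set I)) {c : Set I} {C : Finset (Set I)} (h : c ∉ C) :
    eps B (insert c C) = eps B {c} * eps B C := by
  rw [Finset.insert_eq, eps_union_right B (Finset.disjoint_singleton_left.2 h)]

/-- Moving one element across a set changes the sign by the parity of the set. -/
theorem eps_singleton_right {b : Set I} {B : Finset (Set I)} (h : b ∉ B) :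
    eps B {b} = (B.card : ℤ).negOnePow * eps {b} B := by
  unfold eps
  rw [Finset.prod_singleton]
  simp only [Finset.prod_singleton]
  induction B using Finset.induction_on with
  | empty => simp
  | insert a B ha ih =>
    rw [Finset.mem_insert, not_or] at h
    rw [Finset.prod_insert ha, Finset.prod_insert ha, ih h.2, Finset.card_insert_of_notMem ha,
      pairSign_swap (Ne.symm h.1), Nat.cast_succ, Int.negOnePow_add, Int.negOnePow_one]
    simp only [mul_neg, neg_mul, mul_one]
    rw [mul_left_comm]

/-- The sign of a sequence is multiplicative with respect to cutting the sequence. -/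
theorem sgn_append {p q : ℕ} (u : Fin p → Set I) (w : Fin q → Set I)
    (hu : Function.Injective u) (hw : Function.Injective w) :
    sgn (Fin.append u w)
      = sgn u * sgn w * eps (Finset.univ.image u) (Finset.univ.image w) := by
  have h1 : ∀ i : Fin p, ∏ j ∈ Finset.Ioi (Fin.castAdd q i),
      pairSign (Fin.append u w (Fin.castAdd q i)) (Fin.append u w j)
        = (∏ j ∈ Finset.Ioi i, pairSign (u i) (u j)) * ∏ j, pairSign (u i) (w j) := by
    intro i
    have : Finset.Ioi (Fin.castAdd q i)
        = ((Finset.Ioi i).map (Fin.castAddEmb q)).disjUnion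
          ((Finset.univ : Finset (Fin q)).map (Fin.natAddEmb p)) (by
            rw [Finset.disjoint_left]
            intro x hx hx'
            simp only [Finset.mem_map, Fin.castAddEmb_apply, Fin.natAddEmb_apply] at hx hx'
            obtain ⟨a, _, rfl⟩ := hx
            obtain ⟨b, _, hb⟩ := hx'
            have := congrArg Fin.val hb
            simp at this
            omega) := by
      ext x
      refine Fin.addCases (fun a => ?_) (fun a => ?_) x
      · simp only [Finset.mem_Ioi, Finset.mem_disjUnion, Finset.mem_map, Fin.castAddEmb_apply,
          Fin.natAddEmb_apply, Finset.mem_univ, true_and]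
        constructor
        · intro h
          exact Or.inl ⟨a, h, rfl⟩
        · rintro (⟨b, hb, hb'⟩ | ⟨b, hb⟩)
          · obtain rfl : b = a := by simpa using hb'
            exact hb
          · have := congrArg Fin.val hb
            simp at this
            omega
      · simp only [Finset.mem_Ioi, Finset.mem_disjUnion, Finset.mem_map, Fin.castAddEmb_apply,
          Fin.natAddEmb_apply, Finset.mem_univ, true_and]
        constructor
        · intro _
          exact Or.inr ⟨a, rfl⟩
        · intro _
          rw [Fin.lt_def]
          simp
          omega
    rw [this, Finset.prod_disjUnion, Finset.prod_map, Finset.prod_map]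
    simp
  have h2 : ∀ i : Fin q, ∏ j ∈ Finset.Ioi (Fin.natAdd p i),
      pairSign (Fin.append u w (Fin.natAdd p i)) (Fin.append u w j)
        = ∏ j ∈ Finset.Ioi i, pairSign (w i) (w j) := by
    intro i
    have : Finset.Ioi (Fin.natAdd p i) = (Finset.Ioi i).map (Fin.natAddEmb p) := by
      ext x
      refine Fin.addCases (fun a => ?_) (fun a => ?_) x
      · simp only [Finset.mem_Ioi, Finset.mem_map, Fin.natAddEmb_apply]
        constructor
        · intro h
          rw [Fin.lt_def] at h
          simp at h
          omega
        · rintro ⟨b, _, hb⟩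
          have := congrArg Fin.val hb
          simp at this
          omega
      · simp
    rw [this, Finset.prod_map]
    simp
  have h3 : eps (Finset.univ.image u) (Finset.univ.image w)
      = ∏ i, ∏ j, pairSign (u i) (w j) := by
    unfold eps
    rw [Finset.prod_image fun _ _ _ _ h => hu h]
    exact Finset.prod_congr rfl fun i _ => Finset.prod_image fun _ _ _ _ h => hw h
  rw [h3]
  conv_lhs => unfold sgn
  rw [Fin.prod_univ_add]
  simp only [h1, h2, Finset.prod_mul_distrib]
  unfold sgn
  exact mul_right_comm _ _ _

end Signs

section ShuffleSets

/-- The last positions of a shuffle determine it, and every set of positions is the set of the last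
positions of a shuffle: summing over shuffles is summing over sets. -/
theorem sum_shuffles {M : Type*} [AddCommMonoid M] (m : ℕ) (F : Finset (Fin m) → M) :
    ∑ p : Fin (m + 1), ∑ σ : Equiv.Perm (Fin m) with IsShuffle (p : ℕ) σ,
      F (Finset.univ.image fun i : Fin (m - p) => σ ⟨p + i, by omega⟩)
    = ∑ S : Finset (Fin m), F S := by
  have hcard : ∀ (p : Fin (m + 1)) (σ : Equiv.Perm (Fin m)),
      (Finset.univ.image fun i : Fin (m - p) => σ ⟨p + i, by omega⟩).card = m - p := by
    intro p σ
    rw [Finset.card_image_of_injective, Finset.card_univ, Fintype.card_fin]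
    intro i j hij
    have := congrArg Fin.val (σ.injective hij)
    simp only at this
    ext
    omega
  have hcompl : ∀ (p : Fin (m + 1)) (σ : Equiv.Perm (Fin m)),
      (Finset.univ.image fun i : Fin (m - p) => σ ⟨p + i, by omega⟩)ᶜ
        = Finset.univ.image fun i : Fin p => σ ⟨i, by omega⟩ := by
    intro p σ
    ext x
    obtain ⟨y, rfl⟩ := σ.surjective x
    simp only [Finset.mem_compl, Finset.mem_image, Finset.mem_univ, true_and,
      EmbeddingLike.apply_eq_iff_eq]
    constructor
    · intro h
      by_contra h'
      rw [not_exists] at h h'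
      have hy : (p : ℕ) ≤ y := by
        by_contra hlt
        exact h' ⟨y, by omega⟩ rfl
      exact h ⟨y - p, by omega⟩ (Fin.ext (by simp; omega))
    · rintro ⟨i, rfl⟩ ⟨j, hj⟩
      have := congrArg Fin.val hj
      simp only at this
      omega
  rw [Finset.sum_sigma']
  refine Finset.sum_bij
    (fun x _ => Finset.univ.image fun i : Fin (m - x.1) => x.2 ⟨x.1 + i, by omega⟩)
    (fun _ _ => Finset.mem_univ _) ?_ ?_ (fun _ _ => rfl)
  · rintro ⟨p, σ⟩ hσ ⟨p', σ'⟩ hσ' h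
    simp only [Finset.mem_sigma, Finset.mem_univ, Finset.mem_filter, true_and] at hσ hσ' h
    obtain rfl : p = p' := by
      have := hcard p σ
      rw [h, hcard p' σ'] at this
      ext
      omega
    congr 1
    have h2 : (fun i : Fin (m - p) => σ ⟨p + i, by omega⟩)
        = fun i : Fin (m - p) => σ' ⟨p + i, by omega⟩ := by
      rw [Finset.orderEmbOfFin_unique (hcard p σ) (f := fun i : Fin (m - p) => σ ⟨p + i, by omega⟩)
        (fun x => Finset.mem_image_of_mem _ (Finset.mem_univ _))
        (fun i j hij => hσ _ _ (by simpa using hij) (Or.inr (by simp))),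
        Finset.orderEmbOfFin_unique (hcard p σ) (f := fun i : Fin (m - p) => σ' ⟨p + i, by omega⟩)
        (fun x => by
          rw [h]
          exact Finset.mem_image_of_mem (fun i : Fin (m - p) => σ' ⟨p + i, by omega⟩)
            (Finset.mem_univ x))
        (fun i j hij => hσ' _ _ (by simpa using hij) (Or.inr (by simp)))]
    have hc : (Finset.univ.image fun i : Fin p => σ ⟨i, by omega⟩)
        = Finset.univ.image fun i : Fin p => σ' ⟨i, by omega⟩ := by
      rw [← hcompl, ← hcompl, h]
    have hc' : (Finset.univ.image fun i : Fin p => σ ⟨i, by omega⟩).card = p := by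
      rw [← hcompl, Finset.card_compl, hcard, Fintype.card_fin]
      omega
    have h1 : (fun i : Fin p => σ ⟨i, by omega⟩) = fun i : Fin p => σ' ⟨i, by omega⟩ := by
      rw [Finset.orderEmbOfFin_unique hc' (f := fun i : Fin p => σ ⟨i, by omega⟩)
        (fun x => Finset.mem_image_of_mem _ (Finset.mem_univ _))
        (fun i j hij => hσ _ _ (by simpa using hij) (Or.inl (by simp))),
        Finset.orderEmbOfFin_unique hc' (f := fun i : Fin p => σ' ⟨i, by omega⟩)
        (fun x => by
          rw [hc]
          exact Finset.mem_image_of_mem (fun i : Fin p => σ' ⟨i, by omega⟩) (Finset.mem_univ x))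
        (fun i j hij => hσ' _ _ (by simpa using hij) (Or.inl (by simp)))]
    ext1 i
    by_cases hi : (i : ℕ) < p
    · exact congrFun h1 ⟨i, hi⟩
    · have := congrFun h2 ⟨i - p, by omega⟩
      have hi' : (⟨p + (i - p), by omega⟩ : Fin m) = i := Fin.ext (by simp; omega)
      simpa only [hi'] using this
  · intro S _
    have hS : S.card ≤ m := by simpa using S.card_le_univ
    have hSc : Sᶜ.card = m - S.card := by rw [Finset.card_compl, Fintype.card_fin]
    have hScc : Sᶜᶜ.card = S.card := by rw [compl_compl]
    let τ : Fin (m - S.card + S.card) ≃ Fin m :=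
      finSumFinEquiv.symm.trans (finSumEquivOfFinset hSc hScc)
    let σ : Equiv.Perm (Fin m) := (finCongr (by omega)).trans τ
    have hl : ∀ (i : Fin m) (hi : (i : ℕ) < m - S.card),
        σ i = Sᶜ.orderEmbOfFin hSc ⟨i, hi⟩ := by
      intro i hi
      have : finCongr (by omega : m = m - S.card + S.card) i
          = Fin.castAdd S.card ⟨i, hi⟩ := rfl
      change finSumEquivOfFinset hSc hScc (finSumFinEquiv.symm (finCongr _ i)) = _
      rw [this, finSumFinEquiv_symm_apply_castAdd, finSumEquivOfFinset_inl]
    have hr : ∀ (i : Fin m) (hi : m - S.card ≤ (i : ℕ)),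
        σ i = Sᶜᶜ.orderEmbOfFin hScc ⟨i - (m - S.card), by omega⟩ := by
      intro i hi
      have : finCongr (by omega : m = m - S.card + S.card) i
          = Fin.natAdd (m - S.card) ⟨i - (m - S.card), by omega⟩ := Fin.ext (by simp; omega)
      change finSumEquivOfFinset hSc hScc (finSumFinEquiv.symm (finCongr _ i)) = _
      rw [this, finSumFinEquiv_symm_apply_natAdd, finSumEquivOfFinset_inr]
    refine ⟨⟨⟨m - S.card, by omega⟩, σ⟩, ?_, ?_⟩
    · simp only [Finset.mem_sigma, Finset.mem_univ, Finset.mem_filter, true_and]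
      rintro i j hij (hj | hi)
      · have hij' : (i : ℕ) < j := hij
        rw [hl i (by omega), hl j hj]
        exact (Sᶜ.orderEmbOfFin hSc).strictMono hij
      · have hij' : (i : ℕ) < j := hij
        rw [hr i hi, hr j (by omega)]
        refine (Sᶜᶜ.orderEmbOfFin hScc).strictMono ?_
        rw [Fin.lt_def]
        simp only
        omega
    · refine Finset.eq_of_subset_of_card_le ?_ ?_
      · intro x hx
        obtain ⟨i, _, rfl⟩ := Finset.mem_image.1 hx
        rw [hr _ (by simp)]
        have hmem : ∀ y, y ∈ Sᶜᶜ → y ∈ S := fun y hy => by rwa [compl_compl] at hy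
        exact hmem _ (Finset.orderEmbOfFin_mem Sᶜᶜ hScc _)
      · rw [hcard ⟨m - S.card, by omega⟩ σ]
        simp only
        omega

end ShuffleSets

/-! ### Trees and contractions -/

namespace ITree

variable {I : Type v}

instance (t s : ITree I) : Subsingleton (t ⟶ s) := ⟨fun ⟨⟨_⟩⟩ ⟨⟨_⟩⟩ => rfl⟩

theorem hom_edges_subset {t s : ITree I} (f : t ⟶ s) : s.edges ⊆ t.edges := by
  obtain ⟨E, _, rfl⟩ := f.down.down
  rw [edges_contract]
  exact Finset.sdiff_subset

theorem hom_contract (t : ITree I) (E : Finset (Set I)) : Nonempty (t ⟶ t.contract E) := by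
  refine ⟨⟨⟨E ∩ t.edges, Finset.inter_subset_right, ?_⟩⟩⟩
  apply edges_injective
  rw [edges_contract, edges_contract]
  ext x
  simp only [Finset.mem_sdiff, Finset.mem_inter, not_and]
  tauto

theorem contract_hom {t s : ITree I} (f : t ⟶ s) {C : Finset (Set I)} (hC : C ⊆ contracted t s) :
    Nonempty (t.contract C ⟶ s) := by
  have h : s = (t.contract C).contract (contracted t s) := by
    rw [contract_contract, Finset.union_eq_right.2 hC, contract_contracted f]
  rw [h]
  exact hom_contract _ _

theorem contracted_contract_left (t s : ITree I) (C : Finset (Set I)) :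
    contracted (t.contract C) s = contracted t s \ C := by
  unfold contracted
  rw [edges_contract]
  ext x
  simp only [Finset.mem_sdiff]
  tauto

theorem contracted_contract_right (t s : ITree I) {C : Finset (Set I)}
    (hC : C ⊆ contracted t s) : contracted t (t.contract C) = C :=
  contracted_contract t (hC.trans Finset.sdiff_subset)

@[simp] theorem contracted_self (t : ITree I) : contracted t t = ∅ := Finset.sdiff_self _

theorem eq_of_contracted_eq_empty {t s : ITree I} (f : t ⟶ s) (h : contracted t s = ∅) :
    t = s := by
  rw [← contract_contracted f, h, contract_empty]

theorem degree_lt_of_hom {t s : ITree I} (f : t ⟶ s) (h : t ≠ s) : s.degree < t.degree := by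
  refine Finset.card_lt_card ((hom_edges_subset f).ssubset_of_ne fun h' => h ?_)
  exact edges_injective h'.symm

theorem contract_eq_self {t : ITree I} {e : Set I} (h : e ∉ t.edges) : t.contract {e} = t := by
  apply edges_injective
  rw [edges_contract, Finset.sdiff_singleton_eq_erase, Finset.erase_eq_of_notMem h]

theorem contract_contract_comm (t : ITree I) (E F : Finset (Set I)) :
    (t.contract E).contract F = (t.contract F).contract E := by
  rw [contract_contract, contract_contract, Finset.union_comm]

end ITree

section Generators

variable (k : Type u) [Field k] {I : Type v}

open ITree

/-! ### The generators of the graph `K` -/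

/-- The edges contracted by a morphism, numbered from `0`. -/
def numbering (t s : ITree I) (i : Fin (t.contracted s).card) : Set I :=
  (t.contracted s).equivFin.symm i

theorem numbering_injective (t s : ITree I) : Function.Injective (numbering t s) :=
  Subtype.val_injective.comp (Equiv.injective _)

theorem image_numbering (t s : ITree I) :
    Finset.univ.image (numbering t s) = t.contracted s := by
  ext x
  simp only [Finset.mem_image, Finset.mem_univ, true_and]
  constructor
  · rintro ⟨i, rfl⟩
    exact ((t.contracted s).equivFin.symm i).2
  · intro hx
    exact ⟨(t.contracted s).equivFin ⟨x, hx⟩, by simp [numbering]⟩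

/-- The exterior product of the elements of `E` in increasing order, as an element of `K(t, s)`,
where `s = t / E`. -/
def gen (t s : ITree I) (n : ℤ) : koszulGraph k t s n := fun _ =>
  sgn (numbering t s) • exteriorPower.ιMulti k _ fun i =>
    basisElem k (t.contracted s) (numbering t s i)

theorem basisElem_numbering (t s : ITree I) (i : Fin (t.contracted s).card) :
    basisElem k (t.contracted s) (numbering t s i)
      = ((Finsupp.basisSingleOne (R := k)).reindex (t.contracted s).equivFin.symm.symm) i := by
  refine (dif_pos ((t.contracted s).equivFin.symm i).2).trans ?_
  simp
  rfl

theorem topForm_gen (t s : ITree I) {n : ℤ}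
    (f : {_f : t ⟶ s // ((t.contracted s).card : ℤ) = n}) :
    topForm k (t.contracted s) (t.contracted s).equivFin.symm (gen k t s n f)
      = ((sgn (numbering t s) : ℤˣ) : ℤ) := by
  unfold topForm gen
  rw [map_unit_smul, exteriorPower.alternatingMapLinearEquiv_apply_ιMulti]
  simp only [basisElem_numbering]
  rw [Module.Basis.det_self, Units.smul_def, zsmul_one]

theorem koszulLift_gen {t s : ITree I} {n : ℤ} {N : Type*} [AddCommGroup N] [Module k N]
    (y : ∀ m : ℕ, (m : ℤ) = n → (Fin m → Set I) → N) (f : t ⟶ s)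
    (hn : ((t.contracted s).card : ℤ) = n) :
    koszulLift k t s n y (gen k t s n)
      = sgn (numbering t s) • y (t.contracted s).card hn (numbering t s) := by
  unfold koszulLift
  have h : Nonempty {_f : t ⟶ s // ((t.contracted s).card : ℤ) = n} := ⟨⟨f, hn⟩⟩
  rw [dif_pos h, LinearMap.comp_apply, LinearMap.smulRight_apply]
  have h1 : topForm k (t.contracted s) (t.contracted s).equivFin.symm
      (koszulEval k t s n h.some (gen k t s n)) = ((sgn (numbering t s) : ℤˣ) : ℤ) :=
    topForm_gen k t s h.some
  rw [h1, Int.cast_smul_eq_zsmul k, ← Units.smul_def]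
  rfl

theorem koszulGraph_subsingleton {t s : ITree I} {n : ℤ}
    (h : ¬ (Nonempty (t ⟶ s) ∧ ((t.contracted s).card : ℤ) = n)) :
    Subsingleton (koszulGraph k t s n) :=
  ⟨fun _ _ => funext fun f => absurd ⟨⟨f.1⟩, f.2⟩ h⟩

/-- The top exterior power of `k[E]` is a line, spanned by the product of the elements of `E`. -/
theorem exists_eq_smul_gen {t s : ITree I} {n : ℤ} (x : koszulGraph k t s n) :
    ∃ r : k, x = r • gen k t s n := by
  by_cases h : Nonempty (t ⟶ s) ∧ ((t.contracted s).card : ℤ) = n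
  · obtain ⟨⟨f⟩, hn⟩ := h
    let b := (Finsupp.basisSingleOne (R := k)).reindex (t.contracted s).equivFin.symm.symm
    let w := exteriorPower.ιMulti k _ fun i => basisElem k (t.contracted s) (numbering t s i)
    have hw : w = exteriorPower.ιMulti k _ b := by
      simp only [w, basisElem_numbering]
      rfl
    -- the identity of the top exterior power and `y ↦ topForm y • w` agree on the basis
    have key : LinearMap.id
        = (topForm k (t.contracted s) (t.contracted s).equivFin.symm).smulRight w := by
      apply exteriorPower.linearMap_ext
      refine Module.Basis.ext_alternating b fun v hv => ?_
      obtain ⟨σ, rfl⟩ : ∃ σ : Equiv.Perm (Fin (t.contracted s).card), v = σ :=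
        ⟨Equiv.ofBijective v (Finite.injective_iff_bijective.1 hv), rfl⟩
      simp only [LinearMap.compAlternatingMap_apply, LinearMap.id_apply,
        LinearMap.smulRight_apply, topForm,
        exteriorPower.alternatingMapLinearEquiv_apply_ιMulti]
      have h1 := AlternatingMap.map_perm (exteriorPower.ιMulti k (t.contracted s).card) b σ
      have h2 := AlternatingMap.map_perm b.det b σ
      simp only [Function.comp_def] at h1 h2
      rw [h1]
      change _ = b.det (fun i => b (σ i)) • w
      rw [h2, Module.Basis.det_self, hw, Units.smul_def, Units.smul_def, zsmul_one]
      exact (Int.cast_smul_eq_zsmul k _ _).symm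
    let f' : {_f : t ⟶ s // ((t.contracted s).card : ℤ) = n} := ⟨f, hn⟩
    refine ⟨topForm k (t.contracted s) (t.contracted s).equivFin.symm
        (x f' : ⋀[k]^((t.contracted s).card) (t.contracted s →₀ k))
      * ((sgn (numbering t s) : ℤˣ) : ℤ), ?_⟩
    funext g
    obtain rfl : g = f' := Subtype.ext (Subsingleton.elim _ _)
    have h1 : x f' = topForm k (t.contracted s) (t.contracted s).equivFin.symm (x f') • w :=
      LinearMap.congr_fun key (x f' : ⋀[k]^((t.contracted s).card) (t.contracted s →₀ k))
    conv_lhs => rw [h1]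
    change _ = (topForm k (t.contracted s) (t.contracted s).equivFin.symm (x f')
      * ((sgn (numbering t s) : ℤˣ) : ℤ)) • (sgn (numbering t s) • w)
    rw [mul_smul, Int.cast_smul_eq_zsmul k, ← Units.smul_def, smul_smul, sgn_mul_self, one_smul]
  · exact ⟨0, (koszulGraph_subsingleton k h).elim _ _⟩

/-- Linear maps out of `K(t, s)` agree when they agree on the generator. -/
theorem koszulGraph_hom_ext {t s : ITree I} {n : ℤ} {N : Type*} [AddCommGroup N] [Module k N]
    {f g : koszulGraph k t s n →ₗ[k] N}
    (h : (t ⟶ s) → ((t.contracted s).card : ℤ) = n → f (gen k t s n) = g (gen k t s n))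
    (x : koszulGraph k t s n) : f x = g x := by
  by_cases h' : Nonempty (t ⟶ s) ∧ ((t.contracted s).card : ℤ) = n
  · obtain ⟨r, rfl⟩ := exists_eq_smul_gen k x
    rw [map_smul, map_smul, h h'.1.some h'.2]
  · have := koszulGraph_subsingleton k h'
    rw [Subsingleton.elim x 0, map_zero, map_zero]

theorem wedge_eq_smul_gen {t s : ITree I} {m : ℕ} (e : Fin m → Set I)
    (he : Function.Injective e) (himg : Finset.univ.image e = t.contracted s) :
    wedge k t s e = sgn e • gen k t s m := by
  obtain rfl : m = (t.contracted s).card := by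
    rw [← himg, Finset.card_image_of_injective _ he, Finset.card_univ, Fintype.card_fin]
  have hmem : ∀ i, e i ∈ t.contracted s := fun i =>
    himg ▸ Finset.mem_image_of_mem e (Finset.mem_univ i)
  let v : Fin (t.contracted s).card → Fin (t.contracted s).card :=
    fun i => (t.contracted s).equivFin ⟨e i, hmem i⟩
  have hv : Function.Injective v := fun i j hij => he (by simpa [v] using hij)
  obtain ⟨σ, hσ⟩ : ∃ σ : Equiv.Perm (Fin (t.contracted s).card), v = σ :=
    ⟨Equiv.ofBijective v (Finite.injective_iff_bijective.1 hv), rfl⟩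
  have heσ : e = fun i => numbering t s (σ i) := by
    funext i
    rw [← hσ]
    simp [v, numbering]
  funext f
  change exteriorPower.ιMulti k _ (fun i => basisElem k (t.contracted s) (e i))
    = sgn e • (sgn (numbering t s) • exteriorPower.ιMulti k _ fun i =>
      basisElem k (t.contracted s) (numbering t s i))
  have h1 := AlternatingMap.map_perm (exteriorPower.ιMulti k (t.contracted s).card)
    (fun i => basisElem k (t.contracted s) (numbering t s i)) σ
  simp only [Function.comp_def] at h1
  rw [heσ, h1, sgn_comp_perm (numbering_injective t s), smul_smul, mul_assoc, sgn_mul_self,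
    mul_one]

/-- The cocomposition of the generator of `K(t, s)`, as a sum over the set `C` of the edges that are
contracted first. -/
def genΔ (t s : ITree I) (n : ℤ) : tens (koszulGraph k) (koszulGraph k) t s n :=
  ∑ C ∈ (t.contracted s).powerset, eps (t.contracted s \ C) C •
    tmul (koszulGraph k) (koszulGraph k) (b := t.contract C) (p := n - C.card) (q := C.card)
      (sub_add_cancel _ _) (gen k _ s _) (gen k t _ _)

theorem tmul_gen_congr {t s b b' : ITree I} {p q p' q' n : ℤ} (hb : b = b') (hq : q = q')
    (h : p + q = n) (h' : p' + q' = n) :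
    tmul (koszulGraph k) (koszulGraph k) h (gen k b s p) (gen k t b q)
      = tmul (koszulGraph k) (koszulGraph k) h' (gen k b' s p') (gen k t b' q') := by
  subst hb hq
  obtain rfl : p = p' := by omega
  rfl

/-- The shuffle sum does not depend on the chosen order of the edges, up to the sign of this order:
it is the sum over all subsets, with signs that only refer to the fixed linear order. -/
theorem shuffleSum_eq {t s : ITree I} {m : ℕ} {n : ℤ} (h : (m : ℤ) = n)
    (e : Fin m → Set I) (he : Function.Injective e)
    (himg : Finset.univ.image e = t.contracted s) :
    shuffleSum k t s m h e = sgn e • genΔ k t s n := by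
  let G : Finset (Fin m) → tens (koszulGraph k) (koszulGraph k) t s n := fun S =>
    (sgn e * eps (t.contracted s \ S.image e) (S.image e)) •
      tmul (koszulGraph k) (koszulGraph k) (b := t.contract (S.image e))
        (p := n - (S.image e).card) (q := (S.image e).card)
        (sub_add_cancel _ _) (gen k _ s _) (gen k t _ _)
  have hG : shuffleSum k t s m h e = ∑ S : Finset (Fin m), G S := by
    rw [← sum_shuffles]
    unfold shuffleSum
    refine Finset.sum_congr rfl fun p _ => Finset.sum_congr rfl fun σ _ => ?_
    have hp : (p : ℕ) ≤ m := by omega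
    let u : Fin (p : ℕ) → Set I := fun i => e (σ ⟨i, by omega⟩)
    let v : Fin (m - p) → Set I := fun i => e (σ ⟨p + i, by omega⟩)
    have hu : Function.Injective u := fun i j hij => by
      have := congrArg Fin.val (σ.injective (he hij))
      exact Fin.ext this
    have hv : Function.Injective v := fun i j hij => by
      have := congrArg Fin.val (σ.injective (he hij))
      simp only at this
      exact Fin.ext (by omega)
    have hS : (Finset.univ.image fun i : Fin (m - p) => σ ⟨p + i, by omega⟩).image e
        = Finset.univ.image v := by
      rw [Finset.image_image]
      rfl
    have hdisj : Disjoint (Finset.univ.image u) (Finset.univ.image v) := by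
      rw [Finset.disjoint_left]
      intro x hx hx'
      obtain ⟨i, _, rfl⟩ := Finset.mem_image.1 hx
      obtain ⟨j, _, hj⟩ := Finset.mem_image.1 hx'
      have := congrArg Fin.val (σ.injective (he hj))
      simp only at this
      omega
    have hunion : Finset.univ.image u ∪ Finset.univ.image v = t.contracted s := by
      rw [← himg]
      ext x
      simp only [Finset.mem_union, Finset.mem_image, Finset.mem_univ, true_and]
      constructor
      · rintro (⟨i, rfl⟩ | ⟨i, rfl⟩)
        exacts [⟨_, rfl⟩, ⟨_, rfl⟩]
      · rintro ⟨i, rfl⟩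
        obtain ⟨j, rfl⟩ := σ.surjective i
        by_cases hj : (j : ℕ) < p
        · exact Or.inl ⟨⟨j, hj⟩, rfl⟩
        · refine Or.inr ⟨⟨j - p, by omega⟩, ?_⟩
          simp only [v]
          congr 2
          exact Fin.ext (by simp; omega)
    have hsub : Finset.univ.image v ⊆ t.contracted s := hunion ▸ Finset.subset_union_right
    have hdiff : t.contracted s \ Finset.univ.image v = Finset.univ.image u := by
      rw [← hunion, Finset.union_sdiff_right, Finset.sdiff_eq_self_of_disjoint hdisj]
    have hsgn : Equiv.Perm.sign σ
        = sgn e * (sgn u * sgn v * eps (Finset.univ.image u) (Finset.univ.image v)) := by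
      have h1 : ∀ (m' : ℕ) (hm : m' = m), sgn (fun i : Fin m' => e (σ (Fin.cast hm i)))
          = Equiv.Perm.sign σ * sgn e := by
        rintro m' rfl
        exact sgn_comp_perm he σ
      have h2 : (fun i : Fin (p + (m - p)) => e (σ (Fin.cast (by omega) i)))
          = Fin.append u v := by
        funext i
        refine Fin.addCases (fun a => ?_) (fun a => ?_) i
        · rw [Fin.append_left]
          rfl
        · rw [Fin.append_right]
          rfl
      rw [← sgn_append u v hu hv, ← h2, h1, mul_comm, mul_assoc, sgn_mul_self, mul_one]
    have hvcard : (Finset.univ.image v).card = m - p := by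
      rw [Finset.card_image_of_injective _ hv, Finset.card_univ, Fintype.card_fin]
    simp only [G]
    rw [hS, hdiff]
    change Equiv.Perm.sign σ • tmul (koszulGraph k) (koszulGraph k)
      (b := t.contract (Finset.univ.image v)) _ (wedge k _ s u) (wedge k t _ v) = _
    rw [wedge_eq_smul_gen k u hu (by rw [contracted_contract_left, hdiff]),
      wedge_eq_smul_gen k v hv (contracted_contract_right t s hsub).symm, map_unit_smul₂,
      map_unit_smul, smul_smul, smul_smul, hsgn]
    rw [tmul_gen_congr k (q' := (Finset.univ.image v).card) rfl (by rw [hvcard]) _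
      (sub_add_cancel n _)]
    congr 1
    generalize sgn u = a
    generalize sgn v = b
    rcases Int.units_eq_one_or a with rfl | rfl <;> rcases Int.units_eq_one_or b with rfl | rfl <;>
      simp
  rw [hG]
  unfold genΔ
  rw [Finset.smul_sum, ← himg]
  refine Finset.sum_nbij' (fun S => S.image e) (fun C => Finset.univ.filter fun i => e i ∈ C)
    ?_ ?_ ?_ ?_ ?_
  · intro S _
    exact Finset.mem_powerset.2 (Finset.image_subset_image (Finset.subset_univ S))
  · intro C _
    exact Finset.mem_univ _
  · intro S _
    ext i
    simp only [Finset.mem_filter, Finset.mem_univ, true_and, Finset.mem_image]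
    exact ⟨fun ⟨j, hj, hij⟩ => he hij ▸ hj, fun hi => ⟨i, hi, rfl⟩⟩
  · intro C hC
    ext x
    simp only [Finset.mem_filter, Finset.mem_univ, true_and, Finset.mem_image]
    constructor
    · rintro ⟨i, hi, rfl⟩
      exact hi
    · intro hx
      obtain ⟨i, _, rfl⟩ := Finset.mem_image.1 (Finset.mem_powerset.1 hC hx)
      exact ⟨i, hx, rfl⟩
  · intro S _
    simp only [G]
    rw [smul_smul, himg]

theorem koszul_Δ_gen {t s : ITree I} (f : t ⟶ s) {n : ℤ}
    (hn : ((t.contracted s).card : ℤ) = n) :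
    (koszul k I).Δ t s n (gen k t s n) = genΔ k t s n := by
  have h : sgn (numbering t s) • shuffleSum k t s _ hn (numbering t s) = genΔ k t s n := by
    rw [shuffleSum_eq k _ _ (numbering_injective t s) (image_numbering t s), smul_smul,
      sgn_mul_self, one_smul]
  exact (koszulLift_gen k _ f hn).trans h

end Generators

section KoszulCocategory

variable (k : Type u) [Field k] {I : Type v}

open ITree

/-! ### The cocategory `K` -/

theorem sgn_of_le_one {m : ℕ} (hm : m ≤ 1) (e : Fin m → Set I) : sgn e = 1 := by
  refine Finset.prod_eq_one fun i _ => Finset.prod_eq_one fun j hj => ?_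
  have h : i < j := Finset.mem_Ioi.1 hj
  rw [Fin.lt_def] at h
  omega

/-- The cocategory `K`, with its graph given explicitly. -/
abbrev koszulCocat (I : Type v) : CocatData k (ITree I) where
  X := koszulGraph k
  d _ _ _ _ _ := 0
  counit t := koszulLift k t t 0 fun _ _ _ => (1 : k)
  Δ t s n := koszulLift k t s n fun m h e => shuffleSum k t s m h e

theorem koszulCocat_Δ_gen {t s : ITree I} (f : t ⟶ s) {n : ℤ}
    (hn : ((t.contracted s).card : ℤ) = n) :
    (koszulCocat k I).Δ t s n (gen k t s n) = genΔ k t s n := koszul_Δ_gen k f hn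

theorem koszulCocat_counit_gen (t : ITree I) :
    (koszulCocat k I).counit t (gen k t t 0) = 1 := by
  refine (koszulLift_gen k _ (𝟙 t) (by simp)).trans ?_
  rw [sgn_of_le_one (by simp), one_smul]

theorem Δ_gen_left {t s : ITree I} (f : t ⟶ s) {n : ℤ} (hn : ((t.contracted s).card : ℤ) = n)
    {C : Finset (Set I)} (hC : C ⊆ t.contracted s) :
    (koszulCocat k I).Δ (t.contract C) s (n - C.card) (gen k (t.contract C) s (n - C.card))
      = ∑ D ∈ (t.contracted s \ C).powerset, eps ((t.contracted s \ C) \ D) D •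
        tmul (koszulGraph k) (koszulGraph k) (p := n - C.card - D.card) (q := D.card)
          (sub_add_cancel _ _) (gen k ((t.contract C).contract D) s _)
          (gen k (t.contract C) _ _) := by
  rw [koszulCocat_Δ_gen k (contract_hom f hC).some]
  · unfold genΔ
    rw [contracted_contract_left]
  · rw [contracted_contract_left, Finset.card_sdiff_of_subset hC,
      Nat.cast_sub (Finset.card_le_card hC), hn]

theorem Δ_gen_right {t s : ITree I} {C : Finset (Set I)} (hC : C ⊆ t.contracted s) :
    (koszulCocat k I).Δ t (t.contract C) C.card (gen k t (t.contract C) C.card)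
      = ∑ D ∈ C.powerset, eps (C \ D) D •
        tmul (koszulGraph k) (koszulGraph k) (p := C.card - D.card) (q := D.card)
          (sub_add_cancel _ _) (gen k (t.contract D) (t.contract C) _)
          (gen k t (t.contract D) _) := by
  rw [koszulCocat_Δ_gen k (hom_contract t C).some]
  · unfold genΔ
    rw [contracted_contract_right t s hC]
  · rw [contracted_contract_right t s hC]

theorem tmul_tmul_gen_congr {t s b b' c c' : ITree I} {p q r qr p' q' r' qr' n : ℤ} (hb : b = b')
    (hc : c = c') (hq : q = q') (hr : r = r') (h : p + qr = n) (h₁ : q + r = qr)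
    (h' : p' + qr' = n) (h₁' : q' + r' = qr') :
    tmul (koszulGraph k) (tens (koszulGraph k) (koszulGraph k)) h (gen k c s p)
        (tmul (koszulGraph k) (koszulGraph k) h₁ (gen k b c q) (gen k t b r))
      = tmul (koszulGraph k) (tens (koszulGraph k) (koszulGraph k)) h' (gen k c' s p')
        (tmul (koszulGraph k) (koszulGraph k) h₁' (gen k b' c' q') (gen k t b' r')) := by
  subst hb hc hq hr h₁ h₁'
  obtain rfl : p = p' := by omega
  rfl

/-- Both sides are the sum over the ways of contracting the edges in three steps. -/
theorem koszulCocat_coassoc_gen {t s : ITree I} (f : t ⟶ s) {n : ℤ}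
    (hn : ((t.contracted s).card : ℤ) = n) :
    assoc (koszulGraph k) (koszulGraph k) (koszulGraph k) t s n
        (tensMap (koszulCocat k I).Δ (Hom.id (koszulGraph k)) t s n (genΔ k t s n))
      = tensMap (Hom.id (koszulGraph k)) (koszulCocat k I).Δ t s n (genΔ k t s n) := by
  unfold genΔ
  simp only [map_sum, map_unit_smul]
  have hl : ∀ C ∈ (t.contracted s).powerset,
      eps (t.contracted s \ C) C • assoc (koszulGraph k) (koszulGraph k) (koszulGraph k) t s n
        (tensMap (koszulCocat k I).Δ (Hom.id (koszulGraph k)) t s n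
          (tmul (koszulGraph k) (koszulGraph k) (b := t.contract C) (sub_add_cancel n _)
            (gen k _ s _) (gen k t _ C.card)))
      = ∑ D ∈ (t.contracted s \ C).powerset,
        (eps (t.contracted s \ C) C * eps ((t.contracted s \ C) \ D) D) •
        tmul (koszulGraph k) (tens (koszulGraph k) (koszulGraph k)) (p := n - C.card - D.card)
          (q := D.card + C.card) (by omega) (gen k ((t.contract C).contract D) s _)
          (tmul (koszulGraph k) (koszulGraph k) rfl (gen k (t.contract C) _ D.card)
            (gen k t _ C.card)) := by
    intro C hC
    rw [tensMap_tmul, Δ_gen_left k f hn (Finset.mem_powerset.1 hC), map_sum, LinearMap.sum_apply,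
      map_sum, Finset.smul_sum]
    refine Finset.sum_congr rfl fun D _ => ?_
    rw [map_unit_smul₂, map_unit_smul, smul_smul,
      assoc_tmul _ _ _ _ _ (qr := D.card + C.card) rfl (by omega)]
    rfl
  have hr : ∀ C ∈ (t.contracted s).powerset,
      eps (t.contracted s \ C) C • tensMap (Hom.id (koszulGraph k)) (koszulCocat k I).Δ t s n
          (tmul (koszulGraph k) (koszulGraph k) (b := t.contract C) (sub_add_cancel n _)
            (gen k _ s _) (gen k t _ C.card))
      = ∑ D ∈ C.powerset, (eps (t.contracted s \ C) C * eps (C \ D) D) •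
        tmul (koszulGraph k) (tens (koszulGraph k) (koszulGraph k)) (p := n - C.card)
          (sub_add_cancel _ _) (gen k (t.contract C) s _)
          (tmul (koszulGraph k) (koszulGraph k) (p := C.card - D.card) (q := D.card)
            (sub_add_cancel _ _) (gen k (t.contract D) _ _) (gen k t (t.contract D) _)) := by
    intro C hC
    rw [tensMap_tmul, Δ_gen_right k (Finset.mem_powerset.1 hC), map_sum, Finset.smul_sum]
    refine Finset.sum_congr rfl fun D _ => ?_
    rw [map_unit_smul, smul_smul]
    rfl
  rw [Finset.sum_congr rfl hl, Finset.sum_congr rfl hr, Finset.sum_sigma', Finset.sum_sigma']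
  -- the edges of `C` are contracted first, and those of `D` next
  refine Finset.sum_nbij' (fun x => ⟨x.1 ∪ x.2, x.1⟩) (fun x => ⟨x.2, x.1 \ x.2⟩) ?_ ?_ ?_ ?_ ?_
  · rintro ⟨C, D⟩ h
    simp only [Finset.mem_sigma, Finset.mem_powerset] at h ⊢
    exact ⟨Finset.union_subset h.1 (h.2.trans Finset.sdiff_subset), Finset.subset_union_left⟩
  · rintro ⟨C, D⟩ h
    simp only [Finset.mem_sigma, Finset.mem_powerset] at h ⊢
    exact ⟨h.2.trans h.1, Finset.sdiff_subset_sdiff h.1 subset_rfl⟩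
  · rintro ⟨C, D⟩ h
    simp only [Finset.mem_sigma, Finset.mem_powerset] at h ⊢
    have : Disjoint D C := Finset.disjoint_of_subset_left h.2 Finset.sdiff_disjoint
    rw [Finset.union_sdiff_left, Finset.sdiff_eq_self_of_disjoint this]
  · rintro ⟨C, D⟩ h
    simp only [Finset.mem_sigma, Finset.mem_powerset] at h ⊢
    rw [Finset.union_sdiff_of_subset h.2]
  · rintro ⟨C, D⟩ h
    simp only [Finset.mem_sigma, Finset.mem_powerset] at h ⊢
    have hdisj : Disjoint D C := Finset.disjoint_of_subset_left h.2 Finset.sdiff_disjoint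
    have hcard : (C ∪ D).card = C.card + D.card := Finset.card_union_of_disjoint hdisj.symm
    have hCD : (C ∪ D) \ C = D := by
      rw [Finset.union_sdiff_left, Finset.sdiff_eq_self_of_disjoint hdisj]
    have hsplit : t.contracted s \ C = ((t.contracted s \ C) \ D) ∪ D :=
      (Finset.sdiff_union_of_subset h.2).symm
    have hXY : t.contracted s \ (C ∪ D) = (t.contracted s \ C) \ D := by
      rw [sdiff_sdiff_left]
      rfl
    have h1 : eps (t.contracted s \ C) C = eps ((t.contracted s \ C) \ D) C * eps D C := by
      conv_lhs => rw [hsplit]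
      rw [eps_union_left Finset.sdiff_disjoint]
    rw [tmul_tmul_gen_congr k (b' := t.contract C) (c' := t.contract (C ∪ D))
      (q' := (C ∪ D).card - C.card) (r' := C.card) (p' := n - (C ∪ D).card)
      (qr' := (C ∪ D).card) rfl (contract_contract t C D) (by rw [hcard]; push_cast; ring) rfl
      _ _ (by omega) (by omega), hXY, hCD, h1, eps_union_right _ hdisj.symm]
    congr 1
    rw [mul_right_comm]

theorem koszulCocat_isDGCocategory : (koszulCocat k I).IsDGCocategory where
  d_d _ _ _ _ _ _ _ _ := rfl
  coassoc t s n x := by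
    refine koszulGraph_hom_ext k (f := (assoc _ _ _ t s n).comp
      ((tensMap (koszulCocat k I).Δ (Hom.id (koszulGraph k)) t s n).comp
        ((koszulCocat k I).Δ t s n)))
      (g := (tensMap (Hom.id (koszulGraph k)) (koszulCocat k I).Δ t s n).comp
        ((koszulCocat k I).Δ t s n)) ?_ x
    intro f hn
    rw [LinearMap.comp_apply, LinearMap.comp_apply, LinearMap.comp_apply,
      koszulCocat_Δ_gen k f hn]
    exact koszulCocat_coassoc_gen k f hn
  counit_left t s n x := by
    refine koszulGraph_hom_ext k
      (f := ((koszulCocat k I).counitLeft t s n).comp ((koszulCocat k I).Δ t s n))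
      (g := LinearMap.id) ?_ x
    intro f hn
    rw [LinearMap.comp_apply, koszulCocat_Δ_gen k f hn, LinearMap.id_apply]
    unfold genΔ
    rw [map_sum, Finset.sum_eq_single (t.contracted s)]
    · rw [map_unit_smul, Finset.sdiff_self, eps_empty_left, one_smul,
        tmul_gen_congr k (b' := s) (q' := n) (p' := 0) (contract_contracted f) hn _ (zero_add n),
        CocatData.counitLeft_tmul, koszulCocat_counit_gen, one_smul]
    · intro C hC hne
      rw [map_unit_smul, CocatData.counitLeft_tmul_of_ne, smul_zero]
      rintro ⟨h, _⟩
      refine hne ?_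
      rw [← contracted_contract_right t s (Finset.mem_powerset.1 hC), h]
    · intro h
      exact absurd (Finset.mem_powerset_self _) h
  counit_right t s n x := by
    refine koszulGraph_hom_ext k
      (f := ((koszulCocat k I).counitRight t s n).comp ((koszulCocat k I).Δ t s n))
      (g := LinearMap.id) ?_ x
    intro f hn
    rw [LinearMap.comp_apply, koszulCocat_Δ_gen k f hn, LinearMap.id_apply]
    unfold genΔ
    rw [map_sum, Finset.sum_eq_single ∅]
    · rw [map_unit_smul, eps_empty_right, one_smul,
        tmul_gen_congr k (b' := t) (q' := 0) (p' := n) (contract_empty t) (by simp) _ (add_zero n),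
        CocatData.counitRight_tmul, koszulCocat_counit_gen, one_smul]
    · intro C hC hne
      rw [map_unit_smul, CocatData.counitRight_tmul_of_ne, smul_zero]
      rintro ⟨_, h⟩
      exact hne (by simpa using h)
    · intro h
      exact absurd (Finset.empty_mem_powerset _) h
  coleibniz t s m n h x := by
    rw [LinearMap.zero_apply, map_zero]
    refine (tens_hom_ext (f := (koszulCocat k I).tensD t s h) (g := 0) ?_ _).symm
    intro b p q h' y z
    rw [CocatData.tensD_tmul _ (p' := p - 1) (q' := q - 1) h h' (by omega) (by omega) (by omega)
      (by omega), LinearMap.zero_apply, LinearMap.zero_apply, map_zero, map_zero, smul_zero,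
      LinearMap.zero_apply, add_zero, LinearMap.zero_apply]
  counit_d _ _ := map_zero _

theorem koszulGraph_subsingleton_of_not_lt {t s : ITree I} {n : ℤ} (h : t ≠ s)
    (hd : ¬ s.degree < t.degree) : Subsingleton (koszulGraph k t s n) :=
  koszulGraph_subsingleton k fun h' => hd (degree_lt_of_hom h'.1.some h)

theorem koszulCocat_isConnected : (koszulCocat k I).IsConnected ITree.degree where
  subsingleton_self t n hn := koszulGraph_subsingleton k fun h => hn (by simpa using h.2.symm)
  bijective_counit t := by
    have hc := koszulCocat_counit_gen k t
    refine ⟨fun x y h => ?_, fun r => ⟨r • gen k t t 0, ?_⟩⟩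
    · obtain ⟨r, rfl⟩ := exists_eq_smul_gen k x
      obtain ⟨r', rfl⟩ := exists_eq_smul_gen k y
      rw [map_smul, map_smul, hc] at h
      rw [show r = r' by simpa using h]
    · rw [map_smul, hc, smul_eq_mul, mul_one]
  subsingleton a b n h := koszulGraph_subsingleton_of_not_lt k
    (by rintro rfl; exact lt_irrefl _ h) (by omega)

end KoszulCocategory

section TreeCategory

variable (k : Type u) [Field k] {I : Type v}

open ITree

/-! ### The category `k T_I` -/

theorem linearization_comp_single {Ob : Type v} [SmallCategory Ob] {a b c : Ob} {p q n : ℤ}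
    (h : p + q = n) (g : {_f : b ⟶ c // p = 0}) (f : {_f : a ⟶ b // q = 0}) (r r' : k) :
    (linearization k Ob).comp h (Finsupp.single g r) (Finsupp.single f r')
      = Finsupp.single ⟨f.1 ≫ g.1, by rw [← h, g.2, f.2, add_zero]⟩ (r * r') := by
  unfold linearization
  dsimp only
  rw [Finsupp.lsum_single, LinearMap.toSpanSingleton_apply, LinearMap.smul_apply]
  erw [Finsupp.lmapDomain_apply, Finsupp.mapDomain_single]
  exact Finsupp.smul_single _ _ _

theorem linearization_induction {Ob : Type v} [SmallCategory Ob] {a b : Ob} {n : ℤ}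
    {P : (linearization k Ob).X a b n → Prop} (zero : P 0)
    (add : ∀ x y, P x → P y → P (x + y))
    (single : ∀ (f : {_f : a ⟶ b // n = 0}) (r : k),
      P (Finsupp.single f r : {_f : a ⟶ b // n = 0} →₀ k))
    (x : (linearization k Ob).X a b n) : P x :=
  Finsupp.induction_linear (motive := P) x zero add single

theorem linearization_isDGCategory (Ob : Type v) [SmallCategory Ob] :
    (linearization k Ob).IsDGCategory where
  d_d _ _ _ _ _ _ _ _ := rfl
  assoc a b c e p q r pq qr n hpq hqr h h' x y z := by
    induction x using linearization_induction with
    | zero => simp only [map_zero, LinearMap.zero_apply]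
    | add x x' hx hx' => simp only [map_add, LinearMap.add_apply, hx, hx']
    | single g s =>
      induction y using linearization_induction with
      | zero => simp only [map_zero, LinearMap.zero_apply]
      | add x x' hx hx' => simp only [map_add, LinearMap.add_apply, hx, hx']
      | single g' s' =>
        induction z using linearization_induction with
        | zero => simp only [map_zero]
        | add x x' hx hx' => simp only [map_add, hx, hx']
        | single g'' s'' =>
          rw [linearization_comp_single, linearization_comp_single, linearization_comp_single,
            linearization_comp_single, mul_assoc]
          simp only [Category.assoc]
          rfl
  one_comp a b n x := by
    induction x using linearization_induction with
    | zero => simp only [map_zero]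
    | add x x' hx hx' => rw [map_add, hx, hx']
    | single g s =>
      refine (linearization_comp_single k _ ⟨𝟙 b, rfl⟩ g 1 s).trans ?_
      simp only [Category.comp_id, one_mul]
      rfl
  comp_one a b n x := by
    induction x using linearization_induction with
    | zero => simp only [map_zero, LinearMap.zero_apply]
    | add x x' hx hx' => rw [map_add, LinearMap.add_apply, hx, hx']
    | single g s =>
      refine (linearization_comp_single k _ g ⟨𝟙 a, rfl⟩ s 1).trans ?_
      simp only [Category.id_comp, mul_one]
      rfl
  leibniz a b c p q n p' q' n' h hp hq hn h₁ h₂ x y := by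
    change 0 = (linearization k Ob).comp h₁ 0 y + _ • (linearization k Ob).comp h₂ x 0
    rw [map_zero, map_zero, LinearMap.zero_apply, smul_zero, add_zero]

theorem treeCat_subsingleton {t s : ITree I} {n : ℤ} (h : ¬ (Nonempty (t ⟶ s) ∧ n = 0)) :
    Subsingleton ((treeCat k I).X t s n) :=
  ⟨fun _ _ => Finsupp.ext fun f => absurd ⟨⟨f.1⟩, f.2⟩ h⟩

theorem arrow_eq_single {t s : ITree I} {n : ℤ} (f : {_f : t ⟶ s // n = 0}) :
    arrow k t s n = (Finsupp.single f 1 : {_f : t ⟶ s // n = 0} →₀ k) := by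
  unfold arrow
  refine (dif_pos ⟨f⟩).trans (congrArg (fun g => Finsupp.single g 1) ?_)
  exact Subtype.ext (Subsingleton.elim _ _)

theorem exists_eq_smul_arrow {t s : ITree I} {n : ℤ} (x : (treeCat k I).X t s n) :
    ∃ r : k, x = r • arrow k t s n := by
  by_cases h : Nonempty (t ⟶ s) ∧ n = 0
  · obtain ⟨⟨f⟩, hn⟩ := h
    let f' : {_f : t ⟶ s // n = 0} := ⟨f, hn⟩
    let x' : {_f : t ⟶ s // n = 0} →₀ k := x
    refine ⟨x' f', ?_⟩
    rw [arrow_eq_single k f']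
    refine Eq.trans (b := (Finsupp.single f' (x' f') : {_f : t ⟶ s // n = 0} →₀ k)) ?_
      (Finsupp.smul_single_one _ _).symm
    refine Finsupp.ext fun g => ?_
    obtain rfl : f' = g := Subtype.ext (Subsingleton.elim _ _)
    exact (Finsupp.single_eq_same).symm
  · exact ⟨0, (treeCat_subsingleton k h).elim _ _⟩

theorem comp_arrow {t b s : ITree I} (f : t ⟶ b) (g : b ⟶ s) {p q n : ℤ} (hp : p = 0)
    (hq : q = 0) (h : p + q = n) :
    (treeCat k I).comp h (arrow k b s p) (arrow k t b q) = arrow k t s n := by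
  rw [arrow_eq_single k ⟨g, hp⟩, arrow_eq_single k ⟨f, hq⟩,
    arrow_eq_single k ⟨f ≫ g, by omega⟩]
  refine (linearization_comp_single k _ _ _ _ _).trans ?_
  rw [mul_one]

theorem treeCat_one (t : ITree I) : (treeCat k I).one t = arrow k t t 0 :=
  (arrow_eq_single k ⟨𝟙 t, rfl⟩).symm

theorem smul_arrow_eq_zero_iff {t s : ITree I} (f : t ⟶ s) {n : ℤ} (hn : n = 0) (r : k) :
    r • arrow k t s n = 0 ↔ r = 0 := by
  rw [arrow_eq_single k ⟨f, hn⟩]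
  constructor
  · intro h
    have h1 : (Finsupp.single (⟨f, hn⟩ : {_f : t ⟶ s // n = 0}) r) = 0 :=
      (Finsupp.smul_single_one _ _).symm.trans h
    exact Finsupp.single_eq_zero.1 h1
  · rintro rfl
    exact zero_smul _ _

theorem treeCat_subsingleton_of_not_lt {t s : ITree I} (n : ℤ) (h : t ≠ s)
    (hd : ¬ s.degree < t.degree) : Subsingleton ((treeCat k I).X t s n) :=
  treeCat_subsingleton k fun h' => hd (degree_lt_of_hom h'.1.some h)

theorem treeCat_isConnected : (treeCat k I).IsConnected ITree.degree where
  subsingleton_self t n hn := treeCat_subsingleton k fun h => hn h.2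
  bijective_one t := by
    rw [treeCat_one]
    refine ⟨fun r r' h => ?_, fun x => ?_⟩
    · have : (r - r') • arrow k t t 0 = 0 := by
        rw [sub_smul]
        exact sub_eq_zero.2 h
      exact sub_eq_zero.1 ((smul_arrow_eq_zero_iff k (𝟙 t) rfl _).1 this)
    · obtain ⟨r, rfl⟩ := exists_eq_smul_arrow k x
      exact ⟨r, rfl⟩
  subsingleton a b n h := treeCat_subsingleton_of_not_lt k n
    (by rintro rfl; exact lt_irrefl _ h) (by omega)

theorem treeCat_bar_isDGCocategory : (bar (treeCat k I)).IsDGCocategory :=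
  bar_isDGCocategory (treeCat k I) (linearization_isDGCategory k _) (deg := ITree.degree)
    (fun _ _ _ _ _ _ => rfl) fun _ _ n h h' => treeCat_subsingleton_of_not_lt k n h h'

theorem treeCat_bar_isConnected : (bar (treeCat k I)).IsConnected ITree.degree :=
  bar_isConnected (treeCat k I) fun _ _ n h h' => treeCat_subsingleton_of_not_lt k n h h'

end TreeCategory

section Antisymmetrization

variable (k : Type u) [Field k] {I : Type v}

open ITree

/-! ### The antisymmetrization map from `K` to the bar construction -/

/-- The letter of the bar construction given by the morphism from `t` to `s`. -/
def edgeLetter (t s : ITree I) : shift 1 (treeCat k I).X t s 1 :=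
  toShift 1 (treeCat k I).X (m := 0) (by omega) (arrow k t s 0)

/-- The words of the bar construction, as elements of the free cocategory. -/
def edgeWord (t : ITree I) (l : List (Set I)) (s : ITree I) {n : ℤ} (h : (l.length : ℤ) = n) :
    free (shift 1 (treeCat k I).X) t s n := barWord k t l s h

/-- The antisymmetrization of a word, as an element of the free cocategory. -/
def antisym (t s : ITree I) {n : ℤ} (m : ℕ) (h : (m : ℤ) = n) (e : Fin m → Set I) :
    free (shift 1 (treeCat k I).X) t s n :=
  ∑ σ : Equiv.Perm (Fin m), Equiv.Perm.sign σ •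
    edgeWord k t (List.ofFn fun i => e (σ i)) s (by simpa using h)

/-- The image in the bar construction of the generator of `K(t, s)`. -/
def kap (t s : ITree I) (n : ℤ) : free (shift 1 (treeCat k I).X) t s n :=
  kappaBar k I t s n (gen k t s n)

theorem antisym_comp_perm {t s : ITree I} {n : ℤ} {m : ℕ} (h : (m : ℤ) = n)
    (e : Fin m → Set I) (τ : Equiv.Perm (Fin m)) :
    antisym k t s m h (fun i => e (τ i))
      = Equiv.Perm.sign τ • antisym k t s m h e := by
  unfold antisym
  rw [Finset.smul_sum]
  refine Fintype.sum_equiv (Equiv.mulLeft τ) _ _ fun σ => ?_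
  rw [smul_smul, Equiv.coe_mulLeft, map_mul, ← mul_assoc, Int.units_mul_self, one_mul]
  rfl

theorem kap_eq_smul {t s : ITree I} (f : t ⟶ s) {n : ℤ} (hn : ((t.contracted s).card : ℤ) = n) :
    kap k t s n
      = sgn (numbering t s) • antisym k t s _ hn (numbering t s) :=
  koszulLift_gen k (N := (bar (treeCat k I)).X t s n)
    (fun m h e => antisymmetrization k t s m h e) f hn

/-- The antisymmetrization only depends on the order of the edges through its sign. -/
theorem antisym_eq_smul_kap {t s : ITree I} (f : t ⟶ s) {n : ℤ} {m : ℕ}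
    (h : (m : ℤ) = n) (e : Fin m → Set I) (he : Function.Injective e)
    (himg : Finset.univ.image e = t.contracted s) :
    antisym k t s m h e = sgn e • kap k t s n := by
  obtain rfl : m = (t.contracted s).card := by
    rw [← himg, Finset.card_image_of_injective _ he, Finset.card_univ, Fintype.card_fin]
  have hmem : ∀ i, e i ∈ t.contracted s := fun i =>
    himg ▸ Finset.mem_image_of_mem e (Finset.mem_univ i)
  let v : Fin (t.contracted s).card → Fin (t.contracted s).card :=
    fun i => (t.contracted s).equivFin ⟨e i, hmem i⟩
  have hv : Function.Injective v := fun i j hij => he (by simpa [v] using hij)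
  obtain ⟨σ, hσ⟩ : ∃ σ : Equiv.Perm (Fin (t.contracted s).card), v = σ :=
    ⟨Equiv.ofBijective v (Finite.injective_iff_bijective.1 hv), rfl⟩
  have heσ : e = fun i => numbering t s (σ i) := by
    funext i
    rw [← hσ]
    simp [v, numbering]
  rw [kap_eq_smul k f h, heσ, antisym_comp_perm, smul_smul,
    sgn_comp_perm (numbering_injective t s), mul_assoc, sgn_mul_self, mul_one]

theorem sgn_succ {m : ℕ} (e : Fin (m + 1) → Set I)
    (he : Function.Injective fun i : Fin m => e i.succ) :
    sgn e = eps {e 0} (Finset.univ.image fun i : Fin m => e i.succ)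
      * sgn fun i : Fin m => e i.succ := by
  unfold sgn eps
  rw [Fin.prod_univ_succ, Fin.prod_Ioi_zero, Finset.prod_singleton,
    Finset.prod_image fun _ _ _ _ h => he h]
  simp only [Fin.prod_Ioi_succ]

theorem edgeWord_congr {t s : ITree I} {l l' : List (Set I)} (hl : l = l') {n : ℤ}
    (h : (l.length : ℤ) = n) (h' : (l'.length : ℤ) = n) :
    edgeWord k t l s h = edgeWord k t l' s h' := by
  subst hl
  rfl

theorem edgeWord_cons_eq {t s b : ITree I} (a : Set I) (l : List (Set I)) {n n' : ℤ}
    (h : ((a :: l).length : ℤ) = n) (h' : (l.length : ℤ) = n') (h₁ : 1 + n' = n)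
    (hb : t.contract l.toFinset = b) :
    edgeWord k t (a :: l) s h
      = cons (shift 1 (treeCat k I).X) h₁ (edgeLetter k b s) (edgeWord k t l b h') := by
  subst hb
  obtain rfl : n' = n - 1 := by omega
  rfl

theorem kap_self (t : ITree I) : kap k t t 0 = GrGraph.one (shift 1 (treeCat k I).X) t := by
  rw [kap_eq_smul k (𝟙 t) (by simp), sgn_of_le_one (by simp), one_smul]
  have key : ∀ (m : ℕ) (h : (m : ℤ) = 0) (e : Fin m → Set I),
      antisym k t t m h e = GrGraph.one (shift 1 (treeCat k I).X) t := by
    intro m h e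
    obtain rfl : m = 0 := by exact_mod_cast h
    unfold antisym
    rw [Fintype.sum_unique]
    have hs : Equiv.Perm.sign (default : Equiv.Perm (Fin 0)) = 1 := Equiv.Perm.sign_one
    rw [hs, one_smul]
    refine (edgeWord_congr k (l' := []) (by simp) _ rfl).trans ?_
    exact dif_pos rfl
  exact key _ _ _

/-- The expansion of the antisymmetrization with respect to the first letter of the words, that is,
to the edge which is contracted last. -/
theorem kap_eq_sum {t s : ITree I} (f : t ⟶ s) (h0 : t ≠ s) {n q : ℤ}
    (hn : ((t.contracted s).card : ℤ) = n) (hq : 1 + q = n) :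
    kap k t s n = ∑ a ∈ t.contracted s, eps {a} ((t.contracted s).erase a) •
      cons (shift 1 (treeCat k I).X) hq
        (edgeLetter k (t.contract ((t.contracted s).erase a)) s)
        (kap k t (t.contract ((t.contracted s).erase a)) q) := by
  obtain ⟨m, hm⟩ : ∃ m, (t.contracted s).card = m + 1 :=
    Nat.exists_eq_succ_of_ne_zero fun h =>
      h0 (eq_of_contracted_eq_empty f (Finset.card_eq_zero.1 h))
  obtain ⟨e, he, himg⟩ : ∃ e : Fin (m + 1) → Set I, Function.Injective e ∧
      Finset.univ.image e = t.contracted s :=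
    ⟨fun i => numbering t s (Fin.cast hm.symm i),
      (numbering_injective t s).comp (Fin.cast_injective _), by
        conv_rhs => rw [← image_numbering]
        ext x
        simp only [Finset.mem_image, Finset.mem_univ, true_and]
        exact ⟨fun ⟨i, hi⟩ => ⟨_, hi⟩, fun ⟨i, hi⟩ => ⟨Fin.cast hm i, hi⟩⟩⟩
  have hmn : ((m + 1 : ℕ) : ℤ) = n := by omega
  have hmq : (m : ℤ) = q := by push_cast at hmn; omega
  have h1 : kap k t s n = sgn e • antisym k t s (m + 1) hmn e := by
    rw [antisym_eq_smul_kap k f hmn e he himg, smul_smul, sgn_mul_self, one_smul]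
  rw [h1, ← himg, Finset.sum_image fun _ _ _ _ h => he h]
  unfold antisym
  rw [← Equiv.Perm.decomposeFin.symm.sum_comp, Fintype.sum_prod_type, Finset.smul_sum]
  refine Finset.sum_congr rfl fun p _ => ?_
  let e' : Fin m → Set I := fun j => e (Equiv.swap 0 p j.succ)
  have he' : Function.Injective e' := fun i j hij =>
    Fin.succ_injective _ ((Equiv.swap 0 p).injective (he hij))
  have himg' : Finset.univ.image e' = (Finset.univ.image e).erase (e p) := by
    ext x
    simp only [Finset.mem_image, Finset.mem_erase, Finset.mem_univ, true_and, e']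
    constructor
    · rintro ⟨j, rfl⟩
      refine ⟨fun h => ?_, _, rfl⟩
      have h2 := he h
      rw [← Equiv.swap_apply_left 0 p] at h2
      exact Fin.succ_ne_zero j ((Equiv.swap 0 p).injective h2)
    · rintro ⟨hx, i, rfl⟩
      obtain ⟨j, rfl⟩ := (Equiv.swap 0 p).surjective i
      obtain ⟨j, rfl⟩ := Fin.exists_succ_eq.2 (show j ≠ 0 by
        rintro rfl
        exact hx (by rw [Equiv.swap_apply_left]))
      exact ⟨j, rfl⟩
  have hsub : (Finset.univ.image e).erase (e p) ⊆ t.contracted s :=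
    himg ▸ Finset.erase_subset _ _
  have hA : ∀ τ : Equiv.Perm (Fin m),
      (Equiv.Perm.sign (Equiv.Perm.decomposeFin.symm (p, τ))) •
        edgeWord k t (List.ofFn fun i => e (Equiv.Perm.decomposeFin.symm (p, τ) i)) s
          (by simpa using hmn)
      = Equiv.Perm.sign (Equiv.swap 0 p) • cons (shift 1 (treeCat k I).X) hq
        (edgeLetter k (t.contract ((Finset.univ.image e).erase (e p))) s)
        (Equiv.Perm.sign τ • edgeWord k t (List.ofFn fun i => e' (τ i))
          (t.contract ((Finset.univ.image e).erase (e p))) (by simpa using hmq)) := by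
    intro τ
    rw [map_unit_smul, smul_smul]
    congr 1
    · rw [Equiv.Perm.decomposeFin.symm_sign, Equiv.Perm.sign_swap']
      simp only [eq_comm]
    · refine (edgeWord_congr k (l' := e p :: List.ofFn fun i => e' (τ i)) ?_ _
        (by simpa using hmn)).trans (edgeWord_cons_eq k _ _ _ _ _ ?_)
      · rw [List.ofFn_succ, Equiv.Perm.decomposeFin_symm_apply_zero]
        simp only [Equiv.Perm.decomposeFin_symm_apply_succ, e']
      · congr 1
        rw [← himg']
        ext x
        simp only [List.mem_toFinset, List.mem_ofFn, Finset.mem_image, Finset.mem_univ, true_and]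
        exact ⟨fun ⟨i, hi⟩ => ⟨_, hi⟩, fun ⟨i, hi⟩ => ⟨τ.symm i, by simpa using hi⟩⟩
  rw [Finset.sum_congr rfl fun τ _ => hA τ, ← Finset.smul_sum, ← map_sum]
  have h2 : ∑ τ : Equiv.Perm (Fin m), Equiv.Perm.sign τ •
        edgeWord k t (List.ofFn fun i => e' (τ i))
          (t.contract ((Finset.univ.image e).erase (e p))) (by simpa using hmq)
      = sgn e' • kap k t (t.contract ((Finset.univ.image e).erase (e p))) q :=
    antisym_eq_smul_kap k (hom_contract _ _).some hmq e' he'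
      (by rw [himg', contracted_contract_right t s hsub])
  have h3 : sgn e = Equiv.Perm.sign (Equiv.swap 0 p) *
      (eps {e p} ((Finset.univ.image e).erase (e p)) * sgn e') := by
    have h4 := sgn_comp_perm he (Equiv.swap 0 p)
    have h5 := sgn_succ (fun i => e (Equiv.swap 0 p i)) he'
    have h6 : (Finset.univ.image fun i : Fin m => e (Equiv.swap 0 p i.succ))
      = (Finset.univ.image e).erase (e p) := himg'
    rw [h6, Equiv.swap_apply_left] at h5
    rw [← h5, h4, ← mul_assoc, Int.units_mul_self, one_mul]
  rw [h2, map_unit_smul, smul_smul, smul_smul, h3]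
  congr 1
  generalize Equiv.Perm.sign (Equiv.swap 0 p) = x
  generalize sgn e' = y
  rcases Int.units_eq_one_or x with rfl | rfl <;> rcases Int.units_eq_one_or y with rfl | rfl <;>
    simp

end Antisymmetrization

/-! ### `K` as a subcocategory of the bar construction -/

section Kappa

variable (k : Type u) [Field k] {I : Type v}

open ITree

/-- Exchanging the first two of the elements taken out of a set changes the sign. -/
theorem eps_erase_erase {A : Finset (Set I)} {a b : Set I} (ha : a ∈ A) (hb : b ∈ A)
    (hab : a ≠ b) : eps {a} (A.erase a) * eps {b} ((A.erase a).erase b)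
      = -(eps {b} (A.erase b) * eps {a} ((A.erase b).erase a)) := by
  have h : ∀ {a b : Set I}, b ∈ A → a ≠ b →
      eps {a} (A.erase a) = pairSign a b * eps {a} ((A.erase a).erase b) := by
    intro a b hb hab
    conv_lhs => rw [← Finset.insert_erase (Finset.mem_erase.2 ⟨hab.symm, hb⟩)]
    rw [eps_insert_right _ (Finset.notMem_erase _ _)]
    congr 1
    simp [eps]
  rw [h hb hab, h ha hab.symm, pairSign_swap hab, Finset.erase_right_comm (s := A) (a := b)]
  simp only [neg_mul]
  rw [mul_right_comm]

/-- The differential of the bar construction of `k T_I`; it only involves the composition. -/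
def treeBarD {t s : ITree I} {m n : ℤ} (h : n + 1 = m) :
    free (shift 1 (treeCat k I).X) t s m →ₗ[k] free (shift 1 (treeCat k I).X) t s n :=
  (bar (treeCat k I)).d t s h

theorem treeBarD_one (t : ITree I) {n : ℤ} (h : n + 1 = 0) :
    treeBarD k h (GrGraph.one (shift 1 (treeCat k I).X) t) = 0 :=
  coderiv_one _ (barμ (treeCat k I)) h

theorem treeBarD_cons {a b c : ITree I} {p q q' i j : ℤ} (h : p + q = i) (h' : j + 1 = i)
    (hq : q' + 1 = q) (h₂ : p + q' = j) (h₃ : j + 1 = p + q)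
    (γ : shift 1 (treeCat k I).X b c p) (w : free (shift 1 (treeCat k I).X) a b q) :
    treeBarD k h' (cons (shift 1 (treeCat k I).X) h γ w)
      = merge _ (barμ (treeCat k I)) h₃ γ w
        + p.negOnePow • cons (shift 1 (treeCat k I).X) h₂ γ (treeBarD k hq w) := by
  refine coderiv_cons_of_eq_zero _ (barμ (treeCat k I)) ?_ h h' hq h₂ h₃ γ w
  intro a b i j h γ
  refine neg_eq_zero.2 ?_
  exact map_zero (toShift 1 (treeCat k I).X (m := j - 1) (n := j) (by omega))

theorem kap_cons_congr {t b s : ITree I} {p q q' n : ℤ} (γ : shift 1 (treeCat k I).X b s p)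
    (hq : q = q') (h : p + q = n) (h' : p + q' = n) :
    cons (shift 1 (treeCat k I).X) h γ (kap k t b q)
      = cons (shift 1 (treeCat k I).X) h' γ (kap k t b q') := by
  subst hq
  rfl

theorem kap_tmul_congr {t s b b' : ITree I} {p q p' q' n : ℤ} (hb : b = b') (hq : q = q')
    (h : p + q = n) (h' : p' + q' = n) :
    tmul (free (shift 1 (treeCat k I).X)) (free (shift 1 (treeCat k I).X)) h
        (kap k b s p) (kap k t b q)
      = tmul (free (shift 1 (treeCat k I).X)) (free (shift 1 (treeCat k I).X)) h'
        (kap k b' s p') (kap k t b' q') := by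
  subst hb hq
  obtain rfl : p = p' := by omega
  rfl

theorem bar_counit_one {Ob : Type v} (C : CatData k Ob) (a : Ob) :
    (bar C).counit a (GrGraph.one (shift 1 C.X) a) = 1 :=
  (freeLift_incl _ _ _ _).trans (wordZeroLift_nil _ _)

theorem treeBar_counit_kap (t : ITree I) :
    (bar (treeCat k I)).counit t (kap k t t 0) = 1 := by
  refine Eq.trans (congrArg ((bar (treeCat k I)).counit t) (kap_self k t)) ?_
  exact bar_counit_one k (treeCat k I) t

theorem barμ_edgeLetter {t b s : ITree I} (f : t ⟶ b) (g : b ⟶ s) (h₁ : t ≠ b) (h₂ : b ≠ s)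
    (h : (1 : ℤ) + 1 = 1 + 1) :
    barμ (treeCat k I) t b s 1 1 1 h (edgeLetter k b s) (edgeLetter k t b)
      = -edgeLetter k t s := by
  rw [barμ_apply (treeCat k I) h (zero_add 1) (zero_add 1) (zero_add 1) (zero_add 0)]
  unfold edgeLetter
  rw [ofShift_toShift _ _ h₂, ofShift_toShift _ _ h₁, comp_arrow k f g rfl rfl,
    Int.negOnePow_one, Units.neg_smul, one_smul]

theorem contract_erase_ne {t s : ITree I} {a : Set I} (ha : a ∈ t.contracted s) :
    t.contract ((t.contracted s).erase a) ≠ s := by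
  intro h
  have h1 := contracted_contract_right t s (Finset.erase_subset a (t.contracted s))
  rw [h] at h1
  rw [h1] at ha
  exact Finset.notMem_erase a _ ha

/-- The two ways of ordering the last two contractions give the same composite with opposite
signs. -/
theorem treeBarD_kap {t s : ITree I} (f : t ⟶ s) {m n : ℤ} (h : n + 1 = m)
    (hm : ((t.contracted s).card : ℤ) = m) : treeBarD k h (kap k t s m) = 0 := by
  induction hN : (t.contracted s).card generalizing s m n with
  | zero =>
    obtain rfl := eq_of_contracted_eq_empty f (Finset.card_eq_zero.1 hN)
    obtain rfl : m = 0 := by rw [← hm, hN]; rfl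
    rw [kap_self, treeBarD_one]
  | succ N ih =>
    have hne : t ≠ s := by
      rintro rfl
      simp at hN
    rw [kap_eq_sum k f hne (q := n) hm (by omega), map_sum]
    let A := t.contracted s
    let F : Set I → Set I → free (shift 1 (treeCat k I).X) t s n := fun a b =>
      (eps {a} (A.erase a) * eps {b} ((A.erase a).erase b)) •
        -cons (shift 1 (treeCat k I).X) (add_sub_cancel 1 n)
          (edgeLetter k (t.contract ((A.erase a).erase b)) s)
          (kap k t (t.contract ((A.erase a).erase b)) (n - 1))
    have key : ∀ a ∈ t.contracted s, treeBarD k h (eps {a} ((t.contracted s).erase a) •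
        cons (shift 1 (treeCat k I).X) (show 1 + n = m by omega)
          (edgeLetter k (t.contract ((t.contracted s).erase a)) s)
          (kap k t (t.contract ((t.contracted s).erase a)) n)) = ∑ b ∈ A.erase a, F a b := by
      intro a ha
      have hB : t.contracted (t.contract (A.erase a)) = A.erase a :=
        contracted_contract_right t s (Finset.erase_subset a _)
      have hcard : (A.erase a).card = N := by
        rw [Finset.card_erase_of_mem ha]
        omega
      rw [map_unit_smul, treeBarD_cons k (q' := n - 1) _ h (by omega) (by omega) (by omega),
        ih (hom_contract _ _).some (by omega) (by rw [hB, hcard]; omega) (by rw [hB, hcard]),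
        map_zero, smul_zero, add_zero]
      by_cases h0 : t = t.contract (A.erase a)
      · have h1 : A.erase a = ∅ := by rw [← hB, ← h0, contracted_self]
        rw [h1, Finset.sum_empty]
        have hn : n = 0 := by
          rw [h1] at hcard
          rw [hN, ← hcard] at hm
          simp at hm
          omega
        subst hn
        rw [contract_empty, kap_self, merge_one, smul_zero]
      · rw [kap_eq_sum k (hom_contract t _).some h0 (q := n - 1) (by rw [hB, hcard]; omega)
          (by omega), hB, map_sum, Finset.smul_sum]
        refine Finset.sum_congr rfl fun b hb => ?_
        have hg : Nonempty (t.contract ((A.erase a).erase b) ⟶ t.contract (A.erase a)) :=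
          contract_hom (hom_contract t _).some (by rw [hB]; exact Finset.erase_subset _ _)
        have hne' : t.contract ((A.erase a).erase b) ≠ t.contract (A.erase a) := by
          have := contract_erase_ne (t := t) (s := t.contract (A.erase a)) (a := b)
            (by rwa [hB])
          rwa [hB] at this
        rw [map_unit_smul, smul_smul, merge_cons _ _ _ (m := 1) (by omega) (by omega),
          barμ_edgeLetter k hg.some (contract_hom f (Finset.erase_subset a _)).some hne'
            (contract_erase_ne ha), map_neg, LinearMap.neg_apply]
    rw [Finset.sum_congr rfl key, Finset.sum_sigma']
    refine Finset.sum_involution (fun x _ => ⟨x.2, x.1⟩) ?_ ?_ ?_ ?_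
    · rintro ⟨a, b⟩ hab
      simp only [Finset.mem_sigma, Finset.mem_erase] at hab
      obtain ⟨ha, hba, hb⟩ := hab
      simp only [F]
      rw [eps_erase_erase ha hb (Ne.symm hba), Finset.erase_right_comm (s := A) (a := b),
        Units.neg_smul, neg_add_cancel]
    · rintro ⟨a, b⟩ hab _ heq
      simp only [Finset.mem_sigma, Finset.mem_erase] at hab
      exact hab.2.1 (congrArg Sigma.fst heq)
    · rintro ⟨a, b⟩ hab
      simp only [Finset.mem_sigma, Finset.mem_erase] at hab ⊢
      exact ⟨hab.2.2, Ne.symm hab.2.1, hab.1⟩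
    · rintro ⟨a, b⟩ _
      rfl

/-- The cocomposition of the bar construction cuts the antisymmetrization of a set of edges in all
possible ways, as the shuffle cocomposition does. -/
theorem deconcat_kap {t s : ITree I} (f : t ⟶ s) {n : ℤ} (hn : ((t.contracted s).card : ℤ) = n) :
    deconcat (shift 1 (treeCat k I).X) t s n (kap k t s n)
      = ∑ C ∈ (t.contracted s).powerset, eps (t.contracted s \ C) C •
        tmul (free (shift 1 (treeCat k I).X)) (free (shift 1 (treeCat k I).X))
          (b := t.contract C) (p := n - C.card) (q := C.card) (sub_add_cancel _ _)
          (kap k _ s _) (kap k t _ _) := by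
  induction hN : (t.contracted s).card generalizing s n with
  | zero =>
    have h0 := Finset.card_eq_zero.1 hN
    obtain rfl := eq_of_contracted_eq_empty f h0
    obtain rfl : n = 0 := by rw [← hn, hN]; rfl
    rw [kap_self, deconcat_one, h0, Finset.powerset_empty, Finset.sum_singleton, eps_empty_right,
      one_smul, kap_tmul_congr k (b' := t) (q' := 0) (p' := 0) (contract_empty t) (by simp) _
        (add_zero 0), kap_self]
  | succ N ih =>
    have hne : t ≠ s := by
      rintro rfl
      simp at hN
    let A := t.contracted s
    -- the term of `C`, for `a` the edge that is contracted last
    let G : Set I → Finset (Set I) → tens (free (shift 1 (treeCat k I).X))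
        (free (shift 1 (treeCat k I).X)) t s n := fun a C =>
      (eps (A \ C) C * eps {a} ((A \ C).erase a)) •
        tmul (free (shift 1 (treeCat k I).X)) (free (shift 1 (treeCat k I).X))
          (sub_add_cancel n C.card)
          (cons (shift 1 (treeCat k I).X) (add_sub_cancel 1 (n - C.card))
            (edgeLetter k (t.contract (A.erase a)) s)
            (kap k (t.contract C) (t.contract (A.erase a)) (n - C.card - 1)))
          (kap k t (t.contract C) C.card)
    have hl : deconcat (shift 1 (treeCat k I).X) t s n (kap k t s n)
        = tmul (free (shift 1 (treeCat k I).X)) (free (shift 1 (treeCat k I).X)) (zero_add n)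
            (GrGraph.one _ s) (kap k t s n)
          + ∑ a ∈ A, ∑ C ∈ (A.erase a).powerset, G a C := by
      conv_lhs => rw [kap_eq_sum k f hne hn (q := n - 1) (by omega)]
      conv_rhs => rw [kap_eq_sum k f hne hn (q := n - 1) (by omega)]
      rw [map_sum, map_sum, ← Finset.sum_add_distrib]
      refine Finset.sum_congr rfl fun a ha => ?_
      have hB : t.contracted (t.contract (A.erase a)) = A.erase a :=
        contracted_contract_right t s (Finset.erase_subset a _)
      have hcard : (A.erase a).card = N := by
        rw [Finset.card_erase_of_mem ha]
        omega
      rw [map_unit_smul, map_unit_smul, deconcat_cons, smul_add,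
        ih (hom_contract _ _).some (by rw [hB, hcard]; omega) (by rw [hB, hcard]), hB]
      congr 1
      rw [map_sum, Finset.smul_sum]
      refine Finset.sum_congr rfl fun C hC => ?_
      have hC' := Finset.mem_powerset.1 hC
      have haC : a ∉ C := fun h => Finset.notMem_erase a _ (hC' h)
      have haAC : a ∈ A \ C := Finset.mem_sdiff.2 ⟨ha, haC⟩
      have hEa : A.erase a \ C = (A \ C).erase a := by
        rw [Finset.erase_sdiff_comm]
      have h1 : eps {a} (A.erase a) = eps {a} ((A \ C).erase a) * eps {a} C := by
        rw [← hEa]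
        conv_lhs => rw [← Finset.sdiff_union_of_subset hC']
        rw [eps_union_right _ Finset.sdiff_disjoint]
      have h2 : eps (A \ C) C = eps {a} C * eps ((A \ C).erase a) C := by
        conv_lhs => rw [← Finset.insert_erase haAC]
        rw [eps_insert_left (Finset.notMem_erase _ _)]
      rw [map_unit_smul, smul_smul, consTens_tmul _ _ _ _ (m := n - C.card) (by omega) (by omega)]
      simp only [G]
      rw [kap_cons_congr k (q' := n - C.card - 1) _ (by omega) _ (by omega), h2]
      change (eps {a} (A.erase a) * _) • _ = _
      rw [h1, hEa]
      congr 1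
      generalize eps {a} C = x
      rcases Int.units_eq_one_or x with rfl | rfl <;> simp [mul_comm]
    rw [hl]
    rw [Finset.sum_comm' (t' := A.powerset) (s' := fun C => A \ C) (by
      intro a C
      simp only [Finset.mem_powerset, Finset.mem_sdiff, Finset.subset_erase]
      tauto), ← Finset.sum_erase_add _ _ (Finset.mem_powerset_self A), Finset.sdiff_self,
      Finset.sum_empty, add_zero, ← Finset.sum_erase_add _ _ (Finset.mem_powerset_self A), add_comm]
    congr 1
    · refine Finset.sum_congr rfl fun C hC => ?_
      obtain ⟨hCA, hC⟩ := Finset.mem_erase.1 hC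
      have hC' := Finset.mem_powerset.1 hC
      have hD : (t.contract C).contracted s = A \ C := contracted_contract_left t s C
      have hcs : t.contract C ≠ s := by
        intro h
        refine hCA ?_
        rw [← contracted_contract_right t s hC', h]
      rw [kap_eq_sum k (contract_hom f hC').some hcs (q := n - C.card - 1)
        (by rw [hD, Finset.card_sdiff_of_subset hC', Nat.cast_sub (Finset.card_le_card hC'), hn])
        (by omega), map_sum, LinearMap.sum_apply, Finset.smul_sum, hD]
      refine Finset.sum_congr rfl fun a ha => ?_
      simp only [G]
      have hu : C ∪ (A \ C).erase a = A.erase a := by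
        ext x
        simp only [Finset.mem_union, Finset.mem_erase, Finset.mem_sdiff]
        have h1 := @hC' x
        have h2 := (Finset.mem_sdiff.1 ha).2
        by_cases hx : x ∈ C
        · have : x ≠ a := fun h => h2 (h ▸ hx)
          tauto
        · tauto
      rw [map_unit_smul₂, smul_smul, contract_contract, hu]
    · rw [Finset.sdiff_self, eps_empty_left, one_smul,
        kap_tmul_congr k (b' := s) (q' := n) (p' := 0) (contract_contracted f) hn _ (zero_add n),
        kap_self]

/-- Linear maps out of the words, given on the words whose first letter starts from the object `b`
and has degree `p`, and zero on the other words. -/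
def firstLetterLift {Γ : GrGraph k (ITree I)} {a b c : ITree I} {p q n : ℤ} {N : Type*}
    [AddCommGroup N] [Module k N] (ψ : Γ b c p →ₗ[k] free Γ a b q →ₗ[k] N) :
    free Γ a c n →ₗ[k] N :=
  freeLift Γ fun m =>
    match m with
    | 0 => 0
    | m + 1 => wordSuccLift Γ m fun b' p' q' _ =>
      if hb : b' = b ∧ p' = p ∧ q' = q then
        ψ.compl₁₂ (Γ.cast hb.1 rfl hb.2.1) (((free Γ).cast rfl hb.1 hb.2.2).comp (incl Γ m a b' q'))
      else 0

theorem firstLetterLift_cons {Γ : GrGraph k (ITree I)} {a b c : ITree I} {p q n : ℤ} {N : Type*}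
    [AddCommGroup N] [Module k N] (ψ : Γ b c p →ₗ[k] free Γ a b q →ₗ[k] N) (h : p + q = n)
    (γ : Γ b c p) (w : free Γ a b q) : firstLetterLift k ψ (cons Γ h γ w) = ψ γ w := by
  induction w using free_induction_incl with
  | zero => simp only [map_zero]
  | add x y hx hy => simp only [map_add, hx, hy]
  | incl m w =>
    unfold firstLetterLift
    rw [cons_incl, freeLift_incl]
    refine (wordSuccLift_cons Γ m _ h γ w).trans ?_
    rw [dif_pos ⟨rfl, rfl, rfl⟩]
    rfl

theorem firstLetterLift_cons_of_ne {Γ : GrGraph k (ITree I)} {a b b' c : ITree I} {p q p' q' n : ℤ}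
    {N : Type*} [AddCommGroup N] [Module k N] (ψ : Γ b c p →ₗ[k] free Γ a b q →ₗ[k] N)
    (h : p' + q' = n) (hb : b' ≠ b) (γ : Γ b' c p') (w : free Γ a b' q') :
    firstLetterLift k ψ (cons Γ h γ w) = 0 := by
  induction w using free_induction_incl with
  | zero => simp only [map_zero]
  | add x y hx hy => simp only [map_add, hx, hy, add_zero]
  | incl m w =>
    unfold firstLetterLift
    rw [cons_incl, freeLift_incl]
    refine (wordSuccLift_cons Γ m _ h γ w).trans ?_
    rw [dif_neg fun h => hb h.1]
    rfl

theorem edgeLetter_ne_zero {t s : ITree I} (f : t ⟶ s) (h : t ≠ s) : edgeLetter k t s ≠ 0 := by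
  intro h0
  have h1 := congrArg (ofShift 1 (treeCat k I).X (zero_add 1)) h0
  unfold edgeLetter at h1
  rw [ofShift_toShift _ _ h, map_zero] at h1
  exact one_ne_zero ((smul_arrow_eq_zero_iff k f rfl (1 : k)).1 (by rw [h1, smul_zero]))

/-- In the expansion with respect to the edge which is contracted last, the first letters of the
terms start from different trees, so the terms cannot cancel. -/
theorem kap_ne_zero {t s : ITree I} (f : t ⟶ s) {n : ℤ} (hn : ((t.contracted s).card : ℤ) = n) :
    kap k t s n ≠ 0 := by
  induction hN : (t.contracted s).card generalizing s n with
  | zero =>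
    obtain rfl := eq_of_contracted_eq_empty f (Finset.card_eq_zero.1 hN)
    obtain rfl : n = 0 := by rw [← hn, hN]; rfl
    intro h
    have h1 := treeBar_counit_kap k t
    have h2 := congrArg ((bar (treeCat k I)).counit t) h
    exact one_ne_zero (h1.symm.trans (h2.trans (map_zero ((bar (treeCat k I)).counit t))))
  | succ N ih =>
    have hne : t ≠ s := by
      rintro rfl
      simp at hN
    obtain ⟨a, ha⟩ : (t.contracted s).Nonempty := Finset.card_pos.1 (by omega)
    have hB : t.contracted (t.contract ((t.contracted s).erase a)) = (t.contracted s).erase a :=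
      contracted_contract_right t s (Finset.erase_subset a _)
    have hcard : ((t.contracted s).erase a).card = N := by
      rw [Finset.card_erase_of_mem ha]
      omega
    have h1 := ih (hom_contract t _).some (n := n - 1) (by rw [hB, hcard]; omega)
      (by rw [hB, hcard])
    have h2 := edgeLetter_ne_zero k (contract_hom f (Finset.erase_subset a _)).some
      (contract_erase_ne ha)
    obtain ⟨φ, hφ⟩ : ∃ φ : Module.Dual k _, φ (kap k t (t.contract ((t.contracted s).erase a))
        (n - 1)) ≠ 0 := by
      by_contra! h
      exact h1 ((Module.forall_dual_apply_eq_zero_iff k _).1 h)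
    obtain ⟨c, hc⟩ : ∃ c : Module.Dual k _,
        c (edgeLetter k (t.contract ((t.contracted s).erase a)) s) ≠ 0 := by
      by_contra! h
      exact h2 ((Module.forall_dual_apply_eq_zero_iff k _).1 h)
    intro h
    have h3 := congrArg (firstLetterLift k (n := n) ((LinearMap.mul k k).compl₁₂ c φ)) h
    rw [kap_eq_sum k f hne hn (q := n - 1) (by omega), map_sum, Finset.sum_eq_single a,
      map_unit_smul, firstLetterLift_cons, map_zero] at h3
    · have h4 : c (edgeLetter k (t.contract ((t.contracted s).erase a)) s)
          * φ (kap k t (t.contract ((t.contracted s).erase a)) (n - 1)) = 0 := by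
        rcases Int.units_eq_one_or (eps {a} ((t.contracted s).erase a)) with h | h <;>
          rw [h] at h3
        · simpa using h3
        · simpa using h3
      exact (mul_ne_zero hc hφ) h4
    · intro b hb hba
      rw [map_unit_smul, firstLetterLift_cons_of_ne, smul_zero]
      intro h
      have h5 := contracted_contract_right t s (Finset.erase_subset b (t.contracted s))
      rw [h, hB] at h5
      have h6 : b ∈ (t.contracted s).erase a := Finset.mem_erase.2 ⟨hba, hb⟩
      rw [h5] at h6
      exact Finset.notMem_erase _ _ h6
    · intro h
      exact absurd ha h

theorem kappaBar_isSubcocategory :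
    IsSubcocategory (koszul k I) (bar (treeCat k I)) (kappaBar k I) where
  map_d t s m n h x := by
    refine (map_zero (kappaBar k I t s n)).trans (Eq.symm ?_)
    refine koszulGraph_hom_ext k
      (f := ((bar (treeCat k I)).d t s h).comp (kappaBar k I t s m)) (g := 0) ?_ x
    intro f hm
    exact treeBarD_kap k f h hm
  map_Δ t s n x := by
    refine koszulGraph_hom_ext k
      (f := ((bar (treeCat k I)).Δ t s n).comp (kappaBar k I t s n))
      (g := (tensMap (kappaBar k I) (kappaBar k I) t s n).comp ((koszul k I).Δ t s n)) ?_ x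
    intro f hn
    refine (deconcat_kap k f hn).trans (Eq.symm ?_)
    have h1 : tensMap (kappaBar k I) (kappaBar k I) t s n ((koszul k I).Δ t s n (gen k t s n))
        = tensMap (kappaBar k I) (kappaBar k I) t s n (genΔ k t s n) :=
      congrArg _ (koszul_Δ_gen k f hn)
    refine h1.trans ?_
    unfold genΔ
    refine (map_sum (tensMap (kappaBar k I) (kappaBar k I) t s n) _ _).trans ?_
    refine Finset.sum_congr rfl fun C _ => ?_
    refine (map_unit_smul (tensMap (kappaBar k I) (kappaBar k I) t s n) _ _).trans ?_
    exact congrArg _ (tensMap_tmul (kappaBar k I) (kappaBar k I) _ _ _)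
  map_counit t x := by
    refine koszulGraph_hom_ext k
      (f := ((bar (treeCat k I)).counit t).comp (kappaBar k I t t 0))
      (g := (koszul k I).counit t) ?_ x
    intro _ _
    exact (treeBar_counit_kap k t).trans (koszulCocat_counit_gen k t).symm
  injective t s n := by
    refine (injective_iff_map_eq_zero (kappaBar k I t s n)).2 fun x hx => ?_
    by_cases h : Nonempty (t ⟶ s) ∧ ((t.contracted s).card : ℤ) = n
    · obtain ⟨r, rfl⟩ := exists_eq_smul_gen k x
      replace hx := (map_smul (kappaBar k I t s n) r _).symm.trans hx
      have h1 : r = 0 := (smul_eq_zero.1 hx).resolve_right (kap_ne_zero k h.1.some h.2)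
      rw [h1]
      exact zero_smul k _
    · exact (koszulGraph_subsingleton k h).elim _ _

theorem kappaBar_wedge {t s : ITree I} (f : t ⟶ s) {m : ℕ} (e : Fin m → Set I)
    (he : Function.Injective e) (himg : Finset.univ.image e = t.contracted s) :
    kappaBar k I t s m (wedge k t s e) = antisymmetrization k t s m rfl e := by
  rw [wedge_eq_smul_gen k e he himg]
  refine (map_unit_smul (kappaBar k I t s m) _ _).trans ?_
  exact (antisym_eq_smul_kap k f rfl e he himg).symm

theorem koszul_Δ_wedge {t s : ITree I} (f : t ⟶ s) {m : ℕ} (e : Fin m → Set I)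
    (he : Function.Injective e) (himg : Finset.univ.image e = t.contracted s) :
    (koszul k I).Δ t s m (wedge k t s e) = shuffleSum k t s m rfl e := by
  rw [shuffleSum_eq k rfl e he himg, wedge_eq_smul_gen k e he himg]
  refine (map_unit_smul ((koszul k I).Δ t s m) _ _).trans ?_
  refine congrArg _ (koszul_Δ_gen k f ?_)
  rw [← himg, Finset.card_image_of_injective _ he, Finset.card_univ, Fintype.card_fin]

end Kappa

section CobarKoszul

variable (k : Type u) [Field k] {I : Type v}

open ITree

/-! ### The cobar construction of `K` -/

/-- The graph of generators of the cobar construction of `K`. -/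
abbrev sK (I : Type v) : GrGraph k (ITree I) := shift (-1) (koszulGraph k)

/-- The desuspension of the generator of `K(t, s)`. It is zero unless `n + 1` edges are contracted
from `t` to `s` and `t ≠ s`. -/
def sgen (t s : ITree I) (n : ℤ) : sK k I t s n :=
  toShift (-1) (koszulGraph k) (m := n + 1) (by omega) (gen k t s (n + 1))

theorem toShift_gen {t s : ITree I} {m n : ℤ} (h : m + -1 = n) :
    toShift (-1) (koszulGraph k) h (gen k t s m) = sgen k t s n := by
  obtain rfl : m = n + 1 := by omega
  rfl

theorem sgen_eq_zero {t s : ITree I} (h : t = s) (n : ℤ) : sgen k t s n = 0 := by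
  subst h
  exact Subsingleton.elim _ _

theorem sgen_eq_zero_of_card {t s : ITree I} {n : ℤ} (h : ((t.contracted s).card : ℤ) ≠ n + 1) :
    sgen k t s n = 0 := by
  have := koszulGraph_subsingleton k (t := t) (s := s) (n := n + 1) fun h' => h h'.2
  unfold sgen
  rw [Subsingleton.elim (gen k t s (n + 1)) 0, map_zero]

/-- Linear maps out of the graph of generators agree when they agree on the generators. -/
theorem sK_hom_ext {t s : ITree I} {n : ℤ} {N : Type*} [AddCommGroup N] [Module k N]
    {f g : sK k I t s n →ₗ[k] N}
    (h : (t ⟶ s) → t ≠ s → ((t.contracted s).card : ℤ) = n + 1 →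
      f (sgen k t s n) = g (sgen k t s n)) (x : sK k I t s n) : f x = g x := by
  by_cases hts : t = s
  · subst hts
    rw [Subsingleton.elim x 0, map_zero, map_zero]
  · have h1 := koszulGraph_hom_ext k
      (f := f.comp (toShift (-1) (koszulGraph k) (m := n + 1) (by omega)))
      (g := g.comp (toShift (-1) (koszulGraph k) (m := n + 1) (by omega)))
      (fun hom hc => h hom hts hc) (ofShift (-1) (koszulGraph k) (m := n + 1) (by omega) x)
    rw [LinearMap.comp_apply, LinearMap.comp_apply, toShift_ofShift] at h1
    exact h1

theorem sK_subsingleton_of_not_lt (a b : ITree I) (n : ℤ) (hd : ¬ b.degree < a.degree) :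
    Subsingleton (sK k I a b n) :=
  shift_subsingleton_of (-1) _ fun h => koszulGraph_subsingleton_of_not_lt k h hd

theorem sK_subsingleton {a b : ITree I} {n : ℤ} (h : ¬ Nonempty (a ⟶ b)) :
    Subsingleton (sK k I a b n) :=
  shift_subsingleton_of (-1) _ fun _ => koszulGraph_subsingleton k fun h' => h h'.1

/-- The map out of `s⁻¹ K(t, s)` with a given value at the generator. -/
def sgenLift (t s : ITree I) (n : ℤ) {N : Type*} [AddCommGroup N] [Module k N] (y : N) :
    sK k I t s n →ₗ[k] N :=
  (koszulLift k t s (n + 1) fun _ _ e => sgn e • y).comp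
    (ofShift (-1) (koszulGraph k) (by omega))

theorem sgenLift_sgen {t s : ITree I} (f : t ⟶ s) (hts : t ≠ s) {n : ℤ}
    (hn : ((t.contracted s).card : ℤ) = n + 1) {N : Type*} [AddCommGroup N] [Module k N] (y : N) :
    sgenLift k t s n y (sgen k t s n) = y := by
  unfold sgenLift sgen
  rw [LinearMap.comp_apply, ofShift_toShift _ _ hts, koszulLift_gen k _ f hn, smul_smul,
    sgn_mul_self, one_smul]

/-- A word with two letters. -/
def pairWord {x y z : ITree I} {p q n : ℤ} (h : p + q = n) : free (sK k I) x z n :=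
  cons (sK k I) h (sgen k y z p) (letter (sK k I) (sgen k x y q))

theorem pairWord_congr {x y y' z : ITree I} {p q p' q' n : ℤ} (hy : y = y') (hq : q = q')
    (h : p + q = n) (h' : p' + q' = n) :
    pairWord k (x := x) (y := y) (z := z) h = pairWord k (y := y') h' := by
  subst hy hq
  obtain rfl : p = p' := by omega
  rfl

theorem pairWord_eq_zero_left {x y z : ITree I} {p q n : ℤ} (h : p + q = n) (hy : y = z) :
    pairWord k (x := x) (y := y) (z := z) h = 0 := by
  unfold pairWord
  rw [sgen_eq_zero k hy, map_zero, LinearMap.zero_apply]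

theorem pairWord_eq_zero_right {x y z : ITree I} {p q n : ℤ} (h : p + q = n) (hy : x = y) :
    pairWord k (x := x) (y := y) (z := z) h = 0 := by
  unfold pairWord
  rw [sgen_eq_zero k hy, map_zero, map_zero]

theorem smul_bilin_apply {M M' N : Type*} [AddCommGroup M] [AddCommGroup M'] [AddCommGroup N]
    [Module k M] [Module k M'] [Module k N] (u : ℤˣ) (B : M →ₗ[k] M' →ₗ[k] N) (x : M) (y : M') :
    (u • B) x y = u • B x y := rfl

/-- The differential of a generator of the cobar construction of `K`. -/
theorem cobarGen_sgen {t s : ITree I} (f : t ⟶ s) {i j : ℤ}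
    (hi : ((t.contracted s).card : ℤ) = i + 1) (h : j + 1 = i) :
    cobarGen (koszulCocat k I) t s i j h (sgen k t s i)
      = ∑ C ∈ (t.contracted s).powerset,
        (eps (t.contracted s \ C) C * (i - C.card).negOnePow) •
          pairWord k (y := t.contract C) (p := i - C.card) (q := C.card - 1) (by omega) := by
  by_cases hts : t = s
  · subst hts
    rw [sgen_eq_zero k rfl, map_zero, contracted_self, Finset.powerset_empty,
      Finset.sum_singleton, pairWord_eq_zero_left k _ (contract_empty t), smul_zero]
  · unfold cobarGen sgen
    rw [LinearMap.comp_apply, ofShift_toShift _ _ hts, LinearMap.add_apply, LinearMap.comp_apply,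
      koszulCocat_Δ_gen k f hi]
    have h0 : ∀ x, (-((letter (sK k I)).comp ((toShift (-1) (koszulGraph k) (m := j + 1)
        (n := j) (by omega)).comp (0 : koszulGraph k t s (i + 1) →ₗ[k] koszulGraph k t s (j + 1)))))
          x = 0 := by
      intro x
      rw [LinearMap.neg_apply, LinearMap.comp_apply, LinearMap.comp_apply, LinearMap.zero_apply,
        map_zero, map_zero, neg_zero]
    rw [h0, zero_add]
    unfold genΔ
    rw [map_sum]
    refine Finset.sum_congr rfl fun C _ => ?_
    rw [map_unit_smul, tensLift_tmul, smul_bilin_apply, mul_smul]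
    congr 1
    have hsign : (i + 1 - (C.card : ℤ) + 1).negOnePow = (i - C.card).negOnePow := by
      rw [show i + 1 - (C.card : ℤ) + 1 = i - C.card + 2 by ring, Int.negOnePow_add,
        Int.negOnePow_even 2 even_two, mul_one]
    rw [hsign, LinearMap.compl₁₂_apply, LinearMap.comp_apply, toShift_gen, toShift_gen]
    congr 1
    unfold pairWord
    have key : ∀ (p p' : ℤ) (h : p + (C.card - 1) = j) (h' : p' + (C.card - 1) = j),
        cons (sK k I) h (sgen k (t.contract C) s p) (letter (sK k I) (sgen k t (t.contract C) _))
        = cons (sK k I) h' (sgen k (t.contract C) s p') (letter (sK k I) (sgen k t _ _)) := by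
      intro p p' h h'
      obtain rfl : p = p' := by omega
      rfl
    exact key _ _ _ _

/-- The differential of the cobar construction of `K`. -/
def cobarD {t s : ITree I} {i j : ℤ} (h : j + 1 = i) :
    free (sK k I) t s i →ₗ[k] free (sK k I) t s j :=
  deriv (sK k I) (cobarGen (koszulCocat k I)) h

theorem cobarD_letter {t s : ITree I} {i j : ℤ} (h : j + 1 = i) (γ : sK k I t s i) :
    cobarD k h (letter (sK k I) γ) = cobarGen (koszulCocat k I) t s i j h γ :=
  deriv_letter _ h γ

theorem cobarD_cons {a b c : ITree I} {p q p' q' i j : ℤ} (h : p + q = i) (h' : j + 1 = i)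
    (hp : p' + 1 = p) (hq : q' + 1 = q) (h₁ : p' + q = j) (h₂ : p + q' = j) (γ : sK k I b c p)
    (w : free (sK k I) a b q) :
    cobarD k h' (cons (sK k I) h γ w)
      = concat (sK k I) h₁ (cobarGen (koszulCocat k I) b c p p' hp γ) w
        + p.negOnePow • cons (sK k I) h₂ γ (cobarD k hq w) :=
  deriv_cons _ h h' hp hq h₁ h₂ γ w

theorem cobarD_concat {a b c : ITree I} {p q p' q' i j : ℤ} (h : p + q = i) (h' : j + 1 = i)
    (hp : p' + 1 = p) (hq : q' + 1 = q) (h₁ : p' + q = j) (h₂ : p + q' = j)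
    (x : free (sK k I) b c p) (y : free (sK k I) a b q) :
    cobarD k h' (concat (sK k I) h x y)
      = concat (sK k I) h₁ (cobarD k hp x) y
        + p.negOnePow • concat (sK k I) h₂ x (cobarD k hq y) :=
  deriv_concat _ h h' hp hq h₁ h₂ x y

/-- A word with three letters. -/
def tripleWord {w x y z : ITree I} {p q r m n : ℤ} (h₁ : q + r = m) (h : p + m = n) :
    free (sK k I) w z n :=
  cons (sK k I) h (sgen k y z p) (pairWord k (x := w) (y := x) (z := y) h₁)

theorem tripleWord_congr {w x y x' y' z : ITree I} {p q r m p' q' r' m' n : ℤ} (hx : x = x')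
    (hy : y = y') (hq : q = q') (hr : r = r') (h₁ : q + r = m) (h : p + m = n)
    (h₁' : q' + r' = m') (h' : p' + m' = n) :
    tripleWord k (w := w) (x := x) (y := y) (z := z) h₁ h
      = tripleWord k (x := x') (y := y') h₁' h' := by
  subst hx hy hq hr h₁ h₁'
  obtain rfl : p = p' := by omega
  rfl

/-- The differential of the generators squares to zero because `K` is coassociative: the composites
of three generators cancel in pairs. -/
theorem cobarD_cobarGen_sgen {t s : ITree I} (f : t ⟶ s) {l m n : ℤ}
    (hl : ((t.contracted s).card : ℤ) = l + 1) (h : m + 1 = l) (h' : n + 1 = m) :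
    cobarD k h' (cobarGen (koszulCocat k I) t s l m h (sgen k t s l)) = 0 := by
  rw [cobarGen_sgen k f hl, map_sum]
  -- the two sums given by the derivation rule
  let T : Finset (Set I) → Finset (Set I) → free (sK k I) t s n := fun C D =>
    (eps (t.contracted s \ C) C * eps (C \ D) D * ((C.card : ℤ) - 1 - D.card).negOnePow) •
      tripleWord k (x := t.contract D) (y := t.contract C) (p := l - C.card)
        (q := C.card - 1 - D.card) (r := D.card - 1) (m := C.card - 1 - 1) (by omega) (by omega)
  let S : Finset (Set I) → Finset (Set I) → free (sK k I) t s n := fun C D =>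
    (eps (t.contracted s \ C) C * eps ((t.contracted s \ C) \ D) D * (D.card : ℤ).negOnePow) •
      tripleWord k (x := t.contract C) (y := (t.contract C).contract D)
        (p := l - C.card - D.card) (q := D.card - 1) (r := C.card - 1) rfl (by omega)
  have key : ∀ C ∈ (t.contracted s).powerset,
      cobarD k h' ((eps (t.contracted s \ C) C * (l - C.card).negOnePow) •
          pairWord k (x := t) (y := t.contract C) (z := s) (p := l - C.card) (q := C.card - 1)
            (n := m) (by omega))
        = ∑ D ∈ (t.contracted s \ C).powerset, S C D + ∑ D ∈ C.powerset, T C D := by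
    intro C hC
    have hC' := Finset.mem_powerset.1 hC
    have hcard : ((t.contracted s \ C).card : ℤ) = l - C.card + 1 := by
      rw [Finset.card_sdiff_of_subset hC', Nat.cast_sub (Finset.card_le_card hC'), hl]
      ring
    rw [map_unit_smul]
    unfold pairWord
    rw [cobarD_cons k (p' := l - C.card - 1) (q' := C.card - 1 - 1) _ _ (by omega) (by omega)
      (by omega) (by omega), cobarD_letter,
      cobarGen_sgen k (contract_hom f hC').some (by rw [contracted_contract_left, hcard]),
      cobarGen_sgen k (hom_contract t C).some (by rw [contracted_contract_right t s hC']; ring),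
      contracted_contract_left, contracted_contract_right t s hC', map_sum, map_sum,
      LinearMap.sum_apply, smul_add, Finset.smul_sum, Finset.smul_sum, Finset.smul_sum]
    congr 1
    · refine Finset.sum_congr rfl fun D _ => ?_
      rw [map_unit_smul₂, smul_smul]
      unfold pairWord
      rw [cons_concat (sK k I) (l := D.card - 1 + (C.card - 1)) _ _ rfl (by omega)]
      simp only [S]
      congr 1
      · rw [mul_mul_mul_comm]
        congr 1
        rw [← Int.negOnePow_add, show l - (C.card : ℤ) + (l - C.card - D.card)
          = D.card + 2 * (l - C.card - D.card) by ring, Int.negOnePow_add, Int.negOnePow_two_mul,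
          mul_one]
      · unfold tripleWord
        rw [letter_concat]
        rfl
    · refine Finset.sum_congr rfl fun D _ => ?_
      rw [map_unit_smul, smul_smul, smul_smul]
      simp only [T]
      congr 1
      · rw [mul_assoc, mul_assoc, ← mul_assoc (l - (C.card : ℤ)).negOnePow, Int.units_mul_self,
          one_mul, ← mul_assoc]
  rw [Finset.sum_congr rfl key, Finset.sum_add_distrib, Finset.sum_sigma', Finset.sum_sigma',
    add_eq_zero_iff_eq_neg, ← Finset.sum_neg_distrib]
  -- the edges of `C` are contracted first, and those of `D` next
  refine Finset.sum_nbij' (fun x => ⟨x.1 ∪ x.2, x.1⟩) (fun x => ⟨x.2, x.1 \ x.2⟩) ?_ ?_ ?_ ?_ ?_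
  · rintro ⟨C, D⟩ h
    simp only [Finset.mem_sigma, Finset.mem_powerset] at h ⊢
    exact ⟨Finset.union_subset h.1 (h.2.trans Finset.sdiff_subset), Finset.subset_union_left⟩
  · rintro ⟨C, D⟩ h
    simp only [Finset.mem_sigma, Finset.mem_powerset] at h ⊢
    exact ⟨h.2.trans h.1, Finset.sdiff_subset_sdiff h.1 subset_rfl⟩
  · rintro ⟨C, D⟩ h
    simp only [Finset.mem_sigma, Finset.mem_powerset] at h ⊢
    have : Disjoint D C := Finset.disjoint_of_subset_left h.2 Finset.sdiff_disjoint
    rw [Finset.union_sdiff_left, Finset.sdiff_eq_self_of_disjoint this]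
  · rintro ⟨C, D⟩ h
    simp only [Finset.mem_sigma, Finset.mem_powerset] at h ⊢
    rw [Finset.union_sdiff_of_subset h.2]
  · rintro ⟨C, D⟩ h
    simp only [Finset.mem_sigma, Finset.mem_powerset] at h ⊢
    have hdisj : Disjoint D C := Finset.disjoint_of_subset_left h.2 Finset.sdiff_disjoint
    have hcard : (C ∪ D).card = C.card + D.card := Finset.card_union_of_disjoint hdisj.symm
    have hCD : (C ∪ D) \ C = D := by
      rw [Finset.union_sdiff_left, Finset.sdiff_eq_self_of_disjoint hdisj]
    have hsplit : t.contracted s \ C = ((t.contracted s \ C) \ D) ∪ D :=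
      (Finset.sdiff_union_of_subset h.2).symm
    have hXY : t.contracted s \ (C ∪ D) = (t.contracted s \ C) \ D := by
      rw [sdiff_sdiff_left]
      rfl
    have h1 : eps (t.contracted s \ C) C = eps ((t.contracted s \ C) \ D) C * eps D C := by
      conv_lhs => rw [hsplit]
      rw [eps_union_left Finset.sdiff_disjoint]
    simp only [S, T]
    rw [tripleWord_congr k (x' := t.contract C) (y' := t.contract (C ∪ D))
      (p' := l - (C ∪ D).card) (q' := (C ∪ D).card - 1 - C.card) (r' := C.card - 1)
      (m' := (C ∪ D).card - 1 - 1) rfl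
      (contract_contract t C D) (by rw [hcard]; push_cast; ring) rfl _ _ (by omega) (by omega),
      hXY, hCD, h1, eps_union_right _ hdisj.symm, ← Units.neg_smul]
    congr 1
    rw [show ((C ∪ D).card : ℤ) - 1 - C.card = D.card - 1 by rw [hcard]; push_cast; ring,
      Int.negOnePow_sub, Int.negOnePow_one]
    simp only [mul_neg, mul_one, neg_neg]
    congr 1
    rw [mul_right_comm]

theorem cobarD_cobarGen {t s : ITree I} {l m n : ℤ} (h : m + 1 = l) (h' : n + 1 = m)
    (γ : sK k I t s l) : cobarD k h' (cobarGen (koszulCocat k I) t s l m h γ) = 0 := by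
  refine sK_hom_ext k
    (f := (cobarD k h').comp (cobarGen (koszulCocat k I) t s l m h)) (g := 0) ?_ γ
  intro f _ hl
  exact cobarD_cobarGen_sgen k f hl h h'

/-- The cobar construction of `K`, with its graph given explicitly. -/
abbrev cobarCat (I : Type v) : CatData k (ITree I) :=
  freeCat (sK k I) (cobarGen (koszulCocat k I))

theorem cobarCat_isDGCategory : (cobarCat k I).IsDGCategory :=
  freeCat_isDGCategory _ _ fun _ _ _ _ _ h h' γ => cobarD_cobarGen k h h' γ

theorem cobarCat_isConnected : (cobarCat k I).IsConnected ITree.degree :=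
  freeCat_isConnected (sK_subsingleton_of_not_lt k) _

end CobarKoszul

section LiftDeriv

variable {k : Type u} [Field k] {Ob : Type v}

/-! ### Functors out of a free differential graded category -/

theorem CatData.IsDGCategory.d_one {C : CatData k Ob} (hC : C.IsDGCategory) (a : Ob) {n : ℤ}
    (h : n + 1 = 0) : C.d a a h (C.one a) = 0 := by
  have h1 := hC.leibniz a a a 0 0 0 n n n (zero_add 0) h h h (add_zero n) (zero_add n)
    (C.one a) (C.one a)
  rw [hC.comp_one, hC.comp_one, hC.one_comp, Int.negOnePow_zero, one_smul] at h1
  exact left_eq_add.1 h1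

/-- A functor out of a free category is compatible with the differentials when it is so on the
generators. -/
theorem lift_deriv {C : CatData k Ob} (hC : C.IsDGCategory) {Γ : GrGraph k Ob}
    (φ : GrGraph.Hom Γ C.X) (δ : ∀ (a b : Ob) (i j : ℤ), j + 1 = i → Γ a b i →ₗ[k] free Γ a b j)
    (hδ : ∀ (a b : Ob) (i j : ℤ) (h : j + 1 = i) (γ : Γ a b i),
      C.lift φ a b j (δ a b i j h γ) = C.d a b h (φ a b i γ)) {a b : Ob} {i j : ℤ} (h : j + 1 = i)
    (x : free Γ a b i) :
    C.lift φ a b j (deriv Γ δ h x) = C.d a b h (C.lift φ a b i x) := by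
  induction a, b, i, x using free_induction generalizing j with
  | zero => simp only [map_zero]
  | add a c n x y hx hy => simp only [map_add, hx, hy]
  | smul_one a r =>
    rw [map_smul, GrGraph.deriv_one, map_smul, map_smul, map_smul, lift_one, hC.d_one, map_zero]
  | cons a b c p q n h' γ w ih =>
    rw [deriv_cons δ (p' := p - 1) (q' := q - 1) h' h (by omega) (by omega) (by omega) (by omega),
      map_add, map_unit_smul, lift_concat C hC, lift_cons, lift_cons, hδ, ih,
      hC.leibniz _ _ _ _ _ _ (p - 1) (q - 1) j h' (by omega) (by omega) h (by omega) (by omega)]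

/-- The category obtained from `C` by changing the set of objects along a map. -/
abbrev pullCat (C : CatData k Ob) (φ : Ob → Ob) : CatData k Ob where
  X a b n := C.X (φ a) (φ b) n
  d a b _ _ h := C.d (φ a) (φ b) h
  one a := C.one (φ a)
  comp h := C.comp h

theorem pullCat_isDGCategory {C : CatData k Ob} (hC : C.IsDGCategory) (φ : Ob → Ob) :
    (pullCat C φ).IsDGCategory where
  d_d _ _ l m n h h' x := hC.d_d _ _ l m n h h' x
  assoc _ _ _ _ p q r pq qr n hpq hqr h h' x y z :=
    hC.assoc _ _ _ _ p q r pq qr n hpq hqr h h' x y z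
  one_comp _ _ n x := hC.one_comp _ _ n x
  comp_one _ _ n x := hC.comp_one _ _ n x
  leibniz _ _ _ p q n p' q' n' h hp hq hn h₁ h₂ x y :=
    hC.leibniz _ _ _ p q n p' q' n' h hp hq hn h₁ h₂ x y

end LiftDeriv

section ContractionHomotopy

variable (k : Type u) [Field k] {I : Type v}

open ITree

/-! ### The contraction of an edge, and a homotopy -/

/-- The empty word if `t = s` and `n = 0`, and zero otherwise. -/
def emptyWord (t s : ITree I) (n : ℤ) : free (sK k I) t s n :=
  if h : t = s ∧ 0 = n then (free (sK k I)).cast rfl h.1 h.2 (GrGraph.one (sK k I) t) else 0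

/-- The generator of the cobar construction in `(t, s)`, where the identity is taken for the
generator if `t = s`. -/
def ugen (t s : ITree I) (n : ℤ) : free (sK k I) t s n :=
  letter (sK k I) (sgen k t s n) + emptyWord k t s n

theorem ugen_self (t : ITree I) : ugen k t t 0 = GrGraph.one (sK k I) t := by
  unfold ugen
  rw [sgen_eq_zero k rfl, map_zero, zero_add]
  exact dif_pos ⟨rfl, rfl⟩

theorem ugen_of_ne {t s : ITree I} {n : ℤ} (h : ¬ (t = s ∧ 0 = n)) :
    ugen k t s n = letter (sK k I) (sgen k t s n) := by
  unfold ugen emptyWord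
  rw [dif_neg h, add_zero]

variable (e : Set I)

/-- The images of the generators under the contraction of the edge `e`: the generator of a set of
edges `A` goes to the generator of `A` if `e ∉ A`, to the identity if `A = {e}`, and to zero
otherwise. -/
def contractGen (b c : ITree I) (n : ℤ) :
    sK k I b c n →ₗ[k] free (sK k I) (b.contract {e}) (c.contract {e}) n :=
  sgenLift k b c n (ugen k (b.contract {e}) (c.contract {e}) n)

/-- The functor of contraction of the edge `e`. -/
def contractMap {t s : ITree I} {n : ℤ} :
    free (sK k I) t s n →ₗ[k] free (sK k I) (t.contract {e}) (s.contract {e}) n :=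
  (pullCat (cobarCat k I) fun t => t.contract {e}).lift (fun b c n => contractGen k e b c n) t s n

theorem contractGen_sgen {b c : ITree I} (f : b ⟶ c) (hbc : b ≠ c) {n : ℤ}
    (hn : ((b.contracted c).card : ℤ) = n + 1) :
    contractGen k e b c n (sgen k b c n) = ugen k (b.contract {e}) (c.contract {e}) n :=
  sgenLift_sgen k f hbc hn _

theorem contractMap_one (t : ITree I) :
    contractMap k e (GrGraph.one (sK k I) t) = GrGraph.one (sK k I) (t.contract {e}) :=
  lift_one _ _ t

theorem contractMap_cons {a b c : ITree I} {p q n : ℤ} (h : p + q = n) (γ : sK k I b c p)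
    (w : free (sK k I) a b q) :
    contractMap k e (cons (sK k I) h γ w)
      = concat (sK k I) h (contractGen k e b c p γ) (contractMap k e w) :=
  lift_cons _ _ h γ w

theorem contractMap_letter {a b : ITree I} {n : ℤ} (γ : sK k I a b n) :
    contractMap k e (letter (sK k I) γ) = contractGen k e a b n γ :=
  lift_letter _ (pullCat_isDGCategory (cobarCat_isDGCategory k) _) _ γ

/-- The homotopy on the generators: adjoining the edge `e` to the set of contracted edges. It
vanishes if `e` is not an edge of `c`, since there is then no generator in `(b, c)` of the higher
degree. -/
def homotopyGen (b c : ITree I) {n n' : ℤ} (_ : n + 1 = n') :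
    sK k I b c n →ₗ[k] free (sK k I) b (c.contract {e}) n' :=
  sgenLift k b c n
    (eps {e} (b.contracted c) • letter (sK k I) (sgen k b (c.contract {e}) n'))

theorem homotopyGen_sgen {b c : ITree I} (f : b ⟶ c) (hbc : b ≠ c) {n n' : ℤ} (h : n + 1 = n')
    (hn : ((b.contracted c).card : ℤ) = n + 1) :
    homotopyGen k e b c h (sgen k b c n)
      = eps {e} (b.contracted c) • letter (sK k I) (sgen k b (c.contract {e}) n') :=
  sgenLift_sgen k f hbc hn _

/-- The homotopy on the words of length `m`. -/
def homotopyWord : ∀ (m : ℕ) {a c : ITree I} {n n' : ℤ}, n + 1 = n' →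
    (word (sK k I) m a c n →ₗ[k] free (sK k I) a (c.contract {e}) n')
  | 0, _, _, _, _, _ => 0
  | m + 1, a, c, _, _, h =>
    wordSuccLift (sK k I) m fun b p q h' =>
      (concat (sK k I) (p := p + 1) (q := q) (by omega)).compl₁₂ (homotopyGen k e b c rfl)
          (incl (sK k I) m a b q)
        + p.negOnePow • (concat (sK k I) (p := p) (q := q + 1) (by omega)).compl₁₂
          (contractGen k e b c p) (homotopyWord m rfl)

/-- The homotopy between the composition with the contraction of the edge `e` after a morphism and
the composition with it before the contracted morphism. -/
def homotopy {a c : ITree I} {n n' : ℤ} (h : n + 1 = n') :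
    free (sK k I) a c n →ₗ[k] free (sK k I) a (c.contract {e}) n' :=
  freeLift (sK k I) fun m => homotopyWord k e m h

theorem homotopy_one (a : ITree I) {n' : ℤ} (h : 0 + 1 = n') :
    homotopy k e h (GrGraph.one (sK k I) a) = 0 := by
  unfold homotopy GrGraph.one
  rw [freeLift_incl]
  rfl

theorem homotopy_cons {a b c : ITree I} {p q n p' q' n' : ℤ} (h : p + q = n) (hn : n + 1 = n')
    (hp : p + 1 = p') (hq : q + 1 = q') (h₁ : p' + q = n') (h₂ : p + q' = n')
    (γ : sK k I b c p) (w : free (sK k I) a b q) :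
    homotopy k e hn (cons (sK k I) h γ w)
      = concat (sK k I) h₁ (homotopyGen k e b c hp γ) w
        + p.negOnePow • concat (sK k I) h₂ (contractGen k e b c p γ) (homotopy k e hq w) := by
  subst hp hq
  induction w using free_induction_incl with
  | zero => simp only [map_zero, smul_zero, add_zero]
  | add x y hx hy =>
    simp only [map_add, hx, hy, smul_add]
    abel
  | incl m w =>
    unfold homotopy
    rw [cons_incl, freeLift_incl, freeLift_incl]
    exact wordSuccLift_cons (sK k I) m _ h γ w

theorem homotopy_letter {b c : ITree I} {n n' : ℤ} (h : n + 1 = n') (γ : sK k I b c n) :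
    homotopy k e h (letter (sK k I) γ) = homotopyGen k e b c h γ := by
  unfold letter
  rw [LinearMap.flip_apply, homotopy_cons k e (q' := 1) _ _ h rfl (by omega) (by omega),
    homotopy_one, map_zero, smul_zero, add_zero, concat_one]

/-- The homotopy is a derivation with respect to the contraction of `e` on the left and to the
identity on the right. -/
theorem homotopy_concat {a b c : ITree I} {p q n p' q' n' : ℤ} (h : p + q = n) (hn : n + 1 = n')
    (hp : p + 1 = p') (hq : q + 1 = q') (h₁ : p' + q = n') (h₂ : p + q' = n')
    (x : free (sK k I) b c p) (y : free (sK k I) a b q) :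
    homotopy k e hn (concat (sK k I) h x y)
      = concat (sK k I) h₁ (homotopy k e hp x) y
        + p.negOnePow • concat (sK k I) h₂ (contractMap k e x) (homotopy k e hq y) := by
  induction b, c, p, x using free_induction generalizing p' n n' with
  | zero => simp only [map_zero, LinearMap.zero_apply, smul_zero, add_zero]
  | add b c p x x' hx hx' =>
    simp only [map_add, LinearMap.add_apply, smul_add]
    rw [hx h hn hp h₁ h₂, hx' h hn hp h₁ h₂]
    abel
  | smul_one b r =>
    obtain rfl : n = q := by omega
    obtain rfl : n' = q' := by omega
    simp only [map_smul, LinearMap.smul_apply, homotopy_one, map_zero, LinearMap.zero_apply,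
      smul_zero, zero_add, contractMap_one, one_concat, Int.negOnePow_zero, one_smul]
    rfl
  | cons b b₁ c p₁ p₂ p h' γ w ih =>
    rw [cons_concat (sK k I) (l := p₂ + q) h' h rfl (by omega),
      homotopy_cons k e (p' := p₁ + 1) (q' := p₂ + q + 1) _ hn rfl rfl (by omega) (by omega),
      homotopy_cons k e (p' := p₁ + 1) (q' := p₂ + 1) h' hp rfl rfl (by omega) (by omega),
      ih (p' := p₂ + 1) (n := p₂ + q) rfl rfl rfl (by omega) (by omega), contractMap_cons]
    simp only [map_add, LinearMap.add_apply, map_unit_smul₂, smul_add]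
    simp only [map_unit_smul, smul_smul]
    rw [concat_assoc (sK k I) (qr := p₂ + q) _ rfl _ (by omega),
      concat_assoc (sK k I) (qr := p₂ + q + 1) _ (by omega) _ (by omega),
      concat_assoc (sK k I) (qr := p₂ + q + 1) _ (by omega) _ (by omega),
      show p.negOnePow = p₁.negOnePow * p₂.negOnePow by rw [← h', Int.negOnePow_add]]
    exact Eq.symm (add_assoc _ _ _)

end ContractionHomotopy

/-! ### Compatibility of the contraction of an edge with the differential -/

namespace ITree

variable {I : Type v}

theorem contracted_contract_contract (t s : ITree I) (e : Set I) :
    contracted (t.contract {e}) (s.contract {e}) = (contracted t s).erase e := by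
  unfold contracted
  rw [edges_contract, edges_contract]
  ext x
  simp only [Finset.mem_sdiff, Finset.mem_singleton, Finset.mem_erase]
  tauto

theorem hom_contract_contract {t s : ITree I} (f : t ⟶ s) (e : Set I) :
    Nonempty (t.contract {e} ⟶ s.contract {e}) := by
  have h : s.contract {e} = (t.contract {e}).contract (contracted t s) := by
    rw [contract_contract_comm, contract_contracted f]
  rw [h]
  exact hom_contract _ _

theorem contracted_contract_singleton {t s : ITree I} (f : t ⟶ s) {e : Set I} (he : e ∈ s.edges) :
    contracted t (s.contract {e}) = insert e (contracted t s) := by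
  unfold contracted
  rw [edges_contract]
  ext x
  simp only [Finset.mem_sdiff, Finset.mem_singleton, Finset.mem_insert]
  have := hom_edges_subset f he
  by_cases hx : x = e
  · subst hx
    tauto
  · tauto

theorem contract_singleton_ne {t : ITree I} {e : Set I} (he : e ∈ t.edges) :
    t ≠ t.contract {e} := by
  intro h
  rw [h, edges_contract] at he
  simp at he

theorem contracted_nonempty {t s : ITree I} (f : t ⟶ s) (h : t ≠ s) : (contracted t s).Nonempty :=
  Finset.nonempty_iff_ne_empty.2 fun h' => h (eq_of_contracted_eq_empty f h')

theorem ne_of_mem_contracted {t s : ITree I} {e : Set I} (he : e ∈ contracted t s) : t ≠ s := by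
  rintro rfl
  simp at he

end ITree

section Homotopy

variable (k : Type u) [Field k] {I : Type v} {e : Set I}

open ITree

theorem ugen_of_eq {t s : ITree I} (h : t = s) (n : ℤ) : ugen k t s n = emptyWord k t s n := by
  unfold ugen
  rw [sgen_eq_zero k h, map_zero, zero_add]

theorem cobarD_emptyWord {t s : ITree I} {n n' : ℤ} (h : n' + 1 = n) :
    cobarD k h (emptyWord k t s n) = 0 := by
  unfold emptyWord
  split_ifs with h'
  · obtain ⟨rfl, rfl⟩ := h'
    exact GrGraph.deriv_one _ h
  · exact map_zero _

theorem emptyWord_concat_letter {a b c : ITree I} {p q n : ℤ} (hbc : b = c) (hp : p = 0)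
    (h : p + q = n) : concat (sK k I) h (emptyWord k b c p) (letter (sK k I) (sgen k a b q))
      = letter (sK k I) (sgen k a c n) := by
  subst hbc hp
  obtain rfl : q = n := by omega
  rw [← ugen_of_eq k rfl, ugen_self, one_concat]
  rfl

theorem letter_concat_emptyWord {a b c : ITree I} {p q n : ℤ} (hab : a = b) (hq : q = 0)
    (h : p + q = n) : concat (sK k I) h (letter (sK k I) (sgen k b c p)) (emptyWord k a b q)
      = letter (sK k I) (sgen k a c n) := by
  subst hab hq
  obtain rfl : p = n := by omega
  rw [← ugen_of_eq k rfl, ugen_self, concat_one]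

theorem letter_concat_letter {a b c : ITree I} {p q n : ℤ} (h : p + q = n) :
    concat (sK k I) h (letter (sK k I) (sgen k b c p)) (letter (sK k I) (sgen k a b q))
      = pairWord k (y := b) h := letter_concat _ _ _ _

theorem contractGen_sgen_of_notMem {b c : ITree I} (f : b ⟶ c) (he : e ∉ b.contracted c) (n : ℤ) :
    contractGen k e b c n (sgen k b c n)
      = letter (sK k I) (sgen k (b.contract {e}) (c.contract {e}) n) := by
  have hA : contracted (b.contract {e}) (c.contract {e}) = b.contracted c := by
    rw [contracted_contract_contract, Finset.erase_eq_of_notMem he]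
  by_cases hbc : b = c
  · rw [sgen_eq_zero k hbc, map_zero, sgen_eq_zero k (by rw [hbc]), map_zero]
  · by_cases hn : ((b.contracted c).card : ℤ) = n + 1
    · rw [contractGen_sgen k e f hbc hn, ugen_of_ne]
      rintro ⟨h, _⟩
      rw [h, contracted_self] at hA
      exact (contracted_nonempty f hbc).ne_empty hA.symm
    · rw [sgen_eq_zero_of_card k hn, map_zero, sgen_eq_zero_of_card k (by rwa [hA]), map_zero]

theorem contractGen_sgen_of_mem {b c : ITree I} (f : b ⟶ c) (he : e ∈ b.contracted c) {n : ℤ}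
    (hn : ((b.contracted c).card : ℤ) = n + 1) :
    contractGen k e b c n (sgen k b c n) = emptyWord k (b.contract {e}) (c.contract {e}) n := by
  rw [contractGen_sgen k e f (ne_of_mem_contracted he) hn]
  unfold ugen
  rw [sgen_eq_zero_of_card, map_zero, zero_add]
  rw [contracted_contract_contract, Finset.card_erase_of_mem he,
    Nat.cast_sub (Finset.card_pos.2 ⟨e, he⟩)]
  push_cast
  omega

/-- The contraction of `e` kills the generators of positive degree that involve `e`. -/
theorem contractGen_sgen_eq_zero {b c : ITree I} (f : b ⟶ c) (he : e ∈ b.contracted c)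
    (hne : b.contracted c ≠ {e}) (n : ℤ) : contractGen k e b c n (sgen k b c n) = 0 := by
  by_cases hn : ((b.contracted c).card : ℤ) = n + 1
  · rw [contractGen_sgen_of_mem k f he hn]
    unfold emptyWord
    rw [dif_neg]
    rintro ⟨_, rfl⟩
    obtain ⟨x, hx⟩ := Finset.card_eq_one.1 (show (b.contracted c).card = 1 by omega)
    rw [hx, Finset.mem_singleton] at he
    exact hne (by rw [hx, he])
  · rw [sgen_eq_zero_of_card k hn, map_zero]

theorem contractMap_pairWord {x y z : ITree I} {p q n : ℤ} (h : p + q = n) :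
    contractMap k e (pairWord k (x := x) (y := y) (z := z) h)
      = concat (sK k I) h (contractGen k e y z p (sgen k y z p))
        (contractGen k e x y q (sgen k x y q)) := by
  unfold pairWord
  rw [contractMap_cons, contractMap_letter]

theorem erase_sdiff_self {A : Finset (Set I)} (he : e ∈ A) : A \ A.erase e = {e} := by
  ext x
  simp only [Finset.mem_sdiff, Finset.mem_erase, Finset.mem_singleton]
  constructor
  · tauto
  · rintro rfl
    tauto

/-- If `e` is contracted from `b` to `c`, the image of the generator has zero differential, and in
the differential of the generator only the two terms that split off `e` alone have a nonzero image;
otherwise the terms correspond to each other. -/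
theorem contractMap_cobarGen_sgen {b c : ITree I} (f : b ⟶ c) {i j : ℤ}
    (hi : ((b.contracted c).card : ℤ) = i + 1) (h : j + 1 = i) :
    contractMap k e (cobarGen (koszulCocat k I) b c i j h (sgen k b c i))
      = cobarD k h (contractGen k e b c i (sgen k b c i)) := by
  rw [cobarGen_sgen k f hi, map_sum]
  by_cases he : e ∈ b.contracted c
  · rw [contractGen_sgen_of_mem k f he hi, cobarD_emptyWord]
    have hce : c.contract {e} = c := contract_eq_self (Finset.mem_sdiff.1 he).2
    let B := (b.contracted c).erase e
    have hA : b.contracted c = insert e B := (Finset.insert_erase he).symm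
    have heB : e ∉ B := Finset.notMem_erase _ _
    have hBA : B ⊆ b.contracted c := Finset.erase_subset _ _
    have hAB : b.contracted c \ B = {e} := erase_sdiff_self he
    have heA : {e} ⊆ b.contracted c := Finset.singleton_subset_iff.2 he
    have hBe : b.contracted c \ {e} = B := Finset.sdiff_singleton_eq_erase _ _
    have hBcard : (B.card : ℤ) = i := by
      have h1 := Finset.card_erase_add_one he
      have h2 : (B.card : ℤ) + 1 = (b.contracted c).card := by exact_mod_cast h1
      omega
    have h1 : b.contracted (b.contract B) = B := contracted_contract_right b c hBA
    have h2 : b.contracted (b.contract {e}) = {e} := contracted_contract_right b c heA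
    have h3 : (b.contract B).contracted c = {e} := by rw [contracted_contract_left, hAB]
    have h4 : (b.contract {e}).contracted c = B := by rw [contracted_contract_left, hBe]
    obtain ⟨f1⟩ := contract_hom f hBA
    obtain ⟨f2⟩ := contract_hom f heA
    -- only two terms involve the generator of the single edge `e`, and they cancel
    rw [Finset.sum_congr (congrArg Finset.powerset hA) fun _ _ => rfl,
      Finset.sum_powerset_insert heB, Finset.sum_eq_single B, Finset.sum_eq_single ∅]
    · have h5 : contractMap k e (pairWord k (x := b) (y := b.contract B) (z := c)
          (p := i - B.card) (q := B.card - 1) (n := j) (by omega))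
          = letter (sK k I) (sgen k (b.contract {e}) (c.contract {e}) j) := by
        rw [contractMap_pairWord, contractGen_sgen_of_mem k f1 (by rw [h3]; simp)
          (by rw [h3, hBcard]; simp),
          contractGen_sgen_of_notMem k (hom_contract b B).some (by rwa [h1]),
          emptyWord_concat_letter k _ (by omega)]
        rw [contract_contract, hce, Finset.union_comm, ← Finset.insert_eq, ← hA,
          contract_contracted f]
      have h6 : contractMap k e (pairWord k (x := b) (y := b.contract {e}) (z := c)
          (p := i - ({e} : Finset (Set I)).card) (q := ({e} : Finset (Set I)).card - 1) (n := j)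
          (by omega)) = letter (sK k I) (sgen k (b.contract {e}) (c.contract {e}) j) := by
        rw [contractMap_pairWord, contractGen_sgen_of_notMem k f2 (by rwa [h4]),
          contractGen_sgen_of_mem k (hom_contract b {e}).some (by rw [h2]; simp)
            (by rw [h2]; simp), letter_concat_emptyWord k _ (by simp)]
        rw [contract_contract, Finset.union_self]
      have h7 : eps B {e} * (i - 1).negOnePow = -eps {e} B := by
        rw [eps_singleton_right heB, hBcard, Int.negOnePow_sub, Int.negOnePow_one]
        rcases Int.units_eq_one_or i.negOnePow with h | h <;> rw [h] <;> simp
      rw [map_unit_smul, map_unit_smul, h5, insert_empty_eq, h6, hAB, hBe, hBcard, sub_self,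
        Int.negOnePow_zero, mul_one, Finset.card_singleton, Nat.cast_one, h7, Units.neg_smul,
        add_neg_cancel]
    · intro C hC hne
      have hC' := Finset.mem_powerset.1 hC
      have heC : e ∉ C := fun h => heB (hC' h)
      have h5 : (b.contract (insert e C)).contracted c ⊆ b.contracted c := by
        rw [contracted_contract_left]
        exact Finset.sdiff_subset
      have h6 : b.contracted (b.contract (insert e C)) = insert e C :=
        contracted_contract_right b c (Finset.insert_subset he (hC'.trans hBA))
      rw [map_unit_smul, contractMap_pairWord,
        contractGen_sgen_eq_zero k (b := b) (hom_contract b _).some (by rw [h6]; simp),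
        map_zero, smul_zero]
      rw [h6]
      intro h7
      obtain ⟨x, hx⟩ := Finset.nonempty_iff_ne_empty.2 hne
      have h8 : x ∈ ({e} : Finset (Set I)) := h7 ▸ Finset.mem_insert_of_mem hx
      exact heC (Finset.mem_singleton.1 h8 ▸ hx)
    · intro h5
      exact absurd (Finset.empty_mem_powerset _) h5
    · intro C hC hne
      have hC' := Finset.mem_powerset.1 hC
      have heC : e ∉ C := fun h => heB (hC' h)
      obtain ⟨f3⟩ := contract_hom f (hC'.trans hBA)
      rw [map_unit_smul, contractMap_pairWord, contractGen_sgen_eq_zero k f3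
        (by rw [contracted_contract_left]; exact Finset.mem_sdiff.2 ⟨he, heC⟩), map_zero,
        LinearMap.zero_apply, smul_zero]
      rw [contracted_contract_left]
      intro h5
      refine hne ?_
      rw [← Finset.sdiff_sdiff_eq_self (hC'.trans hBA), h5, hBe]
    · intro h5
      exact absurd (Finset.mem_powerset_self _) h5
  · have hA : contracted (b.contract {e}) (c.contract {e}) = b.contracted c := by
      rw [contracted_contract_contract, Finset.erase_eq_of_notMem he]
    rw [contractGen_sgen_of_notMem k f he, cobarD_letter,
      cobarGen_sgen k (hom_contract_contract f e).some (by rw [hA, hi]), hA]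
    refine Finset.sum_congr rfl fun C hC => ?_
    have hC' := Finset.mem_powerset.1 hC
    have h1 : b.contracted (b.contract C) = C := contracted_contract_right b c hC'
    rw [map_unit_smul, contractMap_pairWord,
      contractGen_sgen_of_notMem k (contract_hom f hC').some
        (by rw [contracted_contract_left]; exact fun h => he (Finset.mem_sdiff.1 h).1),
      contractGen_sgen_of_notMem k (hom_contract b C).some (by rw [h1]; exact fun h => he (hC' h)),
      letter_concat_letter, pairWord_congr k (contract_contract_comm b C {e}) rfl]

/-- The contraction of `e` is a differential graded functor. -/
theorem contractMap_cobarD {b c : ITree I} {i j : ℤ} (h : j + 1 = i)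
    (x : free (sK k I) b c i) :
    contractMap k e (cobarD k h x) = cobarD k h (contractMap k e x) := by
  refine lift_deriv (C := pullCat (cobarCat k I) fun t => t.contract {e})
    (pullCat_isDGCategory (cobarCat_isDGCategory k) _) (fun b c n => contractGen k e b c n)
    (cobarGen (koszulCocat k I)) ?_ h x
  intro a b i j h γ
  refine sK_hom_ext k
    (f := (contractMap k e).comp (cobarGen (koszulCocat k I) a b i j h))
    (g := (cobarD k h).comp (contractGen k e a b i)) ?_ γ
  intro f _ hi
  exact contractMap_cobarGen_sgen k f hi h

/-! ### The homotopy on the generators -/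

theorem homotopyGen_sgen_of_mem {b c : ITree I} (f : b ⟶ c) (hbc : b ≠ c) (he : e ∈ c.edges)
    {n n' : ℤ} (h : n + 1 = n') :
    homotopyGen k e b c h (sgen k b c n)
      = eps {e} (b.contracted c) • letter (sK k I) (sgen k b (c.contract {e}) n') := by
  by_cases hn : ((b.contracted c).card : ℤ) = n + 1
  · exact homotopyGen_sgen k e f hbc h hn
  · rw [sgen_eq_zero_of_card k hn, map_zero, sgen_eq_zero_of_card, map_zero, smul_zero]
    have heA : e ∉ b.contracted c := fun h' => (Finset.mem_sdiff.1 h').2 he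
    rw [contracted_contract_singleton f he, Finset.card_insert_of_notMem heA]
    push_cast
    omega

theorem homotopyGen_sgen_of_notMem {b c : ITree I} (f : b ⟶ c) (he : e ∉ c.edges)
    {n n' : ℤ} (h : n + 1 = n') : homotopyGen k e b c h (sgen k b c n) = 0 := by
  by_cases hbc : b = c
  · rw [sgen_eq_zero k hbc, map_zero]
  · by_cases hn : ((b.contracted c).card : ℤ) = n + 1
    · rw [homotopyGen_sgen k e f hbc h hn, sgen_eq_zero_of_card, map_zero, smul_zero]
      rw [contract_eq_self he]
      omega
    · rw [sgen_eq_zero_of_card k hn, map_zero]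

theorem homotopy_pairWord {x y z : ITree I} {p q n p' q' n' : ℤ} (h : p + q = n)
    (hn : n + 1 = n') (hp : p + 1 = p') (hq : q + 1 = q') (h₁ : p' + q = n') (h₂ : p + q' = n') :
    homotopy k e hn (pairWord k (x := x) (y := y) (z := z) h)
      = concat (sK k I) h₁ (homotopyGen k e y z hp (sgen k y z p)) (letter (sK k I) (sgen k x y q))
        + p.negOnePow • concat (sK k I) h₂ (contractGen k e y z p (sgen k y z p))
          (homotopyGen k e x y hq (sgen k x y q)) := by
  unfold pairWord
  rw [homotopy_cons k e h hn hp hq h₁ h₂, homotopy_letter]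

/-- The relation satisfied by the homotopy at a generator `b ⟶ c`, when `e` is an edge of `c`. -/
theorem homotopy_sgen_of_mem {b c : ITree I} (f : b ⟶ c) (hbc : b ≠ c) (he : e ∈ c.edges)
    {n n' m : ℤ} (hn : ((b.contracted c).card : ℤ) = n + 1) (h : n + 1 = n') (h' : m + 1 = n) :
    cobarD k h (homotopyGen k e b c h (sgen k b c n))
        + homotopy k e h' (cobarGen (koszulCocat k I) b c n m h' (sgen k b c n))
      = concat (sK k I) (zero_add n) (ugen k c (c.contract {e}) 0) (letter (sK k I) (sgen k b c n))
        - concat (sK k I) (add_zero n) (contractGen k e b c n (sgen k b c n))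
          (ugen k b (b.contract {e}) 0) := by
  have heb : e ∈ b.edges := hom_edges_subset f he
  have heA : e ∉ b.contracted c := fun h => (Finset.mem_sdiff.1 h).2 he
  have hA : b.contracted (c.contract {e}) = insert e (b.contracted c) :=
    contracted_contract_singleton f he
  obtain ⟨g⟩ : Nonempty (b ⟶ c.contract {e}) := ⟨f ≫ (hom_contract c {e}).some⟩
  rw [homotopyGen_sgen_of_mem k f hbc he, map_unit_smul, cobarD_letter,
    cobarGen_sgen k g (by rw [hA, Finset.card_insert_of_notMem heA]; push_cast; omega),
    cobarGen_sgen k f hn, map_sum, hA, Finset.sum_powerset_insert heA, smul_add, Finset.smul_sum,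
    Finset.smul_sum, ugen_of_ne k fun h => contract_singleton_ne he h.1,
    ugen_of_ne k fun h => contract_singleton_ne heb h.1, contractGen_sgen_of_notMem k f heA,
    letter_concat_letter, letter_concat_letter]
  let A := b.contracted c
  -- the two terms of the homotopy applied to the differential
  let G₁ : Finset (Set I) → free (sK k I) b (c.contract {e}) n := fun C =>
    (eps (A \ C) C * (n - C.card).negOnePow) •
      concat (sK k I) (p := n - C.card + 1) (q := C.card - 1) (by omega)
        (homotopyGen k e (b.contract C) c rfl (sgen k _ c (n - C.card)))
        (letter (sK k I) (sgen k b _ (C.card - 1)))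
  let G₂ : Finset (Set I) → free (sK k I) b (c.contract {e}) n := fun C =>
    eps (A \ C) C •
      concat (sK k I) (p := n - C.card) (q := C.card) (by omega)
        (contractGen k e (b.contract C) c _ (sgen k _ c (n - C.card)))
        (homotopyGen k e b (b.contract C) (by omega) (sgen k b _ (C.card - 1)))
  have hG : ∀ C ∈ A.powerset, homotopy k e h' ((eps (A \ C) C * (n - C.card).negOnePow) •
      pairWord k (x := b) (y := b.contract C) (z := c) (p := n - C.card) (q := C.card - 1)
        (by omega)) = G₁ C + G₂ C := by
    intro C _
    rw [map_unit_smul, homotopy_pairWord k (p' := n - C.card + 1) (q' := C.card) _ h' rfl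
      (by omega) (by omega) (by omega), smul_add, smul_smul, mul_assoc, Int.units_mul_self,
      mul_one]
  rw [Finset.sum_congr rfl hG, Finset.sum_add_distrib, add_add_add_comm,
    ← Finset.sum_add_distrib, ← Finset.sum_add_distrib, sub_eq_add_neg]
  have hbA : b.contract A = c := contract_contracted f
  have hAc : (A.card : ℤ) = n + 1 := hn
  have hmem : ∀ C ∈ A.powerset, e ∉ C := fun C hC h' => heA (Finset.mem_powerset.1 hC h')
  have hcard : ∀ C ∈ A.powerset, ((A \ C).card : ℤ) = n - C.card + 1 := by
    intro C hC
    have hC' := Finset.mem_powerset.1 hC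
    rw [Finset.card_sdiff_of_subset hC', Nat.cast_sub (Finset.card_le_card hC'), hAc]
    ring
  have heps : ∀ C ∈ A.powerset, eps {e} A = eps {e} (A \ C) * eps {e} C := by
    intro C hC
    conv_lhs => rw [← Finset.sdiff_union_of_subset (Finset.mem_powerset.1 hC)]
    rw [eps_union_right _ Finset.sdiff_disjoint]
  have hF₁ : ∀ C ∈ A.powerset, eps {e} A * (eps (insert e A \ C) C * (n' - C.card).negOnePow)
      = -(eps (A \ C) C * (n - C.card).negOnePow * eps {e} (A \ C)) := by
    intro C hC
    have h1 : e ∉ A \ C := fun h' => heA (Finset.mem_sdiff.1 h').1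
    rw [Finset.insert_sdiff_of_notMem _ (hmem C hC), eps_insert_left h1, heps C hC,
      show n' - (C.card : ℤ) = n - C.card + 1 by omega, Int.negOnePow_succ]
    rcases Int.units_eq_one_or (eps {e} C) with h2 | h2 <;> rw [h2] <;>
      simp [mul_comm, mul_left_comm]
  have hF₂ : ∀ C ∈ A.powerset, eps {e} A * (eps (insert e A \ insert e C) (insert e C)
      * (n' - (insert e C).card).negOnePow) = -(eps (A \ C) C * eps {e} C) := by
    intro C hC
    have h1 : e ∉ A \ C := fun h' => heA (Finset.mem_sdiff.1 h').1
    have h3 : insert e A \ insert e C = A \ C := by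
      rw [Finset.insert_sdiff_insert, Finset.sdiff_insert_of_notMem heA]
    rw [h3, eps_insert_right _ (hmem C hC), eps_singleton_right h1, hcard C hC, heps C hC,
      Finset.card_insert_of_notMem (hmem C hC)]
    push_cast
    rw [show n' - ((C.card : ℤ) + 1) = n - C.card by omega, Int.negOnePow_succ]
    rcases Int.units_eq_one_or (n - (C.card : ℤ)).negOnePow with h2 | h2 <;>
    rcases Int.units_eq_one_or (eps {e} (A \ C)) with h4 | h4 <;> rw [h2, h4] <;>
      simp [mul_comm]
  congr 1
  -- the words with `e` in the first letter cancel, except when the first letter is `e` alone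
  · rw [Finset.sum_eq_single A]
    · have h1 : G₁ A = 0 := by
        simp only [G₁]
        rw [sgen_eq_zero k hbA, map_zero, map_zero, LinearMap.zero_apply, smul_zero]
      have h2 : -(eps (A \ A) A * (n - A.card).negOnePow * eps {e} (A \ A)) = 1 := by
        rw [Finset.sdiff_self, eps_empty_left, eps_empty_right, hAc,
          show n - (n + 1) = -1 by ring, Int.negOnePow_neg, Int.negOnePow_one, one_mul, mul_one,
          neg_neg]
      rw [h1, add_zero, smul_smul, hF₁ A (Finset.mem_powerset_self _), h2, one_smul]
      exact pairWord_congr k hbA (by rw [hAc]; ring) _ _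
    · intro C hC hne
      have hC' := Finset.mem_powerset.1 hC
      have h1 : (b.contract C).contracted c = A \ C := contracted_contract_left _ _ _
      have h2 : b.contract C ≠ c := by
        rintro h2
        rw [h2, contracted_self] at h1
        exact hne (Finset.Subset.antisymm hC' (Finset.sdiff_eq_empty_iff_subset.1 h1.symm))
      simp only [G₁]
      rw [homotopyGen_sgen_of_mem k (contract_hom f hC').some h2 he, h1, map_unit_smul₂,
        letter_concat_letter, smul_smul, smul_smul, hF₁ C hC, Units.neg_smul,
        pairWord_congr k rfl rfl _ (show n - (C.card : ℤ) + 1 + (C.card - 1) = n by ring),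
        neg_add_cancel]
    · intro h
      exact absurd (Finset.mem_powerset_self _) h
  -- the words with `e` in the last letter cancel, except when the last letter is `e` alone
  · rw [Finset.sum_eq_single ∅]
    · have h1 : G₂ ∅ = 0 := by
        simp only [G₂]
        rw [sgen_eq_zero k (contract_empty b).symm, map_zero, map_zero, smul_zero]
      rw [h1, add_zero, smul_smul, hF₂ ∅ (Finset.empty_mem_powerset _), eps_empty_right,
        eps_empty_right, one_mul, Units.neg_smul, one_smul]
      congr 1
      exact pairWord_congr k (by rw [insert_empty_eq]) (by simp) _ _
    · intro C hC hne
      have hC' := Finset.mem_powerset.1 hC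
      have h1 : (b.contract C).contracted c = A \ C := contracted_contract_left _ _ _
      have h2 : b.contracted (b.contract C) = C := contracted_contract_right b c hC'
      have h3 : b ≠ b.contract C := by
        intro h3
        rw [← h3, contracted_self] at h2
        exact hne h2.symm
      have h4 : e ∈ (b.contract C).edges := by
        rw [edges_contract]
        exact Finset.mem_sdiff.2 ⟨heb, hmem C hC⟩
      simp only [G₂]
      rw [homotopyGen_sgen_of_mem k (hom_contract b C).some h3 h4, h2, map_unit_smul,
        contractGen_sgen_of_notMem k (contract_hom f hC').some
          (by rw [h1]; exact fun h' => heA (Finset.mem_sdiff.1 h').1),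
        letter_concat_letter, smul_smul, smul_smul, hF₂ C hC, Units.neg_smul,
        pairWord_congr k (y' := (b.contract C).contract {e}) (q' := C.card)
          (p' := n - C.card) _ _ _ (by omega), neg_add_cancel]
      · rw [contract_contract, Finset.union_comm, ← Finset.insert_eq]
      · rw [Finset.card_insert_of_notMem (hmem C hC)]
        push_cast
        ring
    · intro h
      exact absurd (Finset.empty_mem_powerset _) h

/-- The relation satisfied by the homotopy at a generator `b ⟶ c`, when `e` is contracted from `b`
to `c`. -/
theorem homotopy_sgen_of_mem_contracted {b c : ITree I} (f : b ⟶ c)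
    (heA : e ∈ b.contracted c) {n n' m : ℤ} (hn : ((b.contracted c).card : ℤ) = n + 1)
    (h : n + 1 = n') (h' : m + 1 = n) :
    cobarD k h (homotopyGen k e b c h (sgen k b c n))
        + homotopy k e h' (cobarGen (koszulCocat k I) b c n m h' (sgen k b c n))
      = concat (sK k I) (zero_add n) (ugen k c (c.contract {e}) 0) (letter (sK k I) (sgen k b c n))
        - concat (sK k I) (add_zero n) (contractGen k e b c n (sgen k b c n))
          (ugen k b (b.contract {e}) 0) := by
  have he : e ∉ c.edges := (Finset.mem_sdiff.1 heA).2
  have heb : e ∈ b.edges := (Finset.mem_sdiff.1 heA).1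
  have hce : c = c.contract {e} := (contract_eq_self he).symm
  let A := b.contracted c
  let B := A.erase e
  have hBA : B ⊆ A := Finset.erase_subset _ _
  have hAB : A \ B = {e} := erase_sdiff_self heA
  have hBcard : (B.card : ℤ) = n := by
    have h1 := Finset.card_erase_add_one heA
    have h2 : (B.card : ℤ) + 1 = A.card := by exact_mod_cast h1
    have h3 : (A.card : ℤ) = n + 1 := hn
    omega
  have h1 : b.contracted (b.contract B) = B := contracted_contract_right b c hBA
  have h3 : (b.contract B).contracted c = {e} := by rw [contracted_contract_left]; exact hAB
  have h4 : (b.contract B).contract {e} = c := by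
    rw [contract_contract, Finset.union_comm, ← Finset.insert_eq, Finset.insert_erase heA,
      contract_contracted f]
  have heB : e ∈ (b.contract B).edges := by
    rw [edges_contract]
    exact Finset.mem_sdiff.2 ⟨heb, Finset.notMem_erase _ _⟩
  -- only the term whose first letter is `e` alone has a nonzero image under the homotopy
  have key : homotopy k e h' (cobarGen (koszulCocat k I) b c n m h' (sgen k b c n))
      = eps {e} B • concat (sK k I) (p := n - B.card) (q := B.card) (by omega)
        (emptyWord k _ _ (n - B.card))
        (homotopyGen k e b (b.contract B) (by omega) (sgen k b (b.contract B) (B.card - 1))) := by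
    rw [cobarGen_sgen k f hn, map_sum, Finset.sum_eq_single B]
    · rw [map_unit_smul, homotopy_pairWord k (p' := n - B.card + 1) (q' := B.card) _ h' rfl
        (by omega) (by omega) (by omega), homotopyGen_sgen_of_notMem k (contract_hom f hBA).some he,
        map_zero, LinearMap.zero_apply, zero_add, smul_smul, mul_assoc, Int.units_mul_self, mul_one,
        contractGen_sgen_of_mem k (contract_hom f hBA).some (by rw [h3]; simp)
          (by rw [h3, hBcard]; simp)]
      exact congrArg (fun X => eps X B • _) hAB
    · intro C hC hne
      have hC' := Finset.mem_powerset.1 hC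
      rw [map_unit_smul, homotopy_pairWord k (p' := n - C.card + 1) (q' := C.card) _ h' rfl
        (by omega) (by omega) (by omega), homotopyGen_sgen_of_notMem k (contract_hom f hC').some he,
        map_zero, LinearMap.zero_apply, zero_add]
      by_cases heC : e ∈ C
      · rw [homotopyGen_sgen_of_notMem k (hom_contract b C).some
          (by rw [edges_contract]; exact fun h => (Finset.mem_sdiff.1 h).2 heC), map_zero,
          smul_zero, smul_zero]
      · rw [contractGen_sgen_eq_zero k (contract_hom f hC').some
          (by rw [contracted_contract_left]; exact Finset.mem_sdiff.2 ⟨heA, heC⟩), map_zero,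
          LinearMap.zero_apply, smul_zero, smul_zero]
        rw [contracted_contract_left]
        intro h5
        refine hne ?_
        rw [← Finset.sdiff_sdiff_eq_self hC', h5, Finset.sdiff_singleton_eq_erase]
    · intro h
      exact absurd (Finset.mem_powerset.2 hBA) h
  rw [homotopyGen_sgen_of_notMem k f he, map_zero, zero_add, key, ugen_of_eq k hce,
    ugen_of_ne k fun h => contract_singleton_ne heb h.1, emptyWord_concat_letter k hce rfl]
  by_cases hB : B = ∅
  · have hAe : A = {e} := by rw [← hAB, hB, Finset.sdiff_empty]
    have hn0 : n = 0 := by rw [← hBcard, hB]; simp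
    have h5 : b.contract {e} = c := by rw [← hAe, contract_contracted f]
    rw [sgen_eq_zero k (t := b) (s := b.contract B) (by rw [hB, contract_empty]), map_zero,
      map_zero, smul_zero, contractGen_sgen_of_mem k f heA hn,
      emptyWord_concat_letter k (h5.trans hce) hn0, sub_self]
  · have h5 : b ≠ b.contract B := by
      intro h5
      rw [← h5, contracted_self] at h1
      exact hB h1.symm
    rw [contractGen_sgen_eq_zero k f heA, map_zero, LinearMap.zero_apply, sub_zero]
    · rw [homotopyGen_sgen_of_mem k (hom_contract b B).some h5 heB, h1, map_unit_smul, smul_smul,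
        eps_mul_self, one_smul, emptyWord_concat_letter k (h4.trans hce) (by omega)]
    · intro h6
      refine hB ?_
      simp only [B, A, h6]
      simp

/-- The relation satisfied by the homotopy at a generator `b ⟶ c`, when `e` is not an edge of
`b`. -/
theorem homotopy_sgen_of_notMem {b c : ITree I} (f : b ⟶ c)
    (heb : e ∉ b.edges) {n n' m : ℤ} (hn : ((b.contracted c).card : ℤ) = n + 1)
    (h : n + 1 = n') (h' : m + 1 = n) :
    cobarD k h (homotopyGen k e b c h (sgen k b c n))
        + homotopy k e h' (cobarGen (koszulCocat k I) b c n m h' (sgen k b c n))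
      = concat (sK k I) (zero_add n) (ugen k c (c.contract {e}) 0) (letter (sK k I) (sgen k b c n))
        - concat (sK k I) (add_zero n) (contractGen k e b c n (sgen k b c n))
          (ugen k b (b.contract {e}) 0) := by
  have he : e ∉ c.edges := fun h => heb (hom_edges_subset f h)
  have hce : c = c.contract {e} := (contract_eq_self he).symm
  have hbe : b = b.contract {e} := (contract_eq_self heb).symm
  have heA : e ∉ b.contracted c := fun h => heb (Finset.mem_sdiff.1 h).1
  have key : homotopy k e h' (cobarGen (koszulCocat k I) b c n m h' (sgen k b c n)) = 0 := by
    rw [cobarGen_sgen k f hn, map_sum]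
    refine Finset.sum_eq_zero fun C hC => ?_
    have hC' := Finset.mem_powerset.1 hC
    rw [map_unit_smul, homotopy_pairWord k (p' := n - C.card + 1) (q' := C.card) _ h' rfl
      (by omega) (by omega) (by omega),
      homotopyGen_sgen_of_notMem k (contract_hom f hC').some he,
      homotopyGen_sgen_of_notMem k (hom_contract b C).some
        (by rw [edges_contract]; exact fun h => heb (Finset.mem_sdiff.1 h).1), map_zero,
      LinearMap.zero_apply, map_zero, smul_zero, add_zero, smul_zero]
  rw [homotopyGen_sgen_of_notMem k f he, map_zero, zero_add, key, ugen_of_eq k hce,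
    ugen_of_eq k hbe, emptyWord_concat_letter k hce rfl, contractGen_sgen_of_notMem k f heA,
    letter_concat_emptyWord k hbe rfl, sub_self]

end Homotopy

/-! ### The homotopy relation -/

section HomotopyRelation

variable (k : Type u) [Field k] {I : Type v} {e : Set I}

open ITree

/-- The homotopy relation on the generators, for any edge. -/
theorem homotopy_sgen {b c : ITree I} (f : b ⟶ c) (hbc : b ≠ c) {n n' m : ℤ}
    (hn : ((b.contracted c).card : ℤ) = n + 1) (h : n + 1 = n') (h' : m + 1 = n) :
    cobarD k h (homotopyGen k e b c h (sgen k b c n))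
        + homotopy k e h' (cobarGen (koszulCocat k I) b c n m h' (sgen k b c n))
      = concat (sK k I) (zero_add n) (ugen k c (c.contract {e}) 0) (letter (sK k I) (sgen k b c n))
        - concat (sK k I) (add_zero n) (contractGen k e b c n (sgen k b c n))
          (ugen k b (b.contract {e}) 0) := by
  by_cases he : e ∈ c.edges
  · exact homotopy_sgen_of_mem k f hbc he hn h h'
  · by_cases heb : e ∈ b.edges
    · exact homotopy_sgen_of_mem_contracted k f (Finset.mem_sdiff.2 ⟨heb, he⟩) hn h h'
    · exact homotopy_sgen_of_notMem k f heb hn h h'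

/-- The homotopy relation on the letters. -/
theorem homotopy_gen {b c : ITree I} {n n' m : ℤ} (h : n + 1 = n') (h' : m + 1 = n)
    (γ : sK k I b c n) :
    cobarD k h (homotopyGen k e b c h γ)
        + homotopy k e h' (cobarGen (koszulCocat k I) b c n m h' γ)
      = concat (sK k I) (zero_add n) (ugen k c (c.contract {e}) 0) (letter (sK k I) γ)
        - concat (sK k I) (add_zero n) (contractGen k e b c n γ)
          (ugen k b (b.contract {e}) 0) :=
  sK_hom_ext k
    (f := (cobarD k h).comp (homotopyGen k e b c h)
      + (homotopy k e h').comp (cobarGen (koszulCocat k I) b c n m h'))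
    (g := (concat (sK k I) (zero_add n) (ugen k c (c.contract {e}) 0)).comp (letter (sK k I))
      - ((concat (sK k I) (add_zero n)).flip (ugen k b (b.contract {e}) 0)).comp
        (contractGen k e b c n))
    (fun f hbc hn => homotopy_sgen k f hbc hn h h') γ

/-- The contraction of `e` after a morphism is homotopic to the contraction of `e` before the
contracted morphism. -/
theorem homotopy_relation {a c : ITree I} {n n' m : ℤ} (h : n + 1 = n') (h' : m + 1 = n)
    (x : free (sK k I) a c n) :
    cobarD k h (homotopy k e h x) + homotopy k e h' (cobarD k h' x)
      = concat (sK k I) (zero_add n) (ugen k c (c.contract {e}) 0) x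
        - concat (sK k I) (add_zero n) (contractMap k e x) (ugen k a (a.contract {e}) 0) := by
  induction a, c, n, x using free_induction generalizing n' m with
  | zero => simp only [map_zero, LinearMap.zero_apply, sub_zero, add_zero]
  | add a c n x y hx hy =>
    simp only [map_add, LinearMap.add_apply]
    rw [add_add_add_comm, hx, hy]
    abel
  | smul_one a r =>
    have h1 : cobarD k h' (GrGraph.one (sK k I) a) = 0 := GrGraph.deriv_one _ h'
    simp only [map_smul, LinearMap.smul_apply]
    rw [h1, homotopy_one, contractMap_one, map_zero, map_zero, smul_zero, add_zero, ← smul_sub,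
      one_concat]
    -- both composites with the empty word are the contraction of `e`
    exact ((congrArg (r • ·) ((congrArg (· - _) (concat_one _ _)).trans (sub_self _))).trans
      (smul_zero r)).symm
  | cons a b c p q n hpq γ w ih =>
    have h1 := homotopy_gen k (e := e) (n' := p + 1) (m := p - 1) rfl (by omega) γ
    have h2 := ih (n' := q + 1) (m := q - 1) rfl (by omega)
    have h3 : contractMap k e (cobarGen (koszulCocat k I) b c p (p - 1) (by omega) γ)
        = cobarD k (by omega) (contractGen k e b c p γ) := by
      rw [← cobarD_letter k, contractMap_cobarD, contractMap_letter]
    rw [homotopy_cons k e (p' := p + 1) (q' := q + 1) hpq h rfl rfl (by omega) (by omega),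
      cobarD_cons k (p' := p - 1) (q' := q - 1) hpq h' (by omega) (by omega) (by omega) (by omega),
      map_add, map_add, map_unit_smul, map_unit_smul,
      cobarD_concat k (p' := p) (q' := q - 1) _ h rfl (by omega) (by omega) (by omega),
      cobarD_concat k (p' := p - 1) (q' := q) _ h (by omega) rfl (by omega) (by omega),
      homotopy_concat k e (p' := p) (q' := q + 1) _ h' (by omega) rfl (by omega) (by omega),
      homotopy_cons k e (p' := p + 1) (q' := q) _ h' rfl (by omega) (by omega) (by omega), h3,
      contractMap_cons]
    have h4 : concat (sK k I) (zero_add n) (ugen k c (c.contract {e}) 0) (cons (sK k I) hpq γ w)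
        = concat (sK k I) hpq (concat (sK k I) (zero_add p) (ugen k c (c.contract {e}) 0)
          (letter (sK k I) γ)) w := by
      rw [concat_assoc (sK k I) (qr := n) _ hpq _ (zero_add n), letter_concat]
    have h5 : concat (sK k I) (add_zero n) (concat (sK k I) hpq (contractGen k e b c p γ)
          (contractMap k e w)) (ugen k a (a.contract {e}) 0)
        = concat (sK k I) hpq (contractGen k e b c p γ) (concat (sK k I) (add_zero q)
          (contractMap k e w) (ugen k a (a.contract {e}) 0)) :=
      concat_assoc (sK k I) hpq _ _ _ _ _ _
    have h6 : concat (sK k I) hpq (concat (sK k I) (add_zero p) (contractGen k e b c p γ)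
          (ugen k b (b.contract {e}) 0)) w
        = concat (sK k I) hpq (contractGen k e b c p γ) (concat (sK k I) (zero_add q)
          (ugen k b (b.contract {e}) 0) w) :=
      concat_assoc (sK k I) _ _ _ _ _ _ _
    have h7 := congrArg (fun z => concat (sK k I) hpq z w) h1
    have h8 := congrArg (concat (sK k I) hpq (contractGen k e b c p γ)) h2
    simp only [map_add, map_sub, LinearMap.add_apply, LinearMap.sub_apply] at h7 h8
    rw [h4, h5]
    refine Eq.trans ?_ ((congrArg₂ (· + ·) h7 h8).trans ?_)
    · rw [Int.negOnePow_succ, Int.negOnePow_sub, Int.negOnePow_one]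
      rcases Int.units_eq_one_or p.negOnePow with h9 | h9 <;> rw [h9] <;>
        simp only [one_smul, mul_neg, mul_one, neg_neg, Units.neg_smul] <;> abel
    · rw [h6, sub_add_sub_cancel]

end HomotopyRelation

section Resolution

variable (k : Type u) [Field k] {I : Type v}

open ITree

/-! ### The functor from the cobar construction of `K` to the category of trees -/

/-- The functor on the generators. -/
def resGen (t s : ITree I) (n : ℤ) : sK k I t s n →ₗ[k] (treeCat k I).X t s n :=
  (koszulLift k t s (n + 1) fun _ _ _ => arrow k t s n).comp
    (ofShift (-1) (koszulGraph k) (by omega))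

/-- The functor from the cobar construction of `K` to the category of trees. -/
def resMap {t s : ITree I} {n : ℤ} : free (sK k I) t s n →ₗ[k] (treeCat k I).X t s n :=
  (treeCat k I).lift (Γ := sK k I) (resGen k) t s n

theorem resMap_letter {t s : ITree I} {n : ℤ} (γ : sK k I t s n) :
    resMap k (letter (sK k I) γ) = resGen k t s n γ :=
  lift_letter _ (linearization_isDGCategory k _) _ γ

theorem resMap_one (t : ITree I) : resMap k (GrGraph.one (sK k I) t) = arrow k t t 0 :=
  (lift_one _ _ t).trans (treeCat_one k t)

theorem resMap_concat {a b c : ITree I} {p q n : ℤ} (h : p + q = n)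
    (x : free (sK k I) b c p) (y : free (sK k I) a b q) :
    resMap k (concat (sK k I) h x y) = (treeCat k I).comp h (resMap k x) (resMap k y) :=
  lift_concat _ (linearization_isDGCategory k _) _ h x y

theorem resGen_sgen {t s : ITree I} (f : t ⟶ s) (hts : t ≠ s) {n : ℤ}
    (hn : ((t.contracted s).card : ℤ) = n + 1) :
    resGen k t s n (sgen k t s n) = arrow k t s n := by
  have h1 : resGen k t s n (sgen k t s n)
      = sgn (numbering t s) • arrow k t s n := by
    unfold resGen sgen
    rw [LinearMap.comp_apply, ofShift_toShift _ _ hts, koszulLift_gen k _ f hn]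
  rw [h1]
  by_cases h0 : n = 0
  · subst h0
    rw [sgn_of_le_one (by omega), one_smul]
  · exact (treeCat_subsingleton k fun h => h0 h.2).elim _ _

theorem resMap_sgen {t s : ITree I} (f : t ⟶ s) (hts : t ≠ s) {n : ℤ}
    (hn : ((t.contracted s).card : ℤ) = n + 1) :
    resMap k (letter (sK k I) (sgen k t s n)) = arrow k t s n := by
  rw [resMap_letter, resGen_sgen k f hts hn]

theorem resMap_pairWord {x y z : ITree I} (f : x ⟶ y) (g : y ⟶ z)
    (hf : (x.contracted y).card = 1) (hg : (y.contracted z).card = 1) {p q n : ℤ} (hp : p = 0)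
    (hq : q = 0) (h : p + q = n) :
    resMap k (pairWord k (x := x) (y := y) (z := z) h) = arrow k x z n := by
  have hxy : x ≠ y := by
    rintro rfl
    simp at hf
  have hyz : y ≠ z := by
    rintro rfl
    simp at hg
  rw [← letter_concat_letter, resMap_concat, resMap_sgen k f hxy (by omega),
    resMap_sgen k g hyz (by omega), comp_arrow k f g hp hq]

/-- The functor vanishes on the boundaries: contracting two edges in either order gives the same
tree, and the two orders come with opposite signs. -/
theorem resMap_cobarGen_sgen {t s : ITree I} (f : t ⟶ s) {i j : ℤ}
    (hi : ((t.contracted s).card : ℤ) = i + 1) (h : j + 1 = i) :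
    resMap k (cobarGen (koszulCocat k I) t s i j h (sgen k t s i)) = 0 := by
  by_cases hj : j = 0
  · subst hj
    obtain rfl : i = 1 := by omega
    obtain ⟨x, y, hxy, hA⟩ := Finset.card_eq_two.1 (show (t.contracted s).card = 2 by omega)
    have hx : ({x} : Finset (Set I)) ⊆ t.contracted s := by rw [hA]; simp
    have hy : ({y} : Finset (Set I)) ⊆ t.contracted s := by rw [hA]; simp
    have hAx : t.contracted s \ {x} = {y} := by
      rw [hA]
      ext z
      simp only [Finset.mem_sdiff, Finset.mem_insert, Finset.mem_singleton]
      constructor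
      · tauto
      · rintro rfl
        exact ⟨Or.inr rfl, hxy.symm⟩
    have hAy : t.contracted s \ {y} = {x} := by
      rw [hA]
      ext z
      simp only [Finset.mem_sdiff, Finset.mem_insert, Finset.mem_singleton]
      constructor
      · tauto
      · rintro rfl
        exact ⟨Or.inl rfl, hxy⟩
    have key : ∀ e : Set I, {e} ⊆ t.contracted s → (t.contracted s \ {e}).card = 1 →
        ∀ {p q : ℤ} (hp : p = 0) (hq : q = 0) (h : p + q = 0),
        resMap k (pairWord k (x := t) (y := t.contract {e}) (z := s) h) = arrow k t s 0 := by
      intro e he he' p q hp hq h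
      obtain ⟨g⟩ := contract_hom f he
      obtain ⟨g'⟩ := hom_contract t {e}
      exact resMap_pairWord k g' g (by rw [contracted_contract_right t s he]; simp)
        (by rw [contracted_contract_left, he']) hp hq h
    rw [cobarGen_sgen k f hi, map_sum]
    rw [Finset.sum_eq_add {x} {y}]
    · rw [map_unit_smul, map_unit_smul, key x hx (by rw [hAx]; simp) (by simp) (by simp),
        key y hy (by rw [hAy]; simp) (by simp) (by simp), hAx, hAy]
      have h1 : eps {y} {x} = -eps {x} {y} := by
        unfold eps
        simp only [Finset.prod_singleton]
        exact pairSign_swap hxy.symm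
      rw [h1, Finset.card_singleton, Finset.card_singleton, neg_mul, Units.neg_smul,
        neg_add_cancel]
    · simpa using hxy
    · intro C hC hne
      have hC' := Finset.mem_powerset.1 hC
      rw [map_unit_smul]
      have h1 : C = ∅ ∨ C = t.contracted s := by
        rw [hA] at hC' ⊢
        rcases Finset.eq_empty_or_nonempty C with h2 | ⟨z, hz⟩
        · exact Or.inl h2
        · right
          refine hC'.antisymm ?_
          by_contra h3
          have h4 : ∀ w ∈ C, w = x ∨ w = y := fun w hw => by simpa using hC' hw
          grind
      rcases h1 with rfl | rfl
      · rw [pairWord_eq_zero_right k _ (contract_empty t).symm, map_zero, smul_zero]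
      · rw [pairWord_eq_zero_left k _ (contract_contracted f), map_zero, smul_zero]
    · intro h
      exact absurd (Finset.mem_powerset.2 hx) h
    · intro h
      exact absurd (Finset.mem_powerset.2 hy) h
  · exact (treeCat_subsingleton k fun h => hj h.2).elim _ _

theorem resMap_cobarD {t s : ITree I} {i j : ℤ} (h : j + 1 = i) (x : free (sK k I) t s i) :
    resMap k (cobarD k h x) = 0 :=
  lift_deriv (linearization_isDGCategory k _) (resGen k) (cobarGen (koszulCocat k I))
    (fun a b i j h γ => sK_hom_ext k
      (f := (resMap k).comp (cobarGen (koszulCocat k I) a b i j h)) (g := 0)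
      (fun f _ hi => resMap_cobarGen_sgen k f hi h) γ) h x

theorem resolutionMap_isDGFunctor :
    IsDGFunctor (cobarCat k I) (treeCat k I) (fun _ _ _ => resMap k) where
  map_d _ _ _ _ h x := resMap_cobarD k h x
  map_one t := lift_one _ _ t
  map_comp _ _ _ _ _ _ h x y := resMap_concat k h x y

/-! ### The homology of the cobar construction of `K` -/

variable {k} in
/-- Every letter lies over a morphism of trees, and hence so does every word. -/
theorem free_eq_zero {t s : ITree I} {n : ℤ} (h : ¬ Nonempty (t ⟶ s))
    (x : free (sK k I) t s n) : x = 0 := by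
  induction t, s, n, x using free_induction with
  | zero => rfl
  | add t s n x y hx hy => rw [hx h, hy h, add_zero]
  | smul_one t r => exact absurd ⟨𝟙 t⟩ h
  | cons a b c p q n hpq γ w ih =>
    by_cases hab : Nonempty (a ⟶ b)
    · have := sK_subsingleton k (a := b) (b := c) (n := p)
        fun hbc => h ⟨hab.some ≫ hbc.some⟩
      rw [Subsingleton.elim γ 0, map_zero, LinearMap.zero_apply]
    · rw [ih hab, map_zero]

/-- The contraction of `e` is a cycle: the two-letter words in its differential contain an identity.
-/
theorem cobarD_ugen {b : ITree I} (e : Set I) {m : ℤ} (h : m + 1 = 0) :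
    cobarD k h (ugen k b (b.contract {e}) 0) = 0 := by
  by_cases he : e ∈ b.edges
  · obtain ⟨f⟩ := hom_contract b {e}
    have hA : b.contracted (b.contract {e}) = {e} := by
      unfold contracted
      rw [edges_contract, Finset.sdiff_sdiff_eq_self (Finset.singleton_subset_iff.2 he)]
    rw [ugen_of_ne k fun h => contract_singleton_ne he h.1, cobarD_letter,
      cobarGen_sgen k f (by rw [hA]; simp)]
    refine Finset.sum_eq_zero fun C hC => ?_
    rw [hA, Finset.mem_powerset, Finset.subset_singleton_iff] at hC
    rcases hC with rfl | rfl
    · rw [pairWord_eq_zero_right k _ (contract_empty b).symm, smul_zero]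
    · rw [pairWord_eq_zero_left k _ rfl, smul_zero]
  · rw [ugen_of_eq k (contract_eq_self he).symm, cobarD_emptyWord]

theorem resMap_ugen {b : ITree I} {e : Set I} (he : e ∈ b.edges) :
    resMap k (ugen k b (b.contract {e}) 0) = arrow k b (b.contract {e}) 0 := by
  have hA : b.contracted (b.contract {e}) = {e} := by
    unfold contracted
    rw [edges_contract, Finset.sdiff_sdiff_eq_self (Finset.singleton_subset_iff.2 he)]
  rw [ugen_of_ne k fun h => contract_singleton_ne he h.1,
    resMap_sgen k (hom_contract b {e}).some (contract_singleton_ne he) (by rw [hA]; simp)]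

/-- A composite with an empty word which is a boundary, the endpoint `s` being written in two ways.
-/
theorem exists_cobarD_eq {t s s' : ITree I} (h : s = s') {l m : ℤ} (h' : m + 1 = l)
    {x : free (sK k I) t s m} {z : free (sK k I) t s' l}
    (hz : cobarD k h' z = concat (sK k I) (zero_add m) (emptyWord k s s' 0) x) :
    ∃ z', cobarD k h' z' = x := by
  subst h
  rw [← ugen_of_eq k rfl, ugen_self, one_concat] at hz
  exact ⟨z, hz⟩

/-- A cycle of the cobar construction of `K` is a boundary if its image vanishes: by the homotopy
relation, it is homologous to the composite of the contraction of one edge `e` with a cycle whose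
source and target do not have `e`. -/
theorem exists_cobarD_eq_of_resMap_eq_zero (N : ℕ) : ∀ {t s : ITree I}, (t ⟶ s) →
    (t.contracted s).card = N → ∀ {l m n : ℤ} (h : m + 1 = l) (h' : n + 1 = m)
    (x : free (sK k I) t s m), cobarD k h' x = 0 → resMap k x = 0 → ∃ z, cobarD k h z = x := by
  induction N with
  | zero =>
    intro t s f hN l m n h h' x hx hx'
    obtain rfl : t = s := eq_of_contracted_eq_empty f (Finset.card_eq_zero.1 hN)
    refine ⟨0, ?_⟩
    rw [map_zero]
    by_cases hm : m = 0
    · subst hm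
      obtain ⟨r, rfl⟩ := ((cobarCat_isConnected k).bijective_one t).2 x
      have h1 : r • arrow k t t 0 = 0 := by
        rw [← resMap_one, ← map_smul]
        exact hx'
      rw [smul_arrow_eq_zero_iff k f rfl] at h1
      subst h1
      exact (zero_smul k _).symm
    · exact ((cobarCat_isConnected k).subsingleton_self t m hm).elim _ _
  | succ N ih =>
    intro t s f hN l m n h h' x hx hx'
    obtain ⟨e, heA⟩ := Finset.card_pos.1 (show 0 < (t.contracted s).card by omega)
    have he : e ∉ s.edges := (Finset.mem_sdiff.1 heA).2
    have het : e ∈ t.edges := (Finset.mem_sdiff.1 heA).1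
    have hs : s = s.contract {e} := (contract_eq_self he).symm
    obtain ⟨f'⟩ := hom_contract_contract f e
    obtain ⟨g⟩ := hom_contract t {e}
    have hrel := homotopy_relation k (e := e) h h' x
    rw [hx, map_zero, add_zero, ugen_of_eq k hs] at hrel
    have hF : cobarD k h' (contractMap k e x) = 0 := by
      rw [← contractMap_cobarD, hx, map_zero]
    have hF' : resMap k (contractMap k e x) = 0 := by
      by_cases hm : m = 0
      · subst hm
        obtain ⟨r, hr⟩ := exists_eq_smul_arrow k (resMap k (contractMap k e x))
        have h1 := congrArg (resMap k) hrel
        rw [resMap_cobarD, map_sub, resMap_concat, resMap_concat, hx', map_zero, zero_sub,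
          resMap_ugen k het, hr] at h1
        -- composing with the contraction of `e` is injective on `k T_I(t / e, s / e)`
        have h2 := neg_eq_zero.1 h1.symm
        rw [map_smul, LinearMap.smul_apply, comp_arrow k g f' rfl rfl,
          smul_arrow_eq_zero_iff k (g ≫ f') rfl] at h2
        rw [hr, h2, zero_smul]
      · exact (treeCat_subsingleton k fun h => hm h.2).elim _ _
    obtain ⟨y, hy⟩ := ih f' (by
      rw [contracted_contract_contract, Finset.card_erase_of_mem heA, hN]
      rfl) h h' _ hF hF'
    refine exists_cobarD_eq k hs h (z := homotopy k e h x
      + concat (sK k I) (add_zero l) y (ugen k t (t.contract {e}) 0)) ?_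
    rw [map_add, cobarD_concat k (p' := m) (q' := -1) _ h h (by omega) (add_zero m) (by omega),
      cobarD_ugen, map_zero, smul_zero, add_zero, hy, hrel, sub_add_cancel]

/-- A morphism of trees is the composite of contractions of single edges, each of which is the image
of a cycle. -/
theorem exists_resMap_eq_arrow (N : ℕ) : ∀ {t s : ITree I}, (t ⟶ s) →
    (t.contracted s).card = N → ∀ {n : ℤ} (h : n + 1 = 0),
    ∃ x : free (sK k I) t s 0, cobarD k h x = 0 ∧ resMap k x = arrow k t s 0 := by
  induction N with
  | zero =>
    intro t s f hN n h
    obtain rfl : t = s := eq_of_contracted_eq_empty f (Finset.card_eq_zero.1 hN)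
    exact ⟨GrGraph.one (sK k I) t, GrGraph.deriv_one _ h, resMap_one k t⟩
  | succ N ih =>
    intro t s f hN n h
    obtain ⟨e, heA⟩ := Finset.card_pos.1 (show 0 < (t.contracted s).card by omega)
    have het : e ∈ t.edges := (Finset.mem_sdiff.1 heA).1
    have heA' : {e} ⊆ t.contracted s := Finset.singleton_subset_iff.2 heA
    obtain ⟨f'⟩ := contract_hom f heA'
    obtain ⟨g⟩ := hom_contract t {e}
    obtain ⟨x, hx, hx'⟩ := ih f' (by
      rw [contracted_contract_left, Finset.card_sdiff_of_subset heA', hN]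
      rfl) h
    refine ⟨concat (sK k I) (add_zero 0) x (ugen k t (t.contract {e}) 0), ?_, ?_⟩
    · rw [cobarD_concat k (p' := n) (q' := n) _ h h h (by omega) (by omega), hx, cobarD_ugen,
        map_zero, LinearMap.zero_apply, map_zero, smul_zero, add_zero]
    · rw [resMap_concat, hx', resMap_ugen k het, comp_arrow k g f' rfl rfl]

theorem resolutionMap_isQuasiIso :
    IsQuasiIso (cobarCat k I) (treeCat k I) (fun _ _ _ => resMap k) where
  injective t s l m n h h' x hx hy := by
    obtain ⟨_, hy⟩ := hy
    by_cases hts : Nonempty (t ⟶ s)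
    · exact exists_cobarD_eq_of_resMap_eq_zero k _ hts.some rfl h h' x hx hy.symm
    · exact ⟨0, (free_eq_zero hts _).trans (free_eq_zero hts _).symm⟩
  surjective t s l m n h h' y _ := by
    obtain ⟨r, rfl⟩ := exists_eq_smul_arrow k y
    by_cases hts : Nonempty (t ⟶ s) ∧ m = 0
    · obtain ⟨⟨f⟩, rfl⟩ := hts
      obtain ⟨x, hx, hx'⟩ := exists_resMap_eq_arrow k _ f rfl h'
      refine ⟨r • x, ?_, 0, ?_⟩
      · refine (map_smul (cobarD k h') r x).trans ?_
        rw [hx, smul_zero]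
      · refine Eq.symm ((congrArg₂ (· + ·) (map_smul (resMap k) r x) (map_zero _)).trans ?_)
        simp only [add_zero]
        rw [hx']
    · exact ⟨0, map_zero _, 0, (treeCat_subsingleton k hts).elim _ _⟩

end Resolution

section Minimality

variable (k : Type u) [Field k] {I : Type v}

open ITree

/-! ### Minimality -/

/-- The functor from the free category that extends the inclusion of the generators is the
identity. -/
theorem lift_cobarι {t s : ITree I} {n : ℤ} (x : free (sK k I) t s n) :
    (cobarCat k I).lift (Γ := sK k I) (fun _ _ _ => letter (sK k I)) t s n x = x :=
  free_hom_ext (N := fun t s n => free (sK k I) t s n)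
    (f := fun t s n => (cobarCat k I).lift (Γ := sK k I) (fun _ _ _ => letter (sK k I)) t s n)
    (g := fun _ _ _ => LinearMap.id) (fun t => lift_one (cobarCat k I) _ t)
    (fun _ _ _ _ _ _ h γ w ih => (lift_cons (cobarCat k I) _ h γ w).trans
      ((congrArg (concat (sK k I) h (letter (sK k I) γ)) ih).trans
        (letter_concat (sK k I) h γ w))) t s n x

theorem pairWord_eq_incl {x y z : ITree I} {p q n : ℤ} (h : p + q = n) :
    ∃ w, pairWord k (x := x) (y := y) (z := z) h = incl (sK k I) 2 x z n w := by
  unfold pairWord letter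
  rw [LinearMap.flip_apply]
  unfold GrGraph.one
  rw [cons_incl, cons_incl]
  exact ⟨_, rfl⟩

/-- The component of a combination of words that consists of the words of length `l`. -/
def wordComponent (l : ℕ) (t s : ITree I) (n : ℤ) :
    free (sK k I) t s n →ₗ[k] word (sK k I) l t s n :=
  DirectSum.component k ℕ (fun m => word (sK k I) m t s n) l

theorem wordComponent_incl_of_ne {l m : ℕ} (h : m ≠ l) {t s : ITree I} {n : ℤ}
    (w : word (sK k I) m t s n) : wordComponent k l t s n (incl (sK k I) m t s n w) = 0 :=
  DirectSum.of_eq_of_ne (β := fun m => word (sK k I) m t s n) m l w h.symm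

/-- The differential of a generator is a linear combination of words with two letters. -/
theorem wordComponent_cobarGen {t s : ITree I} {i j : ℤ} (h : j + 1 = i) (γ : sK k I t s i)
    {l : ℕ} (hl : 2 ≠ l) :
    wordComponent k l t s j (cobarGen (koszulCocat k I) t s i j h γ) = 0 := by
  refine sK_hom_ext k (f := (wordComponent k l t s j).comp
    (cobarGen (koszulCocat k I) t s i j h)) (g := 0) ?_ γ
  intro f _ hi
  rw [LinearMap.comp_apply, cobarGen_sgen k f hi, map_sum]
  refine Finset.sum_eq_zero fun C _ => ?_
  obtain ⟨w, hw⟩ := pairWord_eq_incl k (x := t) (y := t.contract C) (z := s) (p := i - C.card)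
    (q := C.card - 1) (n := j) (by omega)
  rw [map_unit_smul, hw, wordComponent_incl_of_ne k hl, smul_zero]

theorem cobar_isMinimalResolution :
    IsMinimalResolution (cobar (koszul k I)) (treeCat k I) (shift (-1) (koszul k I).X)
      (cobarι (koszul k I)) (resolutionMap k I) where
  isDGCategory := cobarCat_isDGCategory k
  isDGCategory_target := linearization_isDGCategory k _
  isDGFunctor := resolutionMap_isDGFunctor k
  isQuasiIso := resolutionMap_isQuasiIso k
  reduced a n := inferInstanceAs (Subsingleton (shift (-1) (koszulGraph k) a a n))
  free a b n := by
    have h : ∀ x, (cobar (koszul k I)).lift (cobarι (koszul k I)) a b n x = x := lift_cobarι k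
    exact ⟨fun x y hxy => (h x).symm.trans (hxy.trans (h y)), fun x => ⟨x, h x⟩⟩
  decomposable a b m n h γ :=
    ⟨cobarGen (koszulCocat k I) a b m n h γ, wordComponent_cobarGen k h γ (by decide),
      wordComponent_cobarGen k h γ (by decide),
      (cobarD_letter k h γ).trans (lift_cobarι k _).symm⟩

end Minimality

end

end TreeKoszul

theorem mainTheorem5 {k : Type*} [Field k] {I : Type*} :
    (koszul k I).IsDGCocategory ∧ (koszul k I).IsConnected ITree.degree ∧
    (∀ (t s : ITree I) (_ : t ⟶ s) (m : ℕ) (e : Fin m ≃ t.contracted s),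
      (koszul k I).Δ t s m (wedge k t s fun i => (e i : Set I))
        = shuffleSum k t s m rfl fun i => (e i : Set I)) ∧
    (bar (treeCat k I)).IsDGCocategory ∧ (bar (treeCat k I)).IsConnected ITree.degree ∧
    (∀ (t s : ITree I) (_ : t ⟶ s) (m : ℕ) (e : Fin m ≃ t.contracted s),
      kappaBar k I t s m (wedge k t s fun i => (e i : Set I))
        = antisymmetrization k t s m rfl fun i => (e i : Set I)) ∧
    IsSubcocategory (koszul k I) (bar (treeCat k I)) (kappaBar k I) ∧
    (treeCat k I).IsConnected ITree.degree ∧ (cobar (koszul k I)).IsConnected ITree.degree ∧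
    IsMinimalResolution (cobar (koszul k I)) (treeCat k I) (shift (-1) (koszul k I).X)
      (cobarι (koszul k I)) (resolutionMap k I) := by
  have hinj : ∀ {t s : ITree I} {m : ℕ} (e : Fin m ≃ t.contracted s),
      Function.Injective fun i => (e i : Set I) :=
    fun e => Subtype.val_injective.comp e.injective
  have himg : ∀ {t s : ITree I} {m : ℕ} (e : Fin m ≃ t.contracted s),
      Finset.univ.image (fun i => (e i : Set I)) = t.contracted s := by
    intro t s m e
    ext x
    simp only [Finset.mem_image, Finset.mem_univ, true_and]
    exact ⟨fun ⟨i, hi⟩ => hi ▸ (e i).2, fun hx => ⟨e.symm ⟨x, hx⟩, by simp⟩⟩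
  exact ⟨koszulCocat_isDGCocategory k, koszulCocat_isConnected k,
    fun t s f m e => koszul_Δ_wedge k f _ (hinj e) (himg e), treeCat_bar_isDGCocategory k,
    treeCat_bar_isConnected k, fun t s f m e => kappaBar_wedge k f _ (hinj e) (himg e),
    kappaBar_isSubcocategory k, treeCat_isConnected k, cobarCat_isConnected k,
    cobar_isMinimalResolution k⟩
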